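/- Let $\ell\ge 1$ and let $G_\ell$ be a second countable locally compact (Hausdorff) group satisfying the dual orbit condition of depth $\ell$, with the following fixed data. There are closed subgroups $G_j,H_j,V_j,Q_j$ ($j=1,\dots,\ell$) of $G_\ell$ and characters $\xi_{0,j}\in\hat V_j$ such that $V_j$ is abelian and $G_j=H_j\ltimes V_j$ (topological semidirect product). Write $h^\flat\xi$ for the dual action of $h\in H_j$ on $\hat V_j$, $\langle h^\flat\xi,v\rangle=\langle\xi,h^{-1}vh\rangle$. Then: (a) for $j=1$: $Q_1=H_1$ and the map $H_1\to\hat V_1$, $q\mapsto q^\flat\xi_{0,1}$, is an isomorphism of the Haar measure classes; (b) for $2\le j\le\ell$: the $H_j$-orbit of $\xi_{0,j}$ has full Haar measure in $\hat V_j$; the stabilizer of $\xi_{0,j}$ in $H_j$ is $G_{j-1}$; $(Q_j,G_{j-1})$ is a matched pair for $H_j$, i.e. $Q_j\cap G_{j-1}=\{e\}$ and $Q_jG_{j-1}$ has full Haar measure in $H_j$; and $H_{j-1}$ normalizes $Q_j$. Put $G_0=\{e\}$. Let $N_\ell$ be the closed subgroup $V_\ell V_{\ell-1}\cdots V_1$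 of $G_\ell$ generated by $V_\ell,\dots,V_1$ and let $\chi_\ell\colon N_\ell\to\mathbb T$ be the unitary character $$\chi_\ell(v_\ell\cdots v_1)=\langle\xi_{0,\ell},v_\ell\rangle\cdots\langle\xi_{0,1},v_1\rangle,\qquad v_j\in V_j.$$ Let $\pi_\ell=\operatorname{Ind}_{N_\ell}^{G_\ell}(\chi_\ell)$. Define the Mackey representations inductively: $\tilde\pi_0$ is the trivial one-dimensional representation of $G_0$ and, for $1\le j\le\ell$, $$\tilde\pi_j=\operatorname{Ind}_{G_{j-1}\ltimes V_j}^{G_j}(\tilde\pi_{j-1}\otimes\xi_{0,j}),\qquad(\tilde\pi_{j-1}\otimes\xi_{0,j})(vg)=\langle\xi_{0,j},v\rangle\,\tilde\pi_{j-1}(g)\quad(g\in G_{j-1},\ v\in V_j),$$ so that $\tilde\pi_1=\operatorname{Ind}_{V_1}^{G_1}(\xi_{0,1})$. Here $\operatorname{Ind}$ denotes unitary (normalized) induction from a closed subgroup. Then the unitary representations $\pi_\ell$ and $\tilde\pi_\ell$ of $G_\ell$ are unitarily equivalent. -/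

import Mathlib

universe u v

open MeasureTheory MeasureTheory.Measure Topology Filter
open scoped ENNReal NNReal Pointwise

/-! ### Unitary representations -/

/-- A homomorphism from a group `G` to the unitary group of a complex Hilbert space. -/
structure UnitaryRep (G : Type u) [Group G] : Type (max u (v + 1)) where
  space : Type v
  [normedAddCommGroup : NormedAddCommGroup space]
  [innerProductSpace : InnerProductSpace ℂ space]
  [completeSpace : CompleteSpace space]
  hom : G →* (space ≃ₗᵢ[ℂ] space)

attribute [instance] UnitaryRep.normedAddCommGroup UnitaryRep.innerProductSpace
  UnitaryRep.completeSpace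

namespace UnitaryRep

/-- Unitary equivalence: a surjective linear isometry intertwining the two representations. -/
def UnitarilyEquivalent {G : Type*} [Group G] (π₁ π₂ : UnitaryRep G) : Prop :=
  ∃ U : π₁.space ≃ₗᵢ[ℂ] π₂.space, ∀ (g : G) (x : π₁.space), U (π₁.hom g x) = π₂.hom g (U x)

/-- Multiplication by complex numbers of modulus one, as unitary operators. -/
noncomputable def scalar (E : Type*) [NormedAddCommGroup E] [InnerProductSpace ℂ E] :
    Circle →* (E ≃ₗᵢ[ℂ] E) where
  toFun z :=
    { toFun := fun x => (z : ℂ) • x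
      invFun := fun x => (z : ℂ)⁻¹ • x
      map_add' := fun x y => smul_add _ x y
      map_smul' := fun c x => smul_comm _ c x
      left_inv := fun x => inv_smul_smul₀ (Circle.coe_ne_zero z) x
      right_inv := fun x => smul_inv_smul₀ (Circle.coe_ne_zero z) x
      norm_map' := fun x => by
        change ‖(z : ℂ) • x‖ = ‖x‖
        rw [norm_smul, Circle.norm_coe, one_mul] }
  map_one' := by
    ext x
    change ((1 : Circle) : ℂ) • x = x
    rw [Circle.coe_one, one_smul]
  map_mul' z w := by
    ext x
    change ((z * w : Circle) : ℂ) • x = (z : ℂ) • (w : ℂ) • x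
    rw [smul_smul, Circle.coe_mul]

/-- A unitary character, as a unitary representation on `ℂ`. -/
noncomputable def ofCharacter {G : Type*} [Group G] (χ : G →* Circle) : UnitaryRep G where
  space := ℂ
  hom := (scalar ℂ).comp χ

/-- The trivial representation on a one-dimensional Hilbert space (in the universe of `G`). -/
noncomputable def trivial (G : Type u) [Group G] : UnitaryRep.{u, u} G where
  space := EuclideanSpace ℂ PUnit.{u + 1}
  hom := 1

end UnitaryRep

set_option linter.unusedSectionVars false

/-! ### Induced representations -/

section Induction

variable {K L : Type*}
  [Group K] [TopologicalSpace K] [IsTopologicalGroup K] [LocallyCompactSpace K]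
  [SecondCountableTopology K] [MeasurableSpace K] [BorelSpace K]
  [Group L] [TopologicalSpace L] [IsTopologicalGroup L] [LocallyCompactSpace L] [T2Space L]
  [SecondCountableTopology L] [MeasurableSpace L] [BorelSpace L]

/-- The modular function `Δ`, normalized by `∫ f (x * g) dx = Δ(g)⁻¹ ∫ f x dx` for a left-invariant
Haar measure `dx`. -/
noncomputable def modularFn {G : Type*} [Group G] [TopologicalSpace G] [IsTopologicalGroup G]
    [LocallyCompactSpace G] (g : G) : ℝ≥0 :=
  (modularCharacterFun g)⁻¹

theorem lintegral_mul_right_eq_modularFn {G : Type*} [Group G] [TopologicalSpace G]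
    [IsTopologicalGroup G] [LocallyCompactSpace G] [SecondCountableTopology G]
    [MeasurableSpace G] [BorelSpace G] (f : G → ℝ≥0∞) (g : G) :
    ∫⁻ x, f (x * g) ∂(haar : Measure G) = ((modularFn g)⁻¹ : ℝ≥0) * ∫⁻ x, f x ∂haar := by
  have h : map (· * g) (haar : Measure G) = modularCharacterFun g • haar := by
    rw [modularCharacterFun_eq_haarScalarFactor haar]
    exact isMulLeftInvariant_eq_smul _ _
  rw [modularFn, inv_inv]
  have h2 : ∫⁻ x, f x ∂(map (· * g) (haar : Measure G)) = ∫⁻ x, f (x * g) ∂haar :=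
    lintegral_map_equiv f (MeasurableEquiv.mulRight g)
  rw [← h2, h]
  rw [lintegral_smul_measure]
  rfl

theorem modularFn_pos {G : Type*} [Group G] [TopologicalSpace G] [IsTopologicalGroup G]
    [LocallyCompactSpace G] (g : G) : 0 < modularFn g :=
  inv_pos.2 (modularCharacterFun_pos g)

theorem modularFn_inv {G : Type*} [Group G] [TopologicalSpace G] [IsTopologicalGroup G]
    [LocallyCompactSpace G] (g : G) : modularFn g⁻¹ = (modularFn g)⁻¹ := by
  have h : modularCharacterFun g * modularCharacterFun g⁻¹ = 1 := by
    rw [← modularCharacterFun_map_mul, mul_inv_cancel, modularCharacterFun_map_one]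
  rw [modularFn, modularFn, inv_inv]
  exact (eq_inv_of_mul_eq_one_left h).symm

section Inversion

variable {G : Type*} [Group G] [TopologicalSpace G] [IsTopologicalGroup G] [LocallyCompactSpace G]
  [SecondCountableTopology G] [MeasurableSpace G] [BorelSpace G]

theorem exists_lintegral_ne (G : Type*) [Group G] [TopologicalSpace G] [IsTopologicalGroup G]
    [LocallyCompactSpace G] [SecondCountableTopology G] [MeasurableSpace G] [BorelSpace G] :
    ∃ ψ : G → ℝ≥0∞, Measurable ψ ∧ ∫⁻ x, ψ x ∂(haar : Measure G) ≠ 0 ∧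
      ∫⁻ x, ψ x ∂(haar : Measure G) ≠ ∞ := by
  obtain ⟨C, hC, h1⟩ := exists_compact_mem_nhds (1 : G)
  have hcl : closure C ∈ 𝓝 (1 : G) := mem_of_superset h1 subset_closure
  have hm : MeasurableSet (closure C) := isClosed_closure.measurableSet
  refine ⟨(closure C).indicator 1, measurable_one.indicator hm, ?_, ?_⟩
  · rw [lintegral_indicator_one hm]
    exact (measure_pos_of_mem_nhds haar hcl).ne'
  · rw [lintegral_indicator_one hm]
    exact hC.closure.measure_lt_top.ne

theorem measurable_modularFn_inv :
    Measurable fun g : G => (((modularFn g)⁻¹ : ℝ≥0) : ℝ≥0∞) := by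
  obtain ⟨ψ, hψ, h0, ht⟩ := exists_lintegral_ne G
  have h : (fun g : G => (((modularFn g)⁻¹ : ℝ≥0) : ℝ≥0∞)) =
      fun g => (∫⁻ x, ψ (x * g) ∂(haar : Measure G)) / ∫⁻ x, ψ x ∂(haar : Measure G) := by
    ext g
    rw [lintegral_mul_right_eq_modularFn, ENNReal.mul_div_cancel_right h0 ht]
  rw [h]
  refine Measurable.div_const ?_ _
  refine Measurable.lintegral_prod_left' (f := fun p : G × G => ψ (p.1 * p.2)) ?_
  exact hψ.comp measurable_mul

theorem lintegral_modularFn_inv_mul {φ : G → ℝ≥0∞} (hφ : Measurable φ) :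
    ∫⁻ g, ((modularFn g)⁻¹ : ℝ≥0) * φ g⁻¹ ∂(haar : Measure G) = ∫⁻ g, φ g ∂haar := by
  obtain ⟨ψ, hψ, h0, ht⟩ := exists_lintegral_ne G
  have hi : Measurable fun g : G => φ g⁻¹ := hφ.comp measurable_inv
  have hp : Measurable fun g : G => (((modularFn g)⁻¹ : ℝ≥0) : ℝ≥0∞) * φ g⁻¹ :=
    measurable_modularFn_inv.mul hi
  have hψr : ∀ g, Measurable fun x : G => ψ (x * g) := fun g =>
    hψ.comp (measurable_mul_const g)
  have hφl : ∀ g, Measurable fun x : G => φ (g * x) := fun g =>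
    hφ.comp (measurable_const_mul g)
  refine (ENNReal.mul_right_inj h0 ht).1 ?_
  calc (∫⁻ x, ψ x ∂(haar : Measure G)) * ∫⁻ g, ((modularFn g)⁻¹ : ℝ≥0) * φ g⁻¹ ∂(haar : Measure G)
      = ∫⁻ g, ∫⁻ x, φ g⁻¹ * ψ (x * g) ∂(haar : Measure G) ∂(haar : Measure G) := by
        rw [← lintegral_const_mul _ hp]
        refine lintegral_congr fun g => ?_
        rw [lintegral_const_mul _ (hψr g),
          lintegral_mul_right_eq_modularFn]
        ring
    _ = ∫⁻ x, ∫⁻ g, φ g⁻¹ * ψ (x * g) ∂(haar : Measure G) ∂(haar : Measure G) := by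
        refine lintegral_lintegral_swap ?_
        exact ((hi.comp measurable_fst).mul
          (hψ.comp (measurable_snd.mul measurable_fst))).aemeasurable
    _ = ∫⁻ x, ∫⁻ g, φ (g⁻¹ * x) * ψ g ∂(haar : Measure G) ∂(haar : Measure G) := by
        refine lintegral_congr fun x => ?_
        have h := lintegral_mul_left_eq_self (μ := (haar : Measure G))
          (fun g => φ (g⁻¹ * x) * ψ g) x
        rw [← h]
        refine lintegral_congr fun g => ?_
        rw [mul_inv_rev, inv_mul_cancel_right]
    _ = ∫⁻ g, ∫⁻ x, φ (g⁻¹ * x) * ψ g ∂(haar : Measure G) ∂(haar : Measure G) := by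
        refine lintegral_lintegral_swap ?_
        exact ((hφ.comp (measurable_snd.inv.mul measurable_fst)).mul
          (hψ.comp measurable_snd)).aemeasurable
    _ = (∫⁻ x, ψ x ∂(haar : Measure G)) * ∫⁻ g, φ g ∂haar := by
        rw [← lintegral_mul_const _ hψ]
        refine lintegral_congr fun g => ?_
        rw [lintegral_mul_const _ (hφl g⁻¹),
          lintegral_mul_left_eq_self, mul_comm]

end Inversion

/-- A Bruhat function for a closed subgroup `ι : K → L`: a weight on `L` whose integral over every
coset `xK` is one. Integration over `L` against it plays the role of integration over `L ⧸ K`. -/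
structure IsBruhat (ι : K →* L) (b : L → ℝ≥0∞) : Prop where
  measurable : Measurable b
  ne_zero : ∀ x, b x ≠ 0
  ne_top : ∀ x, b x ≠ ∞
  lintegral_eq_one : ∀ x, ∫⁻ k, b (x * ι k) ∂(haar : Measure K) = 1

theorem exists_isBruhat (ι : K →* L) (hι : IsClosedEmbedding ι) : ∃ b, IsBruhat ι b := by
  obtain ⟨C, hC1, hCcl, hCc⟩ : ∃ C : Set L, C ∈ 𝓝 1 ∧ IsClosed C ∧ IsCompact C := by
    obtain ⟨C, hC, h1⟩ := exists_compact_mem_nhds (1 : L)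
    exact ⟨C, h1, hC.isClosed, hC⟩
  set d : ℕ → L := TopologicalSpace.denseSeq L with hd
  set S : ℕ → Set L := fun n => (fun x => (d n)⁻¹ * x) ⁻¹' C with hS
  have hSm : ∀ n, MeasurableSet (S n) := fun n =>
    (hCcl.preimage (continuous_const_mul _)).measurableSet
  set w : L → ℝ≥0∞ := fun x => ∑' n : ℕ, (2⁻¹ : ℝ≥0∞) ^ (n + 1) * (S n).indicator 1 x with hw
  have hwm : Measurable w := by
    refine Measurable.tsum fun n => ?_
    exact measurable_const.mul (measurable_one.indicator (hSm n))
  have hgeom : ∑' n : ℕ, (2⁻¹ : ℝ≥0∞) ^ (n + 1) = 1 := by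
    rw [ENNReal.tsum_geometric_add_one, ENNReal.one_sub_inv_two, inv_inv]
    exact ENNReal.inv_mul_cancel two_ne_zero ENNReal.ofNat_ne_top
  have hw1 : ∀ x, w x ≤ 1 := fun x => by
    rw [← hgeom]
    refine ENNReal.tsum_le_tsum fun n => ?_
    refine mul_le_of_le_one_right' ?_
    exact Set.indicator_le_self' (fun _ _ => zero_le) x
  have hw0 : ∀ x, w x ≠ 0 := fun x h => by
    have hnb : {y : L | y⁻¹ * x ∈ C} ∈ 𝓝 x := by
      have : ContinuousAt (fun y : L => y⁻¹ * x) x := by fun_prop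
      exact this (by simpa using hC1)
    obtain ⟨y, hy, n, rfl⟩ :=
      mem_closure_iff_nhds.1 (TopologicalSpace.denseRange_denseSeq L x) _ hnb
    have hn := ENNReal.tsum_eq_zero.1 h n
    have hmem : x ∈ S n := hy
    rw [Set.indicator_of_mem hmem, Pi.one_apply, mul_one] at hn
    exact pow_ne_zero _ (ENNReal.inv_ne_zero.2 ENNReal.ofNat_ne_top) hn
  set M : ℝ≥0∞ := (haar : Measure K) (ι ⁻¹' (C⁻¹ * C)) with hM
  have hMt : M ≠ ∞ := (hι.isCompact_preimage (hCc.inv.mul hCc)).measure_lt_top.ne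
  set I : L → ℝ≥0∞ := fun x => ∫⁻ k, w (x * ι k) ∂(haar : Measure K) with hI
  have hmul : ∀ x, Measurable fun k : K => x * ι k := fun x =>
    (continuous_const.mul hι.continuous).measurable
  have hwx : ∀ x, Measurable fun k : K => w (x * ι k) := fun x => hwm.comp (hmul x)
  have hSx : ∀ x n, Measurable fun k : K => (S n).indicator (1 : L → ℝ≥0∞) (x * ι k) :=
    fun x n => (measurable_one.indicator (hSm n)).comp (hmul x)
  have hIt : ∀ x, I x ≠ ∞ := fun x => by
    have hle : ∀ n, haar {k : K | x * ι k ∈ S n} ≤ M := fun n => by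
      by_cases hne : ∃ k₀ : K, x * ι k₀ ∈ S n
      · obtain ⟨k₀, hk₀⟩ := hne
        rw [hM, ← measure_preimage_mul haar k₀⁻¹ (ι ⁻¹' (C⁻¹ * C))]
        refine measure_mono fun k hk => ?_
        refine Set.mem_mul.2 ⟨((d n)⁻¹ * (x * ι k₀))⁻¹, Set.inv_mem_inv.2 hk₀,
          (d n)⁻¹ * (x * ι k), hk, ?_⟩
        change _ = ι (k₀⁻¹ * k)
        rw [map_mul, map_inv]
        group
      · have : {k : K | x * ι k ∈ S n} = ∅ := by
          ext k
          exact ⟨fun h => hne ⟨k, h⟩, fun h => h.elim⟩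
        rw [this]
        simp
    have : I x ≤ M := by
      rw [hI]
      simp only [hw]
      rw [lintegral_tsum fun n => ((hSx x n).const_mul _).aemeasurable]
      calc ∑' n : ℕ, ∫⁻ k, (2⁻¹ : ℝ≥0∞) ^ (n + 1) * (S n).indicator 1 (x * ι k) ∂(haar : Measure K)
          ≤ ∑' n : ℕ, (2⁻¹ : ℝ≥0∞) ^ (n + 1) * M := by
            refine ENNReal.tsum_le_tsum fun n => ?_
            rw [lintegral_const_mul _ (hSx x n)]
            gcongr
            refine le_trans (le_of_eq ?_) (hle n)
            exact lintegral_indicator_one (hmul x (hSm n))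
        _ = M := by rw [ENNReal.tsum_mul_right, hgeom, one_mul]
    exact ne_top_of_le_ne_top hMt this
  have hI0 : ∀ x, I x ≠ 0 := fun x h => by
    replace h := (lintegral_eq_zero_iff (hwx x)).1 h
    have h' : ∀ᵐ k ∂(haar : Measure K), False := h.mono fun k hk => hw0 _ hk
    exact (NeZero.ne (haar : Measure K)) (ae_eq_bot.1 (eventually_false_iff_eq_bot.1 h'))
  have hIinv : ∀ x k, I (x * ι k) = I x := fun x k => by
    simp only [hI, mul_assoc, ← map_mul]
    exact lintegral_mul_left_eq_self (fun k' => w (x * ι k')) k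
  have hIm : Measurable I := by
    refine Measurable.lintegral_prod_right' (f := fun p : L × K => w (p.1 * ι p.2)) ?_
    exact hwm.comp (continuous_fst.mul (hι.continuous.comp continuous_snd)).measurable
  refine ⟨fun x => w x / I x, hwm.div hIm, fun x => ?_, fun x => ?_, fun x => ?_⟩
  · exact ENNReal.div_ne_zero.2 ⟨hw0 x, hIt x⟩
  · exact ENNReal.div_ne_top (ne_top_of_le_ne_top ENNReal.one_ne_top (hw1 x)) (hI0 x)
  · simp only [hIinv, div_eq_mul_inv]
    rw [lintegral_mul_const _ (hwx x)]
    exact ENNReal.mul_inv_cancel (hI0 x) (hIt x)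

theorem IsBruhat.translate {ι : K →* L} {b : L → ℝ≥0∞} (hb : IsBruhat ι b) (g : L) :
    IsBruhat ι fun x => b (g * x) where
  measurable := hb.measurable.comp (measurable_const_mul g)
  ne_zero x := hb.ne_zero _
  ne_top x := hb.ne_top _
  lintegral_eq_one x := by simpa only [mul_assoc] using hb.lintegral_eq_one (g * x)

/-- The weighted integral of a function which transforms under right translation by `K` like a
density on `L ⧸ K` does not depend on the Bruhat function. -/
theorem IsBruhat.lintegral_eq {ι : K →* L} (hι : Continuous ι) {b b' : L → ℝ≥0∞}
    (hb : IsBruhat ι b) (hb' : IsBruhat ι b') {F : L → ℝ≥0∞} (hF : Measurable F)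
    (hcov : ∀ k : K, ∀ᵐ x ∂(haar : Measure L),
      F (x * ι k) = ((modularFn k / modularFn (ι k) : ℝ≥0) : ℝ≥0∞) * F x) :
    ∫⁻ x, b' x * F x ∂(haar : Measure L) = ∫⁻ x, b x * F x ∂haar := by
  have hm : Measurable fun p : L × K => p.1 * ι p.2 :=
    (continuous_fst.mul (hι.comp continuous_snd)).measurable
  have hm' : Measurable fun p : L × K => p.1 * ι p.2⁻¹ :=
    (continuous_fst.mul (hι.comp continuous_snd.inv)).measurable
  have hbm : ∀ x, Measurable fun k : K => b (x * ι k) := fun x =>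
    hb.measurable.comp (continuous_const.mul hι).measurable
  have hinv : Measurable fun k : K => (((modularFn k)⁻¹ : ℝ≥0) : ℝ≥0∞) := measurable_modularFn_inv
  calc ∫⁻ x, b' x * F x ∂(haar : Measure L)
      = ∫⁻ x, ∫⁻ k, b' x * F x * b (x * ι k) ∂(haar : Measure K) ∂(haar : Measure L) := by
        refine lintegral_congr fun x => ?_
        rw [lintegral_const_mul _ (hbm x),
          hb.lintegral_eq_one, mul_one]
    _ = ∫⁻ k, ∫⁻ x, b' x * F x * b (x * ι k) ∂(haar : Measure L) ∂(haar : Measure K) := by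
        refine lintegral_lintegral_swap ?_
        exact (((hb'.measurable.comp measurable_fst).mul (hF.comp measurable_fst)).mul
          (hb.measurable.comp hm)).aemeasurable
    _ = ∫⁻ k, ∫⁻ x, b x * F x * (((modularFn k)⁻¹ : ℝ≥0) * b' (x * ι k⁻¹))
          ∂(haar : Measure L) ∂(haar : Measure K) := by
        refine lintegral_congr fun k => ?_
        have h := lintegral_mul_right_eq_modularFn
          (fun x => b' (x * ι k⁻¹) * F (x * ι k⁻¹) * b x) (ι k)
        simp only [mul_assoc _ (ι k), ← map_mul, mul_inv_cancel, map_one, mul_one] at h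
        rw [h, ← lintegral_const_mul' _ _ ENNReal.coe_ne_top]
        refine lintegral_congr_ae ?_
        filter_upwards [hcov k⁻¹] with x hx
        rw [hx]
        have : ((modularFn (ι k))⁻¹ * (modularFn k⁻¹ / modularFn (ι k⁻¹)) : ℝ≥0)
            = (modularFn k)⁻¹ := by
          rw [map_inv, modularFn_inv, modularFn_inv]
          have := (modularFn_pos (ι k)).ne'
          have := (modularFn_pos k).ne'
          field_simp
        rw [← this, ENNReal.coe_mul]
        ring
    _ = ∫⁻ x, ∫⁻ k, b x * F x * (((modularFn k)⁻¹ : ℝ≥0) * b' (x * ι k⁻¹))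
          ∂(haar : Measure K) ∂(haar : Measure L) := by
        refine lintegral_lintegral_swap (μ := (haar : Measure K)) (ν := (haar : Measure L))
          (f := fun k x => b x * F x * (((modularFn k)⁻¹ : ℝ≥0) * b' (x * ι k⁻¹))) ?_
        exact (((hb.measurable.comp measurable_snd).mul (hF.comp measurable_snd)).mul
          ((hinv.comp measurable_fst).mul
            (hb'.measurable.comp (hm'.comp measurable_swap)))).aemeasurable
    _ = ∫⁻ x, b x * F x ∂haar := by
        refine lintegral_congr fun x => ?_
        have hx : Measurable fun k : K => b' (x * ι k) :=
          hb'.measurable.comp (continuous_const.mul hι).measurable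
        have hp : Measurable fun k : K => (((modularFn k)⁻¹ : ℝ≥0) : ℝ≥0∞) * b' (x * ι k⁻¹) :=
          hinv.mul (hx.comp measurable_inv)
        rw [lintegral_const_mul _ hp,
          lintegral_modularFn_inv_mul hx, hb'.lintegral_eq_one, mul_one]

/-- The measure `b(x) dx` on `L`, where `b` is a Bruhat function for `K` and `dx` is Haar measure. -/
noncomputable def indMeasure (ι : K →* L) (hι : IsClosedEmbedding ι) : Measure L :=
  (haar : Measure L).withDensity (exists_isBruhat ι hι).choose

theorem ae_indMeasure (ι : K →* L) (hι : IsClosedEmbedding ι) :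
    ae (indMeasure ι hι) = ae (haar : Measure L) := by
  have hb := (exists_isBruhat ι hι).choose_spec
  refine le_antisymm (withDensity_absolutelyContinuous _ _).ae_le ?_
  exact (withDensity_absolutelyContinuous' hb.measurable.aemeasurable
    (ae_of_all _ hb.ne_zero)).ae_le

theorem lintegral_indMeasure (ι : K →* L) (hι : IsClosedEmbedding ι) (F : L → ℝ≥0∞) :
    ∫⁻ x, F x ∂(indMeasure ι hι) = ∫⁻ x, (exists_isBruhat ι hι).choose x * F x ∂haar := by
  have hb := (exists_isBruhat ι hι).choose_spec
  exact lintegral_withDensity_eq_lintegral_mul_non_measurable _ hb.measurable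
    (ae_of_all _ fun x => (hb.ne_top x).lt_top) F

theorem ae_haar_of_mul_right {p : L → Prop} (h : ∀ᵐ x ∂(haar : Measure L), p x) (g : L) :
    ∀ᵐ x ∂(haar : Measure L), p (x * g) :=
  (quasiMeasurePreserving_mul_right (haar : Measure L) g).ae h

theorem ae_haar_of_mul_left {p : L → Prop} (h : ∀ᵐ x ∂(haar : Measure L), p x) (g : L) :
    ∀ᵐ x ∂(haar : Measure L), p (g * x) :=
  (measurePreserving_mul_left (haar : Measure L) g).quasiMeasurePreserving.ae h

theorem quasiMeasurePreserving_indMeasure (ι : K →* L) (hι : IsClosedEmbedding ι) (g : L) :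
    QuasiMeasurePreserving (fun x => g * x) (indMeasure ι hι) (indMeasure ι hι) := by
  refine ⟨measurable_const_mul g, AbsolutelyContinuous.mk fun s hs h0 => ?_⟩
  have h1 : ∀ᵐ x ∂(indMeasure ι hι), x ∉ s := measure_eq_zero_iff_ae_notMem.1 h0
  rw [ae_indMeasure] at h1
  have h2 := ae_haar_of_mul_left h1 g
  rw [← ae_indMeasure ι hι] at h2
  rw [map_apply (measurable_const_mul g) hs]
  exact measure_eq_zero_iff_ae_notMem.2 h2

/-- The covariance condition `f (x k) = (Δ_K(k) / Δ_L(k))^{1/2} σ(k)⁻¹ f x` defining the induced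
representation: for every `k` in `K`, at almost every `x` in `L`. -/
def IsCovariant (ι : K →* L) (σ : UnitaryRep K) (f : L → σ.space) : Prop :=
  ∀ k : K, ∀ᵐ x ∂(haar : Measure L),
    f (x * ι k) = ((NNReal.sqrt (modularFn k / modularFn (ι k)) : ℝ) : ℂ) • (σ.hom k)⁻¹ (f x)

theorem IsCovariant.congr {ι : K →* L} {σ : UnitaryRep K} {f f' : L → σ.space}
    (hf : IsCovariant ι σ f) (h : f =ᵐ[haar] f') : IsCovariant ι σ f' := fun k => by
  filter_upwards [hf k, h, ae_haar_of_mul_right h (ι k)] with x h1 h2 h3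
  rw [← h2, ← h3, h1]

theorem IsCovariant.translate {ι : K →* L} {σ : UnitaryRep K} {f : L → σ.space}
    (hf : IsCovariant ι σ f) (g : L) : IsCovariant ι σ fun x => f (g * x) := fun k => by
  filter_upwards [ae_haar_of_mul_left (hf k) g] with x h1
  rw [← mul_assoc, h1]

theorem IsCovariant.eLpNorm_translate {ι : K →* L} (hι : IsClosedEmbedding ι) {σ : UnitaryRep K}
    {f : L → σ.space} (hf : IsCovariant ι σ f) (hm : StronglyMeasurable f) (g : L) :
    eLpNorm (fun x => f (g * x)) 2 (indMeasure ι hι) = eLpNorm f 2 (indMeasure ι hι) := by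
  have hb := (exists_isBruhat ι hι).choose_spec
  set b := (exists_isBruhat ι hι).choose with hbdef
  rw [eLpNorm_eq_lintegral_rpow_enorm_toReal two_ne_zero ENNReal.ofNat_ne_top,
    eLpNorm_eq_lintegral_rpow_enorm_toReal two_ne_zero ENNReal.ofNat_ne_top,
    lintegral_indMeasure, lintegral_indMeasure, ← hbdef]
  congr 1
  set F : L → ℝ≥0∞ := fun x => ‖f x‖ₑ ^ (2 : ℝ≥0∞).toReal with hF
  have hFm : Measurable F := hm.enorm.pow_const _
  have hcov : ∀ k : K, ∀ᵐ x ∂(haar : Measure L),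
      F (x * ι k) = ((modularFn k / modularFn (ι k) : ℝ≥0) : ℝ≥0∞) * F x := fun k => by
    filter_upwards [hf k] with x hx
    have h1 : ‖(σ.hom k)⁻¹ (f x)‖ₑ = ‖f x‖ₑ := LinearIsometryEquiv.enorm_map _ _
    have h2 : ‖((NNReal.sqrt (modularFn k / modularFn (ι k)) : ℝ) : ℂ)‖ₑ =
        (NNReal.sqrt (modularFn k / modularFn (ι k)) : ℝ≥0∞) := by
      rw [← ofReal_norm, Complex.norm_real, Real.norm_of_nonneg (NNReal.coe_nonneg _),
        ENNReal.ofReal_coe_nnreal]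
    simp only [hF, hx, enorm_smul, h1, h2, ENNReal.toReal_ofNat, ENNReal.rpow_ofNat, mul_pow]
    rw [← ENNReal.coe_pow, NNReal.sq_sqrt]
  have h3 : ∫⁻ x, b (g⁻¹ * x) * F x ∂(haar : Measure L) = ∫⁻ x, b x * F (g * x) ∂haar := by
    rw [← lintegral_mul_left_eq_self (fun x => b (g⁻¹ * x) * F x) g]
    simp only [inv_mul_cancel_left]
  rw [← hb.lintegral_eq hι.continuous (hb.translate g⁻¹) hFm hcov, h3]

/-- The Hilbert space of the induced representation: classes of covariant measurable functions
`f : L → σ.space` with `∫ b(x) ‖f x‖² dx < ∞`. -/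
noncomputable def indSpace (ι : K →* L) (hι : IsClosedEmbedding ι) (σ : UnitaryRep K) :
    Submodule ℂ (Lp σ.space 2 (indMeasure ι hι)) where
  carrier := {f | IsCovariant ι σ f}
  add_mem' {f f'} hf hf' := by
    have h : (f + f' : Lp σ.space 2 (indMeasure ι hι)) =ᵐ[haar] fun x => f x + f' x := by
      have := Lp.coeFn_add f f'
      rwa [EventuallyEq, ae_indMeasure] at this
    refine IsCovariant.congr (f := fun x => f x + f' x) (fun k => ?_) h.symm
    filter_upwards [hf k, hf' k] with x h1 h2
    rw [h1, h2, map_add, smul_add]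
  zero_mem' := by
    have h : (0 : Lp σ.space 2 (indMeasure ι hι)) =ᵐ[haar] fun _ => 0 := by
      have := Lp.coeFn_zero σ.space 2 (indMeasure ι hι)
      rwa [EventuallyEq, ae_indMeasure] at this
    refine IsCovariant.congr (f := fun _ => 0) (fun k => ?_) h.symm
    exact ae_of_all _ fun x => by rw [map_zero, smul_zero]
  smul_mem' c f hf := by
    have h : (c • f : Lp σ.space 2 (indMeasure ι hι)) =ᵐ[haar] fun x => c • f x := by
      have := Lp.coeFn_smul c f
      rwa [EventuallyEq, ae_indMeasure] at this
    refine IsCovariant.congr (f := fun x => c • f x) (fun k => ?_) h.symm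
    filter_upwards [hf k] with x h1
    rw [h1, map_smul, smul_comm]

theorem isClosed_indSpace (ι : K →* L) (hι : IsClosedEmbedding ι) (σ : UnitaryRep K) :
    IsClosed (indSpace ι hι σ : Set (Lp σ.space 2 (indMeasure ι hι))) := by
  refine IsSeqClosed.isClosed fun u f hu hlim => ?_
  obtain ⟨ns, -, hns⟩ := (tendstoInMeasure_of_tendsto_Lp hlim).exists_seq_tendsto_ae
  rw [ae_indMeasure] at hns
  intro k
  have hall : ∀ᵐ x ∂(haar : Measure L), ∀ n, u (ns n) (x * ι k) =
      ((NNReal.sqrt (modularFn k / modularFn (ι k)) : ℝ) : ℂ) • (σ.hom k)⁻¹ (u (ns n) x) :=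
    ae_all_iff.2 fun n => hu (ns n) k
  filter_upwards [hns, ae_haar_of_mul_right hns (ι k), hall] with x h1 h2 h3
  refine tendsto_nhds_unique h2 ?_
  simp only [h3]
  exact ((((σ.hom k)⁻¹).continuous.tendsto _).comp h1).const_smul _

/-- Left translation by `g`, `f ↦ f (g⁻¹ ·)`, on the space of the induced representation. -/
noncomputable def indTranslate (ι : K →* L) (hι : IsClosedEmbedding ι) (σ : UnitaryRep K) (g : L)
    (f : indSpace ι hι σ) : indSpace ι hι σ :=
  ⟨⟨AEEqFun.compQuasiMeasurePreserving (f : Lp σ.space 2 (indMeasure ι hι)).1 (fun x => g⁻¹ * x)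
      (quasiMeasurePreserving_indMeasure ι hι g⁻¹), by
    rw [Lp.mem_Lp_iff_eLpNorm_lt_top, eLpNorm_congr_ae (AEEqFun.coeFn_compQuasiMeasurePreserving _ _)]
    refine lt_of_eq_of_lt (f.2.eLpNorm_translate hι (Lp.stronglyMeasurable _) g⁻¹) ?_
    exact Lp.eLpNorm_lt_top _⟩, by
    have h := AEEqFun.coeFn_compQuasiMeasurePreserving (f : Lp σ.space 2 (indMeasure ι hι)).1
      (quasiMeasurePreserving_indMeasure ι hι g⁻¹)
    rw [EventuallyEq, ae_indMeasure] at h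
    exact (f.2.translate g⁻¹).congr (EventuallyEq.symm h)⟩

theorem coeFn_indTranslate (ι : K →* L) (hι : IsClosedEmbedding ι) (σ : UnitaryRep K) (g : L)
    (f : indSpace ι hι σ) :
    (indTranslate ι hι σ g f : Lp σ.space 2 (indMeasure ι hι)) =ᵐ[haar]
      fun x => (f : Lp σ.space 2 (indMeasure ι hι)) (g⁻¹ * x) := by
  rw [EventuallyEq, ← ae_indMeasure ι hι]
  exact AEEqFun.coeFn_compQuasiMeasurePreserving (f : Lp σ.space 2 (indMeasure ι hι)).1
    (quasiMeasurePreserving_indMeasure ι hι g⁻¹)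

theorem indSpace_ext {ι : K →* L} {hι : IsClosedEmbedding ι} {σ : UnitaryRep K}
    {f f' : indSpace ι hι σ} (h : (f : Lp σ.space 2 (indMeasure ι hι)) =ᵐ[haar]
      (f' : Lp σ.space 2 (indMeasure ι hι))) : f = f' := by
  rw [EventuallyEq, ← ae_indMeasure ι hι] at h
  exact Subtype.ext (Lp.ext h)

theorem indTranslate_one (ι : K →* L) (hι : IsClosedEmbedding ι) (σ : UnitaryRep K)
    (f : indSpace ι hι σ) : indTranslate ι hι σ 1 f = f := by
  refine indSpace_ext ((coeFn_indTranslate ι hι σ 1 f).trans (ae_of_all _ fun x => ?_))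
  simp only [inv_one, one_mul]

theorem indTranslate_mul (ι : K →* L) (hι : IsClosedEmbedding ι) (σ : UnitaryRep K) (g h : L)
    (f : indSpace ι hι σ) :
    indTranslate ι hι σ (g * h) f = indTranslate ι hι σ g (indTranslate ι hι σ h f) := by
  refine indSpace_ext ?_
  filter_upwards [coeFn_indTranslate ι hι σ (g * h) f,
    coeFn_indTranslate ι hι σ g (indTranslate ι hι σ h f),
    ae_haar_of_mul_left (coeFn_indTranslate ι hι σ h f) g⁻¹] with x h1 h2 h3
  rw [h1, h2, h3, mul_inv_rev, mul_assoc]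

/-- The unitarily induced representation `Ind_K^L σ` of a unitary representation `σ` of a closed
subgroup `ι : K → L`: the group `L` acts by left translation on the covariant functions. -/
noncomputable def UnitaryRep.ind (ι : K →* L) (hι : IsClosedEmbedding ι) (σ : UnitaryRep K) :
    UnitaryRep L where
  space := indSpace ι hι σ
  completeSpace := (isClosed_indSpace ι hι σ).completeSpace_coe
  hom :=
    { toFun := fun g =>
        { toFun := indTranslate ι hι σ g
          invFun := indTranslate ι hι σ g⁻¹
          map_add' := fun f f' => by
            refine indSpace_ext ?_
            have h1 := Lp.coeFn_add (f : Lp σ.space 2 (indMeasure ι hι)) f'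
            have h2 := Lp.coeFn_add (indTranslate ι hι σ g f : Lp σ.space 2 (indMeasure ι hι))
              (indTranslate ι hι σ g f')
            rw [EventuallyEq, ae_indMeasure] at h1 h2
            filter_upwards [coeFn_indTranslate ι hι σ g (f + f'), coeFn_indTranslate ι hι σ g f,
              coeFn_indTranslate ι hι σ g f', ae_haar_of_mul_left h1 g⁻¹, h2] with x e1 e2 e3 e4 e5
            rw [e1]
            refine e4.trans (Eq.trans ?_ e5.symm)
            rw [Pi.add_apply, Pi.add_apply, e2, e3]
          map_smul' := fun c f => by
            refine indSpace_ext ?_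
            have h1 := Lp.coeFn_smul c (f : Lp σ.space 2 (indMeasure ι hι))
            have h2 := Lp.coeFn_smul c (indTranslate ι hι σ g f : Lp σ.space 2 (indMeasure ι hι))
            rw [EventuallyEq, ae_indMeasure] at h1 h2
            filter_upwards [coeFn_indTranslate ι hι σ g (c • f), coeFn_indTranslate ι hι σ g f,
              ae_haar_of_mul_left h1 g⁻¹, h2] with x e1 e2 e4 e5
            rw [e1]
            refine e4.trans (Eq.trans ?_ e5.symm)
            rw [Pi.smul_apply, Pi.smul_apply, e2]
          left_inv := fun f => by
            rw [← indTranslate_mul, inv_mul_cancel, indTranslate_one]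
          right_inv := fun f => by
            rw [← indTranslate_mul, mul_inv_cancel, indTranslate_one]
          norm_map' := fun f => by
            change ‖(indTranslate ι hι σ g f : Lp σ.space 2 (indMeasure ι hι))‖ =
              ‖(f : Lp σ.space 2 (indMeasure ι hι))‖
            have h := coeFn_indTranslate ι hι σ g f
            rw [EventuallyEq, ← ae_indMeasure ι hι] at h
            rw [Lp.norm_def, Lp.norm_def, eLpNorm_congr_ae h]
            exact congrArg ENNReal.toReal
              (f.2.eLpNorm_translate hι (Lp.stronglyMeasurable _) g⁻¹) }
      map_one' := by
        ext1 f
        exact indTranslate_one ι hι σ f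
      map_mul' := fun g h => by
        ext1 f
        exact indTranslate_mul ι hι σ g h f }

end Induction

/-! ### Semidirect products and matched pairs of closed subgroups -/

section Subgroups

variable {Γ : Type*} [Group Γ] [TopologicalSpace Γ] [IsTopologicalGroup Γ]

/-- `Ind_K^L σ` for closed subgroups `K ≤ L` of a second countable locally compact group. -/
noncomputable def UnitaryRep.indSubgroup [LocallyCompactSpace Γ] [T2Space Γ]
    [SecondCountableTopology Γ] [MeasurableSpace Γ] [BorelSpace Γ] {K L : Subgroup Γ}
    (hKL : K ≤ L) (hK : IsClosed (K : Set Γ)) (hL : IsClosed (L : Set Γ)) (σ : UnitaryRep K) :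
    UnitaryRep L :=
  haveI : SecondCountableTopology K := IsEmbedding.subtypeVal.secondCountableTopology
  haveI : SecondCountableTopology L := IsEmbedding.subtypeVal.secondCountableTopology
  haveI : LocallyCompactSpace K := hK.isClosedEmbedding_subtypeVal.locallyCompactSpace
  haveI : LocallyCompactSpace L := hL.isClosedEmbedding_subtypeVal.locallyCompactSpace
  UnitaryRep.ind (Subgroup.inclusion hKL)
    (IsClosedEmbedding.of_comp_iff hL.isClosedEmbedding_subtypeVal |>.1
      hK.isClosedEmbedding_subtypeVal) σ

/-- Conjugation `v ↦ g v g⁻¹` by an element of the normalizer of `V`. -/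
def conjHom {V : Subgroup Γ} {g : Γ} (hg : g ∈ Subgroup.normalizer (V : Set Γ)) : V →ₜ* V where
  toFun v := ⟨g * v * g⁻¹, (Subgroup.mem_normalizer_iff.1 hg v).1 v.2⟩
  map_one' := by ext; simp
  map_mul' v w := by ext; simp
  continuous_toFun := by fun_prop

/-- `G` is the topological semidirect product `H ⋉ V` of its closed subgroups `H` and `V`: `H`
normalizes `V`, and `(v, h) ↦ v h` is a homeomorphism of `V × H` onto the closed subgroup `G`. -/
structure IsSemidirect (G H V : Subgroup Γ) : Prop where
  isClosed_left : IsClosed (H : Set Γ)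
  isClosed_right : IsClosed (V : Set Γ)
  le_normalizer : H ≤ Subgroup.normalizer (V : Set Γ)
  isClosedEmbedding : IsClosedEmbedding fun p : V × H => (p.1 : Γ) * (p.2 : Γ)
  range_eq : Set.range (fun p : V × H => (p.1 : Γ) * (p.2 : Γ)) = G

namespace IsSemidirect

variable {G H V : Subgroup Γ}

theorem isClosed (hS : IsSemidirect G H V) : IsClosed (G : Set Γ) :=
  hS.range_eq ▸ hS.isClosedEmbedding.isClosed_range

theorem left_le (hS : IsSemidirect G H V) : H ≤ G := fun h hh => by
  rw [← SetLike.mem_coe, ← hS.range_eq]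
  exact ⟨(1, ⟨h, hh⟩), one_mul h⟩

theorem right_le (hS : IsSemidirect G H V) : V ≤ G := fun v hv => by
  rw [← SetLike.mem_coe, ← hS.range_eq]
  exact ⟨(⟨v, hv⟩, 1), mul_one v⟩

/-- The semidirect product `K ⋉ V` inside `H ⋉ V`, for a closed subgroup `K` of `H`. -/
theorem sup_of_le (hS : IsSemidirect G H V) {K : Subgroup Γ} (hK : IsClosed (K : Set Γ))
    (hKH : K ≤ H) : IsSemidirect (K ⊔ V) K V where
  isClosed_left := hK
  isClosed_right := hS.isClosed_right
  le_normalizer := hKH.trans hS.le_normalizer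
  isClosedEmbedding := by
    have hi : IsClosedEmbedding (Subgroup.inclusion hKH) :=
      IsClosedEmbedding.of_comp_iff hS.isClosed_left.isClosedEmbedding_subtypeVal |>.1
        hK.isClosedEmbedding_subtypeVal
    exact hS.isClosedEmbedding.comp (IsClosedEmbedding.id.prodMap hi)
  range_eq := by
    rw [sup_comm, Subgroup.coe_mul_of_right_le_normalizer_left V K (hKH.trans hS.le_normalizer)]
    ext g
    simp [Set.mem_mul]

/-- The components of an element of `G = H ⋉ V`. -/
noncomputable def equiv (hS : IsSemidirect G H V) : V × H ≃ G :=
  Equiv.ofBijective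
    (fun p => ⟨(p.1 : Γ) * p.2, mul_mem (hS.right_le p.1.2) (hS.left_le p.2.2)⟩)
    ⟨fun p q h => hS.isClosedEmbedding.injective (congrArg Subtype.val h), fun g => by
      obtain ⟨p, hp⟩ : (g : Γ) ∈ Set.range (fun p : V × H => (p.1 : Γ) * (p.2 : Γ)) :=
        hS.range_eq ▸ g.2
      exact ⟨p, Subtype.ext hp⟩⟩

theorem equiv_mul (hS : IsSemidirect G H V) (p q : V × H) :
    hS.equiv p * hS.equiv q =
      hS.equiv (p.1 * conjHom (hS.le_normalizer p.2.2) q.1, p.2 * q.2) := by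
  refine Subtype.ext ?_
  change (p.1 : Γ) * p.2 * (q.1 * q.2) = p.1 * (p.2 * q.1 * (p.2 : Γ)⁻¹) * (p.2 * q.2)
  group

/-- The homomorphism `v h ↦ c v * f h` on `H ⋉ V` determined by a compatible pair `(c, f)`. -/
noncomputable def lift (hS : IsSemidirect G H V) {M : Type*} [Monoid M] (c : V →* M) (f : H →* M)
    (hcf : ∀ (h : H) (v : V), f h * c v = c (conjHom (hS.le_normalizer h.2) v) * f h) :
    G →* M where
  toFun g := c (hS.equiv.symm g).1 * f (hS.equiv.symm g).2
  map_one' := by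
    have h : hS.equiv.symm 1 = (1, 1) := by
      rw [Equiv.symm_apply_eq]
      exact Subtype.ext (mul_one (1 : Γ)).symm
    rw [h, map_one, map_one, one_mul]
  map_mul' g g' := by
    obtain ⟨p, rfl⟩ := hS.equiv.surjective g
    obtain ⟨q, rfl⟩ := hS.equiv.surjective g'
    rw [equiv_mul, Equiv.symm_apply_apply, Equiv.symm_apply_apply, Equiv.symm_apply_apply]
    simp only [map_mul]
    rw [mul_assoc, ← mul_assoc (c _) (f p.2), ← hcf]
    simp only [mul_assoc]

end IsSemidirect

/-- The dual orbit map `h ↦ h♭ ξ`, where `⟨h♭ ξ, v⟩ = ⟨ξ, h⁻¹ v h⟩`. -/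
noncomputable def dualOrbitMap {H V : Subgroup Γ} (hHV : H ≤ Subgroup.normalizer (V : Set Γ))
    (ξ : PontryaginDual V) (h : H) : PontryaginDual V :=
  PontryaginDual.map (conjHom (inv_mem (hHV h.2))) ξ

theorem apply_conjHom_of_fixed {H V : Subgroup Γ}
    {hHV : H ≤ Subgroup.normalizer (V : Set Γ)} {ξ : PontryaginDual V}
    (hξ : ∀ h : H, dualOrbitMap hHV ξ h = ξ) (h : H) (v : V) :
    ξ (conjHom (hHV h.2) v) = ξ v := by
  have h1 := DFunLike.congr_fun (hξ h) (conjHom (hHV h.2) v)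
  rw [← h1]
  refine congrArg ξ (Subtype.ext ?_)
  change (h : Γ)⁻¹ * (h * v * (h : Γ)⁻¹) * (h : Γ)⁻¹⁻¹ = v
  group

namespace IsSemidirect

variable {G H V : Subgroup Γ}

/-- The representation `σ ⊗ ξ` of `H ⋉ V`, `(σ ⊗ ξ)(v h) = ⟨ξ, v⟩ σ(h)`, for a character `ξ` of `V`
fixed by `H`. -/
noncomputable def tensor (hS : IsSemidirect G H V) (σ : UnitaryRep H) (ξ : PontryaginDual V)
    (hξ : ∀ h : H, dualOrbitMap hS.le_normalizer ξ h = ξ) : UnitaryRep G where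
  space := σ.space
  hom := hS.lift ((UnitaryRep.scalar σ.space).comp (ξ : V →* Circle)) σ.hom fun h v => by
    ext x
    change σ.hom h ((ξ v : ℂ) • x) = (ξ (conjHom (hS.le_normalizer h.2) v) : ℂ) • σ.hom h x
    rw [apply_conjHom_of_fixed hξ, map_smul]

/-- The unitary character `v h ↦ ⟨ξ, v⟩ χ(h)` of `H ⋉ V`. -/
noncomputable def tensorCharacter (hS : IsSemidirect G H V) (χ : H →* Circle)
    (ξ : PontryaginDual V) (hξ : ∀ h : H, dualOrbitMap hS.le_normalizer ξ h = ξ) : G →* Circle :=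
  hS.lift (ξ : V →* Circle) χ fun h v => by
    change χ h * ξ v = ξ (conjHom (hS.le_normalizer h.2) v) * χ h
    rw [apply_conjHom_of_fixed hξ, mul_comm]

end IsSemidirect

noncomputable instance {A : Type*} [Monoid A] [TopologicalSpace A] : MeasurableSpace (PontryaginDual A) :=
  borel _

instance {A : Type*} [Monoid A] [TopologicalSpace A] : BorelSpace (PontryaginDual A) :=
  ⟨rfl⟩

/-- Negligible subsets of a locally compact group: null sets of the Haar measures. -/
def HaarNull {X : Type*} [Group X] [TopologicalSpace X] [MeasurableSpace X] (S : Set X) : Prop :=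
  ∀ μ : Measure X, μ.IsHaarMeasure → μ S = 0

/-- A map between locally compact groups which is an isomorphism of the Haar measure classes: it
is measurable and nonsingular, with a measurable and nonsingular almost everywhere inverse. -/
def IsMeasureClassIso {X Y : Type*} [Group X] [TopologicalSpace X] [MeasurableSpace X]
    [Group Y] [TopologicalSpace Y] [MeasurableSpace Y] (φ : X → Y) : Prop :=
  ∀ (μ : Measure X) (ν : Measure Y), μ.IsHaarMeasure → ν.IsHaarMeasure →
    QuasiMeasurePreserving φ μ ν ∧ ∃ ψ : Y → X, QuasiMeasurePreserving ψ ν μ ∧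
      (∀ᵐ x ∂μ, ψ (φ x) = x) ∧ ∀ᵐ y ∂ν, φ (ψ y) = y

/-- `(Q, K)` is a matched pair for `H`. -/
structure IsMatchedPair [MeasurableSpace Γ] (H Q K : Subgroup Γ) : Prop where
  isClosed_left : IsClosed (Q : Set Γ)
  isClosed_right : IsClosed (K : Set Γ)
  left_le : Q ≤ H
  right_le : K ≤ H
  inf_eq_bot : Q ⊓ K = ⊥
  full_measure : HaarNull {h : H | ∃ q ∈ Q, ∃ k ∈ K, (h : Γ) = q * k}ᶜ

end Subgroups

/-! ### Groups satisfying the dual orbit condition -/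

/-- The subgroups and characters witnessing the dual orbit condition of depth `ℓ` for
`G ℓ = H ℓ ⋉ V ℓ`, all groups being realized as closed subgroups of `Γ` (one may take `Γ = G ℓ`).
Only the indices `1, …, ℓ` are relevant, and `G 0` is the trivial group. -/
structure DualOrbitTower (Γ : Type*) [Group Γ] [TopologicalSpace Γ] [IsTopologicalGroup Γ]
    [MeasurableSpace Γ] (ℓ : ℕ) where
  G : ℕ → Subgroup Γ
  H : ℕ → Subgroup Γ
  V : ℕ → Subgroup Γ
  Q : ℕ → Subgroup Γ
  ξ : ∀ j, PontryaginDual (V j)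
  G_zero : G 0 = ⊥
  semidirect : ∀ j < ℓ, IsSemidirect (G (j + 1)) (H (j + 1)) (V (j + 1))
  comm : ∀ j < ℓ, ∀ v ∈ V (j + 1), ∀ w ∈ V (j + 1), v * w = w * v
  /-- Depth one: the dual orbit map `H 1 → V̂ 1` of `ξ 1` is a measure class isomorphism. -/
  depth_one : ∀ h0 : 0 < ℓ,
    IsMeasureClassIso (dualOrbitMap (semidirect 0 h0).le_normalizer (ξ (0 + 1)))
  Q_one : 0 < ℓ → Q 1 = H 1
  /-- For `2 ≤ j ≤ ℓ`, the dual orbit of `ξ j` under `H j` has full measure in `V̂ j`. -/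
  full_orbit : ∀ (j : ℕ) (hj : j + 1 < ℓ),
    HaarNull (Set.range
      (dualOrbitMap (semidirect (j + 1) hj).le_normalizer (ξ (j + 1 + 1))))ᶜ
  /-- For `2 ≤ j ≤ ℓ`, `G (j - 1)` is the stabilizer of `ξ j` in `H j`. -/
  stabilizer : ∀ (j : ℕ) (hj : j + 1 < ℓ) (g : Γ), g ∈ G (j + 1) ↔
    ∃ hg : g ∈ H (j + 1 + 1),
      dualOrbitMap (semidirect (j + 1) hj).le_normalizer (ξ (j + 1 + 1)) ⟨g, hg⟩ = ξ (j + 1 + 1)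
  matched : ∀ j, j + 1 < ℓ → IsMatchedPair (H (j + 1 + 1)) (Q (j + 1 + 1)) (G (j + 1))
  normalizes : ∀ j, j + 1 < ℓ → H (j + 1) ≤ Subgroup.normalizer (Q (j + 1 + 1) : Set Γ)

namespace DualOrbitTower

variable {Γ : Type u} [Group Γ] [TopologicalSpace Γ] [IsTopologicalGroup Γ]
  [LocallyCompactSpace Γ] [T2Space Γ] [SecondCountableTopology Γ] [MeasurableSpace Γ] [BorelSpace Γ]
  {ℓ : ℕ} (T : DualOrbitTower Γ ℓ)

theorem isClosed_G {j : ℕ} (hj : j ≤ ℓ) : IsClosed (T.G j : Set Γ) := by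
  cases j with
  | zero =>
    rw [T.G_zero]
    exact isClosed_singleton
  | succ j => exact (T.semidirect j hj).isClosed

theorem G_le_H {j : ℕ} (hj : j < ℓ) : T.G j ≤ T.H (j + 1) := by
  cases j with
  | zero =>
    rw [T.G_zero]
    exact bot_le
  | succ j => exact fun g hg => ((T.stabilizer j hj g).1 hg).1

theorem G_fixes {j : ℕ} (hj : j < ℓ) {K : Subgroup Γ}
    (hK : K ≤ Subgroup.normalizer (T.V (j + 1) : Set Γ)) (hKG : K ≤ T.G j) (g : K) :
    dualOrbitMap hK (T.ξ (j + 1)) g = T.ξ (j + 1) := by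
  obtain ⟨g, hg⟩ := g
  cases j with
  | zero =>
    have h1 : g = 1 := by
      have := hKG hg
      rwa [T.G_zero, Subgroup.mem_bot] at this
    subst h1
    ext v
    refine congrArg (fun v => ((T.ξ (0 + 1) v : Circle) : ℂ)) (Subtype.ext ?_)
    change (1 : Γ)⁻¹ * v * (1 : Γ)⁻¹⁻¹ = v
    group
  | succ j => exact ((T.stabilizer j hj g).1 (hKG hg)).2

/-- The subgroup `G j ⋉ V (j + 1)` of `G (j + 1)`. -/
theorem semidirect_G {j : ℕ} (hj : j < ℓ) :
    IsSemidirect (T.G j ⊔ T.V (j + 1)) (T.G j) (T.V (j + 1)) :=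
  (T.semidirect j hj).sup_of_le (T.isClosed_G hj.le) (T.G_le_H hj)

theorem sup_le_G {j : ℕ} (hj : j < ℓ) : T.G j ⊔ T.V (j + 1) ≤ T.G (j + 1) :=
  sup_le ((T.G_le_H hj).trans (T.semidirect j hj).left_le) (T.semidirect j hj).right_le

/-- The iterated Mackey representations: the trivial representation of the trivial group `G 0`,
and then `π̃_{j+1} = Ind (π̃_j ⊗ ξ_{j+1})`, induced from `G j ⋉ V (j + 1)` to `G (j + 1)`. -/
noncomputable def mackeyRep : (j : ℕ) → j ≤ ℓ → UnitaryRep.{u, u} (T.G j)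
  | 0, _ => UnitaryRep.trivial (T.G 0)
  | j + 1, hj =>
    ((T.semidirect_G hj).tensor (mackeyRep j (Nat.le_of_succ_le hj)) (T.ξ (j + 1))
      (T.G_fixes hj _ le_rfl)).indSubgroup (T.sup_le_G hj) (T.semidirect_G hj).isClosed
      (T.isClosed_G hj)

/-- The subgroup generated by `V 1, …, V j`. -/
def N : ℕ → Subgroup Γ
  | 0 => ⊥
  | j + 1 => N j ⊔ T.V (j + 1)

theorem N_le_G {j : ℕ} (hj : j ≤ ℓ) : T.N j ≤ T.G j := by
  induction j with
  | zero => exact bot_le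
  | succ j ih =>
    exact sup_le ((ih (Nat.le_of_succ_le hj)).trans
      ((T.G_le_H hj).trans (T.semidirect j hj).left_le)) (T.semidirect j hj).right_le

theorem isClosed_N {j : ℕ} (hj : j ≤ ℓ) : IsClosed (T.N j : Set Γ) := by
  induction j with
  | zero => exact isClosed_singleton
  | succ j ih =>
    exact ((T.semidirect j hj).sup_of_le (ih (Nat.le_of_succ_le hj))
      ((T.N_le_G (Nat.le_of_succ_le hj)).trans (T.G_le_H hj))).isClosed

theorem semidirect_N {j : ℕ} (hj : j < ℓ) :
    IsSemidirect (T.N (j + 1)) (T.N j) (T.V (j + 1)) :=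
  (T.semidirect j hj).sup_of_le (T.isClosed_N hj.le) ((T.N_le_G hj.le).trans (T.G_le_H hj))

/-- The unitary character `v_j ⋯ v_1 ↦ ⟨ξ_j, v_j⟩ ⋯ ⟨ξ_1, v_1⟩` of `N j`. -/
noncomputable def chi : (j : ℕ) → j ≤ ℓ → (T.N j →* Circle)
  | 0, _ => 1
  | j + 1, hj =>
    (T.semidirect_N hj).tensorCharacter (chi j (Nat.le_of_succ_le hj)) (T.ξ (j + 1))
      (T.G_fixes hj _ (T.N_le_G (Nat.le_of_succ_le hj)))

/-- The representation `Ind χ_ℓ` of `G ℓ` induced from `N ℓ`. -/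
noncomputable def characterRep : UnitaryRep.{u, u} (T.G ℓ) :=
  (UnitaryRep.ofCharacter (T.chi ℓ le_rfl)).indSubgroup (T.N_le_G le_rfl) (T.isClosed_N le_rfl)
    (T.isClosed_G le_rfl)

end DualOrbitTower

/-! The equivalence holds at every level `j`, by induction on `j`. Here `N (j+1) = N j ⋉ V (j+1)`
sits inside `G j ⋉ V (j+1)`, which sits inside `G (j+1)`, and `chi (j+1)` is `chi j ⊗ ξ (j+1)`.
Induction in stages (`ind_unitarilyEquivalent_ind_ind`) passes through the middle group. Since `G j`
fixes `ξ (j+1)`, the first stage is `Ind (chi j ⊗ ξ (j+1)) ≅ (Ind chi j) ⊗ ξ (j+1)`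
(`ind_tensor_unitarilyEquivalent`). The induction hypothesis replaces `Ind chi j` by the Mackey
representation of `G j`, and the second stage is then the definition of the next Mackey
representation. The induction starts at the trivial group, where `ind_of_subsingleton` applies.

The work lies in the two equivalences. Vectors of an induced representation are classes of functions
whose covariance holds, for each group element, only almost everywhere. Each equivalence is
therefore given as a relation between representatives and turned into a unitary by `of_relation`.
Totality of the relations rests on three measure-theoretic tools: passage between measurable
`L²`-valued maps and jointly measurable functions; the fact that a function invariant under every
translation of a variable up to null sets does not depend on that variable
(`exists_ae_eq_comp_fst_of_forall_ae_mul_left`); and the fact that covariance at almost every group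
element implies covariance at all of them (`isCovariant_of_ae`). Isometry is a computation of coset
integrals, in which the modular functions cancel. -/

/-! ### Measurable maps into `L²` and jointly measurable functions -/

section Curry

variable {X Y E : Type*} [MeasurableSpace X] [MeasurableSpace Y] {ν : Measure Y}
  [NormedAddCommGroup E] [SecondCountableTopology E]

/-- By the Lindelöf property an open set is a countable union of balls. For maps into `L²` the
distances to fixed vectors are integrals, hence accessible to Tonelli's theorem. -/
theorem measurable_of_measurable_edist {Z : Type*} [PseudoEMetricSpace Z]
    [SecondCountableTopology Z] [MeasurableSpace Z] [BorelSpace Z] {F : X → Z}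
    (hF : ∀ z, Measurable fun x => edist (F x) z) : Measurable F := by
  refine measurable_of_isOpen fun s hs => ?_
  choose ε hε hs' using fun z : s => EMetric.isOpen_iff.1 hs z z.2
  obtain ⟨T, hT, hU⟩ := TopologicalSpace.isOpen_iUnion_countable
    (fun z : s => Metric.eball (z : Z) (ε z)) fun z => Metric.isOpen_eball
  have h1 : s = ⋃ z ∈ T, Metric.eball (z : Z) (ε z) := by
    rw [hU]
    refine Set.Subset.antisymm (fun z hz => ?_) (Set.iUnion_subset fun z => hs' z)
    exact Set.mem_iUnion.2 ⟨⟨z, hz⟩, Metric.mem_eball_self (hε _)⟩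
  rw [h1, Set.preimage_iUnion₂]
  exact MeasurableSet.biUnion hT fun z _ => measurableSet_lt (hF z) measurable_const

theorem secondCountableTopology_Lp_two (E : Type*) [NormedAddCommGroup E]
    [SecondCountableTopology E] (ν : Measure Y) [MeasurableSpace.CountablyGenerated Y] [SFinite ν] :
    SecondCountableTopology (Lp E 2 ν) :=
  have : Fact ((2 : ℝ≥0∞) ≠ ∞) := ⟨ENNReal.ofNat_ne_top⟩
  inferInstance

/-- A jointly measurable function, square integrable on sections, is a measurable function with
values in `L²`. -/
theorem exists_measurable_Lp_of_uncurry [MeasurableSpace.CountablyGenerated Y] [SFinite ν]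
    {h : X × Y → E} (hh : StronglyMeasurable h) :
    ∃ F : X → Lp E 2 ν, StronglyMeasurable F ∧
      ∀ x, MemLp (fun y => h (x, y)) 2 ν → F x =ᵐ[ν] fun y => h (x, y) := by
  classical
  have := secondCountableTopology_Lp_two E ν
  borelize ↥(Lp E 2 ν)
  have hhx : ∀ x, StronglyMeasurable fun y => h (x, y) := fun x =>
    hh.comp_measurable measurable_prodMk_left
  -- The distance to a fixed `g` is an integral over `Y` of a jointly measurable function.
  have hn : ∀ g : Lp E 2 ν, Measurable fun x => eLpNorm (fun y => h (x, y) - g y) 2 ν := by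
    intro g
    simp only [eLpNorm_eq_lintegral_rpow_enorm_toReal two_ne_zero ENNReal.ofNat_ne_top]
    refine Measurable.pow_const ?_ _
    refine Measurable.lintegral_prod_right'
      (f := fun p : X × Y => ‖h p - g p.2‖ₑ ^ (2 : ℝ≥0∞).toReal) ?_
    exact ((hh.sub ((Lp.stronglyMeasurable g).comp_measurable measurable_snd)).enorm).pow_const _
  have hA : MeasurableSet {x | MemLp (fun y => h (x, y)) 2 ν} := by
    have h1 : {x | MemLp (fun y => h (x, y)) 2 ν} =
        {x | eLpNorm (fun y => h (x, y)) 2 ν < ∞} := by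
      ext x
      exact ⟨fun hx => hx.2, fun hx => ⟨(hhx x).aestronglyMeasurable, hx⟩⟩
    rw [h1]
    refine measurableSet_lt ?_ measurable_const
    simp only [eLpNorm_eq_lintegral_rpow_enorm_toReal two_ne_zero ENNReal.ofNat_ne_top]
    refine Measurable.pow_const ?_ _
    exact Measurable.lintegral_prod_right'
      (f := fun p : X × Y => ‖h p‖ₑ ^ (2 : ℝ≥0∞).toReal) (hh.enorm.pow_const _)
  -- The value 0 is used at the `x` whose section is not square integrable; by `hA` these form a
  -- measurable set.
  refine ⟨fun x => if hx : MemLp (fun y => h (x, y)) 2 ν then hx.toLp else 0, ?_, fun x hx => ?_⟩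
  · refine Measurable.stronglyMeasurable (measurable_of_measurable_edist fun g => ?_)
    have h1 : (fun x => edist (if hx : MemLp (fun y => h (x, y)) 2 ν then hx.toLp else 0) g) =
        fun x => if x ∈ {x | MemLp (fun y => h (x, y)) 2 ν} then
          eLpNorm (fun y => h (x, y) - g y) 2 ν else edist 0 g := by
      ext x
      by_cases hx : MemLp (fun y => h (x, y)) 2 ν
      · simp only [hx, dif_pos, Set.mem_ofPred_eq, if_true]
        rw [Lp.edist_def]
        refine eLpNorm_congr_ae ?_
        filter_upwards [hx.coeFn_toLp] with y hy
        rw [Pi.sub_apply, hy]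
      · simp only [hx, Set.mem_ofPred_eq, if_false]
        rfl
    rw [h1]
    exact Measurable.ite hA (hn g) measurable_const
  · simp only [hx, dif_pos]
    exact hx.coeFn_toLp

/-- A measurable function with values in `L²` is represented by a jointly measurable function. -/
theorem exists_uncurry_of_measurable_Lp [CompleteSpace E] [MeasurableSpace.CountablyGenerated Y] [SFinite ν]
    {F : X → Lp E 2 ν} (hF : StronglyMeasurable F) :
    ∃ h : X × Y → E, StronglyMeasurable h ∧ ∀ x, F x =ᵐ[ν] fun y => h (x, y) := by
  classical
  have := secondCountableTopology_Lp_two E ν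
  borelize ↥(Lp E 2 ν)
  -- `F` is approximated at a geometric rate by maps with values in a dense sequence. Such maps take
  -- countably many values, so they have obvious jointly measurable representatives, and the rate
  -- forces convergence at almost every `y` for every `x`.
  set d : ℕ → Lp E 2 ν := TopologicalSpace.denseSeq _ with hd
  set B : ℕ → ℝ≥0∞ := fun n => (2⁻¹ : ℝ≥0∞) ^ (n + 1) with hB
  have hB0 : ∀ n, B n ≠ 0 := fun n =>
    pow_ne_zero _ (ENNReal.inv_ne_zero.2 ENNReal.ofNat_ne_top)
  have hex : ∀ n x, ∃ k, edist (F x) (d k) < B (n + 1) := fun n x => by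
    obtain ⟨y, ⟨k, rfl⟩, hk⟩ := EMetric.mem_closure_iff.1
      (TopologicalSpace.denseRange_denseSeq (Lp E 2 ν) (F x)) (B (n + 1)) (pos_iff_ne_zero.2 (hB0 _))
    exact ⟨k, hk⟩
  -- Taking the least admissible index makes the choice measurable in `x`.
  set κ : ℕ → X → ℕ := fun n x => Nat.find (hex n x) with hκ
  have hκm : ∀ n, Measurable (κ n) := fun n => measurable_find _ fun k =>
    measurableSet_lt (hF.measurable.edist measurable_const) measurable_const
  have hκd : ∀ n x, edist (F x) (d (κ n x)) < B (n + 1) := fun n x => Nat.find_spec (hex n x)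
  borelize E
  set H : ℕ → X × Y → E := fun n p => d (κ n p.1) p.2 with hH
  have hHm : ∀ n, StronglyMeasurable (H n) := fun n => by
    have h1 : Measurable fun p : ℕ × Y => d p.1 p.2 :=
      measurable_from_prod_countable_right fun k => (Lp.stronglyMeasurable (d k)).measurable
    exact (h1.comp (((hκm n).comp measurable_fst).prodMk measurable_snd)).stronglyMeasurable
  refine ⟨fun p => limUnder atTop fun n => H n p, StronglyMeasurable.limUnder hHm, fun x => ?_⟩
  have hBanti : ∀ {N n}, N ≤ n → B n ≤ B N := fun {N n} hn =>
    pow_le_pow_right_of_le_one' (ENNReal.inv_le_one.2 one_le_two) (by omega)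
  have hsum : ∑' n, B n ≠ ∞ := by
    rw [hB, ENNReal.tsum_geometric_add_one, ENNReal.one_sub_inv_two, inv_inv]
    exact ENNReal.mul_ne_top (by simp) (by simp)
  -- The tolerance is `B (n + 1)` rather than `B n` so that two errors add up to `B N`.
  have hcau := Lp.ae_tendsto_of_cauchy_eLpNorm (μ := ν) (p := 2) (f := fun n => (d (κ n x) : Y → E))
    (fun n => Lp.aestronglyMeasurable _) one_le_two hsum fun N n m hn hm => by
      rw [← Lp.edist_def]
      calc edist (d (κ n x)) (d (κ m x)) ≤ edist (F x) (d (κ n x)) + edist (F x) (d (κ m x)) :=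
            edist_triangle_left _ _ _
        _ < B (N + 1) + B (N + 1) := ENNReal.add_lt_add
            ((hκd n x).trans_le (hBanti (by omega))) ((hκd m x).trans_le (hBanti (by omega)))
        _ = B N := by
          rw [hB]
          simp only [pow_succ _ (N + 1)]
          rw [← mul_add, ENNReal.inv_two_add_inv_two, mul_one]
  have hlim : Tendsto (fun n => d (κ n x)) atTop (𝓝 (F x)) := by
    rw [tendsto_iff_edist_tendsto_0]
    refine tendsto_of_tendsto_of_tendsto_of_le_of_le tendsto_const_nhds
      (ENNReal.tendsto_atTop_zero_of_tsum_ne_top hsum) (fun _ => zero_le) fun n => ?_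
    rw [edist_comm]
    exact (hκd n x).le.trans (hBanti (by omega))
  -- A subsequence converges almost everywhere to `F x`, which identifies the pointwise limit.
  obtain ⟨ns, hns, hae⟩ := (tendstoInMeasure_of_tendsto_Lp hlim).exists_seq_tendsto_ae
  filter_upwards [hcau, hae] with y ⟨l, hl⟩ hy
  have h1 : F x y = l := tendsto_nhds_unique hy (hl.comp hns.tendsto_atTop)
  rw [h1]
  exact hl.limUnder_eq.symm

end Curry

/-! ### Nonsingular skew maps on product spaces -/

section Skew

variable {X Y : Type*} [MeasurableSpace X] [MeasurableSpace Y] {μ : Measure X} {ν : Measure Y}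
  [SFinite μ] [SFinite ν]

/-- Fubini: almost every section of a null set is null, and each fibre map pulls null sets back to
null sets. -/
theorem quasiMeasurePreserving_prodMk_right {T : X → Y → Y}
    (hT : Measurable fun p : X × Y => T p.1 p.2) (hq : ∀ x, QuasiMeasurePreserving (T x) ν ν) :
    QuasiMeasurePreserving (fun p : X × Y => (p.1, T p.1 p.2)) (μ.prod ν) (μ.prod ν) := by
  have hm : Measurable fun p : X × Y => (p.1, T p.1 p.2) := measurable_fst.prodMk hT
  refine ⟨hm, AbsolutelyContinuous.mk fun s hs h0 => ?_⟩
  rw [map_apply hm hs, measure_prod_null (hm hs)]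
  filter_upwards [(measure_prod_null hs).1 h0] with x hx
  exact (hq x).preimage_null hx

theorem quasiMeasurePreserving_prodMk_left {T : Y → X → X}
    (hT : Measurable fun p : X × Y => T p.2 p.1) (hq : ∀ y, QuasiMeasurePreserving (T y) μ μ) :
    QuasiMeasurePreserving (fun p : X × Y => (T p.2 p.1, p.2)) (μ.prod ν) (μ.prod ν) :=
  (measurePreserving_swap (μ := ν) (ν := μ)).quasiMeasurePreserving.comp
    ((quasiMeasurePreserving_prodMk_right (μ := ν) (ν := μ) (T := T)
      (hT.comp measurable_swap) hq).comp measurePreserving_swap.quasiMeasurePreserving)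

end Skew

/-! ### Invariance up to null sets -/

section Invariance

variable {X G E : Type*} [MeasurableSpace X] {μ : Measure X} [SFinite μ]
  [Group G] [TopologicalSpace G] [IsTopologicalGroup G] [LocallyCompactSpace G]
  [SecondCountableTopology G] [MeasurableSpace G] [BorelSpace G]
  [TopologicalSpace E] [TopologicalSpace.MetrizableSpace E]

/-- A measurable function on `X × G` which is almost everywhere invariant under each left
translation of `G` is almost everywhere a function on `X`. -/
theorem exists_ae_eq_comp_fst_of_forall_ae_mul_left {k : X × G → E} (hk : StronglyMeasurable k)
    (hinv : ∀ g₀ : G, ∀ᵐ p ∂μ.prod (haar : Measure G), k (p.1, g₀ * p.2) = k p) :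
    ∃ φ : X → E, StronglyMeasurable φ ∧ ∀ᵐ p ∂μ.prod (haar : Measure G), k p = φ p.1 := by
  -- The exceptional null set depends on the translation. Fubini on the triple product absorbs this
  -- dependence into a single null set.
  have h1 : ∀ᵐ q ∂(haar : Measure G).prod (μ.prod (haar : Measure G)),
      k (q.2.1, q.1 * q.2.2) = k q.2 := by
    refine (ae_prod_iff_ae_ae (StronglyMeasurable.measurableSet_eq_fun ?_ ?_)).2
      (ae_of_all _ hinv)
    · exact hk.comp_measurable (by fun_prop)
    · exact hk.comp_measurable (by fun_prop)
  have h2 : ∀ᵐ r ∂((haar : Measure G).prod μ).prod (haar : Measure G),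
      k (r.1.2, r.1.1 * r.2) = k (r.1.2, r.2) :=
    (measurePreserving_prodAssoc (haar : Measure G) μ
      (haar : Measure G)).quasiMeasurePreserving.ae h1
  -- With one good `g₁` fixed, `k (x, g * g₁)` no longer depends on `g`; right translation by `g₁⁻¹`
  -- is nonsingular and removes `g₁` from the left side.
  obtain ⟨g₁, hg₁⟩ : ∃ g₁ : G, ∀ᵐ q ∂(haar : Measure G).prod μ, k (q.2, q.1 * g₁) = k (q.2, g₁) := by
    have := (ae_ae_comm (μ := (haar : Measure G).prod μ) (ν := (haar : Measure G))
      (p := fun q g => k (q.2, q.1 * g) = k (q.2, g)) (StronglyMeasurable.measurableSet_eq_fun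
      (hk.comp_measurable (by fun_prop)) (hk.comp_measurable (by fun_prop)))).1
      (ae_ae_of_ae_prod h2)
    exact this.exists
  refine ⟨fun x => k (x, g₁), hk.comp_measurable (by fun_prop), ?_⟩
  have h3 := (measurePreserving_swap (μ := μ) (ν := (haar : Measure G))).quasiMeasurePreserving.ae hg₁
  have hq := quasiMeasurePreserving_prodMk_right (μ := μ) (ν := (haar : Measure G))
    (T := fun _ g => g * g₁⁻¹) (by fun_prop)
    fun _ => quasiMeasurePreserving_mul_right (haar : Measure G) g₁⁻¹
  filter_upwards [hq.ae h3] with p hp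
  simpa using hp

/-- The conull sets `S` and `{g' | g'⁻¹ * g ∈ S}` meet, and `g = g' * (g'⁻¹ * g)` for any common
point `g'`. -/
theorem eq_univ_of_ae_mem_of_mul_mem {S : Set G} (hS : ∀ᵐ g ∂(haar : Measure G), g ∈ S)
    (hmul : ∀ g ∈ S, ∀ g' ∈ S, g * g' ∈ S) (g : G) : g ∈ S := by
  have h1 : ∀ᵐ g' ∂(haar : Measure G), g'⁻¹ * g ∈ S :=
    ((quasiMeasurePreserving_mul_right haar g).comp (quasiMeasurePreserving_inv haar)).ae hS
  obtain ⟨g', h, h'⟩ := (hS.and h1).exists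
  simpa using hmul _ h _ h'

end Invariance

/-! ### Unitary equivalences from relations -/

namespace UnitaryRep

namespace UnitarilyEquivalent

variable {G : Type*} [Group G] {π₁ π₂ π₃ : UnitaryRep G}

theorem symm (h : π₁.UnitarilyEquivalent π₂) : π₂.UnitarilyEquivalent π₁ := by
  obtain ⟨U, hU⟩ := h
  refine ⟨U.symm, fun g x => ?_⟩
  rw [LinearIsometryEquiv.symm_apply_eq, hU, LinearIsometryEquiv.apply_symm_apply]

theorem trans (h : π₁.UnitarilyEquivalent π₂) (h' : π₂.UnitarilyEquivalent π₃) :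
    π₁.UnitarilyEquivalent π₃ := by
  obtain ⟨U, hU⟩ := h
  obtain ⟨W, hW⟩ := h'
  refine ⟨U.trans W, fun g x => ?_⟩
  rw [LinearIsometryEquiv.trans_apply, LinearIsometryEquiv.trans_apply, hU, hW]

/-- A linear, isometric, equivariant relation which is total on both sides is the graph of a
unitary equivalence. -/
theorem of_relation (R : π₁.space → π₂.space → Prop)
    (hadd : ∀ x y x' y', R x y → R x' y' → R (x + x') (y + y'))
    (hsmul : ∀ (c : ℂ) x y, R x y → R (c • x) (c • y))
    (hnorm : ∀ x y, R x y → ‖x‖ = ‖y‖)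
    (hleft : ∀ x, ∃ y, R x y) (hright : ∀ y, ∃ x, R x y)
    (hhom : ∀ g x y, R x y → R (π₁.hom g x) (π₂.hom g y)) :
    π₁.UnitarilyEquivalent π₂ := by
  -- By linearity 0 is related to `y - y'`, and isometry forces this difference to vanish.
  have huniq : ∀ {x y y'}, R x y → R x y' → y = y' := fun {x y y'} h h' => by
    have h1 := hnorm _ _ (hadd _ _ _ _ h (hsmul (-1) _ _ h'))
    rw [neg_one_smul, neg_one_smul, add_neg_cancel, norm_zero, ← sub_eq_add_neg] at h1
    exact sub_eq_zero.1 (norm_eq_zero.1 h1.symm)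
  choose T hT using hleft
  have hTR : ∀ {x y}, R x y → T x = y := fun h => huniq (hT _) h
  refine ⟨LinearIsometryEquiv.ofSurjective
    { toFun := T
      map_add' := fun x x' => hTR (hadd _ _ _ _ (hT x) (hT x'))
      map_smul' := fun c x => hTR (hsmul c _ _ (hT x))
      norm_map' := fun x => (hnorm _ _ (hT x)).symm }
    fun y => (hright y).imp fun x hx => hTR hx, fun g x => hTR (hhom g _ _ (hT x))⟩

end UnitarilyEquivalent

end UnitaryRep

/-! ### Covariant functions and the norm of the induced representation -/

theorem modularFn_mul {G : Type*} [Group G] [TopologicalSpace G] [IsTopologicalGroup G]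
    [LocallyCompactSpace G] (g h : G) : modularFn (g * h) = modularFn g * modularFn h := by
  rw [modularFn, modularFn, modularFn, modularCharacterFun_map_mul, mul_inv]

theorem measurable_modularFn {G : Type*} [Group G] [TopologicalSpace G] [IsTopologicalGroup G]
    [LocallyCompactSpace G] [SecondCountableTopology G] [MeasurableSpace G] [BorelSpace G] :
    Measurable fun g : G => modularFn g := by
  have h := (measurable_modularFn_inv (G := G)).ennreal_toNNReal.inv
  simp only [ENNReal.toNNReal_coe] at h
  exact (funext fun g => inv_inv (modularFn g) : (fun g : G => (modularFn g)⁻¹)⁻¹ = modularFn) ▸ h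

theorem enorm_coe_sqrt_sq (r : ℝ≥0) : ‖((NNReal.sqrt r : ℝ) : ℂ)‖ₑ ^ 2 = (r : ℝ≥0∞) := by
  have h2 : ‖((NNReal.sqrt r : ℝ) : ℂ)‖ₑ = (NNReal.sqrt r : ℝ≥0∞) := by
    rw [← ofReal_norm, Complex.norm_real, Real.norm_of_nonneg (NNReal.coe_nonneg _),
      ENNReal.ofReal_coe_nnreal]
  rw [h2, ← ENNReal.coe_pow, NNReal.sq_sqrt]

section Induction

variable {K L : Type*}
  [Group K] [TopologicalSpace K] [IsTopologicalGroup K] [LocallyCompactSpace K]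
  [SecondCountableTopology K] [MeasurableSpace K] [BorelSpace K]
  [Group L] [TopologicalSpace L] [IsTopologicalGroup L] [LocallyCompactSpace L] [T2Space L]
  [SecondCountableTopology L] [MeasurableSpace L] [BorelSpace L]

/-- The weighted integral of a function which transforms like a density on `L ⧸ K` is the same for
any two measurable weights whose integrals over all cosets of `K` are one. -/
theorem lintegral_mul_eq_of_lintegral_coset_eq_one {ι : K →* L} (hι : Continuous ι)
    {b b' : L → ℝ≥0∞} (hb : Measurable b)
    (hb1 : ∀ x, ∫⁻ k, b (x * ι k) ∂(haar : Measure K) = 1) (hb' : Measurable b')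
    (hb1' : ∀ x, ∫⁻ k, b' (x * ι k) ∂(haar : Measure K) = 1) {F : L → ℝ≥0∞} (hF : Measurable F)
    (hcov : ∀ k : K, ∀ᵐ x ∂(haar : Measure L),
      F (x * ι k) = ((modularFn k / modularFn (ι k) : ℝ≥0) : ℝ≥0∞) * F x) :
    ∫⁻ x, b' x * F x ∂(haar : Measure L) = ∫⁻ x, b x * F x ∂haar := by
  have hm : Measurable fun p : L × K => p.1 * ι p.2 :=
    (continuous_fst.mul (hι.comp continuous_snd)).measurable
  have hm' : Measurable fun p : L × K => p.1 * ι p.2⁻¹ :=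
    (continuous_fst.mul (hι.comp continuous_snd.inv)).measurable
  have hbm : ∀ x, Measurable fun k : K => b (x * ι k) := fun x =>
    hb.comp (continuous_const.mul hι).measurable
  have hinv : Measurable fun k : K => (((modularFn k)⁻¹ : ℝ≥0) : ℝ≥0∞) := measurable_modularFn_inv
  -- A factor `∫ b (x * ι k) dk = 1` is inserted, the order of integration exchanged, and `x`
  -- translated so that the integral over `K` falls on `b'`. Only the coset normalization of the
  -- weights enters, so they may vanish or be infinite at some points, as the averaged weights below
  -- might.
  calc ∫⁻ x, b' x * F x ∂(haar : Measure L)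
      = ∫⁻ x, ∫⁻ k, b' x * F x * b (x * ι k) ∂(haar : Measure K) ∂(haar : Measure L) := by
        refine lintegral_congr fun x => ?_
        rw [lintegral_const_mul _ (hbm x), hb1, mul_one]
    _ = ∫⁻ k, ∫⁻ x, b' x * F x * b (x * ι k) ∂(haar : Measure L) ∂(haar : Measure K) := by
        refine lintegral_lintegral_swap ?_
        exact (((hb'.comp measurable_fst).mul (hF.comp measurable_fst)).mul
          (hb.comp hm)).aemeasurable
    _ = ∫⁻ k, ∫⁻ x, b x * F x * (((modularFn k)⁻¹ : ℝ≥0) * b' (x * ι k⁻¹))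
          ∂(haar : Measure L) ∂(haar : Measure K) := by
        refine lintegral_congr fun k => ?_
        have h := lintegral_mul_right_eq_modularFn
          (fun x => b' (x * ι k⁻¹) * F (x * ι k⁻¹) * b x) (ι k)
        simp only [mul_assoc _ (ι k), ← map_mul, mul_inv_cancel, map_one, mul_one] at h
        rw [h, ← lintegral_const_mul' _ _ ENNReal.coe_ne_top]
        refine lintegral_congr_ae ?_
        filter_upwards [hcov k⁻¹] with x hx
        rw [hx]
        -- The translation costs `Δ_L⁻¹`, which cancels against the covariance of `F`. The remaining
        -- `Δ_K(k)⁻¹ dk` is the image of Haar measure under inversion.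
        have : ((modularFn (ι k))⁻¹ * (modularFn k⁻¹ / modularFn (ι k⁻¹)) : ℝ≥0)
            = (modularFn k)⁻¹ := by
          rw [map_inv, modularFn_inv, modularFn_inv]
          have := (modularFn_pos (ι k)).ne'
          have := (modularFn_pos k).ne'
          field_simp
        rw [← this, ENNReal.coe_mul]
        ring
    _ = ∫⁻ x, ∫⁻ k, b x * F x * (((modularFn k)⁻¹ : ℝ≥0) * b' (x * ι k⁻¹))
          ∂(haar : Measure K) ∂(haar : Measure L) := by
        refine lintegral_lintegral_swap (μ := (haar : Measure K)) (ν := (haar : Measure L))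
          (f := fun k x => b x * F x * (((modularFn k)⁻¹ : ℝ≥0) * b' (x * ι k⁻¹))) ?_
        exact (((hb.comp measurable_snd).mul (hF.comp measurable_snd)).mul
          ((hinv.comp measurable_fst).mul
            (hb'.comp (hm'.comp measurable_swap)))).aemeasurable
    _ = ∫⁻ x, b x * F x ∂haar := by
        refine lintegral_congr fun x => ?_
        have hx : Measurable fun k : K => b' (x * ι k) :=
          hb'.comp (continuous_const.mul hι).measurable
        have hp : Measurable fun k : K => (((modularFn k)⁻¹ : ℝ≥0) : ℝ≥0∞) * b' (x * ι k⁻¹) :=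
          hinv.mul (hx.comp measurable_inv)
        rw [lintegral_const_mul _ hp, lintegral_modularFn_inv_mul hx, hb1', mul_one]

/-- The covariance condition at a single element of `K`. -/
def IsCovariantAt (ι : K →* L) (σ : UnitaryRep K) (f : L → σ.space) (k : K) : Prop :=
  ∀ᵐ x ∂(haar : Measure L),
    f (x * ι k) = ((NNReal.sqrt (modularFn k / modularFn (ι k)) : ℝ) : ℂ) • (σ.hom k)⁻¹ (f x)

theorem IsCovariantAt.mul {ι : K →* L} {σ : UnitaryRep K} {f : L → σ.space} {k k' : K}
    (h : IsCovariantAt ι σ f k) (h' : IsCovariantAt ι σ f k') : IsCovariantAt ι σ f (k * k') := by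
  filter_upwards [h, ae_haar_of_mul_right h' (ι k)] with x h1 h2
  rw [map_mul, ← mul_assoc, h2, h1, map_smul, smul_smul, modularFn_mul, modularFn_mul, map_mul,
    mul_inv_rev, mul_div_mul_comm, NNReal.sqrt_mul, mul_comm]
  push_cast
  rfl

/-- The elements at which `f` is covariant are closed under products by `IsCovariantAt.mul`, and a
conull set closed under products is the whole group. -/
theorem isCovariant_of_ae {ι : K →* L} {σ : UnitaryRep K} {f : L → σ.space}
    (h : ∀ᵐ k ∂(haar : Measure K), IsCovariantAt ι σ f k) : IsCovariant ι σ f :=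
  eq_univ_of_ae_mem_of_mul_mem (S := {k | IsCovariantAt ι σ f k}) h fun _ h _ h' => h.mul h'

theorem IsCovariant.enorm_sq {ι : K →* L} {σ : UnitaryRep K} {f : L → σ.space}
    (hf : IsCovariant ι σ f) (k : K) : ∀ᵐ x ∂(haar : Measure L),
      ‖f (x * ι k)‖ₑ ^ 2 = ((modularFn k / modularFn (ι k) : ℝ≥0) : ℝ≥0∞) * ‖f x‖ₑ ^ 2 := by
  filter_upwards [hf k] with x hx
  have h1 : ‖(σ.hom k)⁻¹ (f x)‖ₑ = ‖f x‖ₑ := LinearIsometryEquiv.enorm_map _ _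
  rw [hx, enorm_smul, mul_pow, h1, enorm_coe_sqrt_sq]

variable {ι : K →* L} {hι : IsClosedEmbedding ι} {σ : UnitaryRep K}

theorem aestronglyMeasurable_indMeasure_iff {E : Type*} [TopologicalSpace E] {f : L → E} :
    AEStronglyMeasurable f (indMeasure ι hι) ↔ AEStronglyMeasurable f (haar : Measure L) := by
  have h := ae_indMeasure ι hι
  constructor
  · rintro ⟨g, hg, hfg⟩
    rw [EventuallyEq, h] at hfg
    exact ⟨g, hg, hfg⟩
  · rintro ⟨g, hg, hfg⟩
    rw [← h] at hfg
    exact ⟨g, hg, hfg⟩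

/-- Frees the norm from the Bruhat function chosen in `indMeasure`: `σ` is unitary, so `‖f‖²`
transforms like a density on `L ⧸ K`, and its weighted integral is the same for all normalized
weights. -/
theorem eLpNorm_two_indMeasure {b : L → ℝ≥0∞} (hb : Measurable b)
    (hb1 : ∀ x, ∫⁻ k, b (x * ι k) ∂(haar : Measure K) = 1) {f : L → σ.space}
    (hm : AEStronglyMeasurable f (haar : Measure L)) (hf : IsCovariant ι σ f) :
    eLpNorm f 2 (indMeasure ι hι) = (∫⁻ x, b x * ‖f x‖ₑ ^ 2 ∂(haar : Measure L)) ^ (1 / 2 : ℝ) := by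
  obtain ⟨f', hf', hff'⟩ := hm
  have hff := hff'
  rw [EventuallyEq, ← ae_indMeasure ι hι] at hff
  rw [eLpNorm_congr_ae hff,
    eLpNorm_eq_lintegral_rpow_enorm_toReal two_ne_zero ENNReal.ofNat_ne_top, lintegral_indMeasure,
    ENNReal.toReal_ofNat]
  simp only [ENNReal.rpow_ofNat]
  have hb0 := (exists_isBruhat ι hι).choose_spec
  rw [← lintegral_mul_eq_of_lintegral_coset_eq_one hι.continuous hb0.measurable
    hb0.lintegral_eq_one hb hb1 (hf'.enorm.pow_const 2) (hf.congr hff').enorm_sq]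
  congr 1
  refine lintegral_congr_ae ?_
  filter_upwards [hff'] with x hx
  rw [hx]

namespace UnitaryRep

/-- The function underlying a vector of the induced representation. -/
noncomputable def indFun (f : (ind ι hι σ).space) : L → σ.space :=
  ((show indSpace ι hι σ from f : indSpace ι hι σ) : Lp σ.space 2 (indMeasure ι hι))

theorem stronglyMeasurable_indFun (f : (ind ι hι σ).space) : StronglyMeasurable (indFun f) :=
  Lp.stronglyMeasurable _

theorem isCovariant_indFun (f : (ind ι hι σ).space) : IsCovariant ι σ (indFun f) :=
  (show indSpace ι hι σ from f).2

theorem indFun_add (f f' : (ind ι hι σ).space) :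
    indFun (f + f') =ᵐ[haar] fun x => indFun f x + indFun f' x := by
  rw [EventuallyEq, ← ae_indMeasure ι hι]
  exact Lp.coeFn_add _ _

theorem indFun_smul (c : ℂ) (f : (ind ι hι σ).space) :
    indFun (c • f) =ᵐ[haar] fun x => c • indFun f x := by
  rw [EventuallyEq, ← ae_indMeasure ι hι]
  exact Lp.coeFn_smul _ _

theorem indFun_hom (g : L) (f : (ind ι hι σ).space) :
    indFun ((ind ι hι σ).hom g f) =ᵐ[haar] fun x => indFun f (g⁻¹ * x) :=
  coeFn_indTranslate ι hι σ g f

theorem ind_norm_eq {b : L → ℝ≥0∞} (hb : Measurable b)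
    (hb1 : ∀ x, ∫⁻ k, b (x * ι k) ∂(haar : Measure K) = 1) (f : (ind ι hι σ).space) :
    ‖f‖ = ((∫⁻ x, b x * ‖indFun f x‖ₑ ^ 2 ∂(haar : Measure L)) ^ (1 / 2 : ℝ)).toReal := by
  change ‖((show indSpace ι hι σ from f : indSpace ι hι σ) : Lp σ.space 2 (indMeasure ι hι))‖ = _
  rw [Lp.norm_def]
  congr 1
  exact eLpNorm_two_indMeasure hb hb1 (stronglyMeasurable_indFun f).aestronglyMeasurable
    (isCovariant_indFun f)

theorem lintegral_indFun_lt_top {b : L → ℝ≥0∞} (hb : Measurable b)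
    (hb1 : ∀ x, ∫⁻ k, b (x * ι k) ∂(haar : Measure K) = 1) (f : (ind ι hι σ).space) :
    ∫⁻ x, b x * ‖indFun f x‖ₑ ^ 2 ∂(haar : Measure L) < ∞ := by
  have h : eLpNorm (indFun f) 2 (indMeasure ι hι) < ∞ :=
    Lp.eLpNorm_lt_top (E := σ.space) (p := 2) (μ := indMeasure ι hι) _
  rw [eLpNorm_two_indMeasure hb hb1 (stronglyMeasurable_indFun f).aestronglyMeasurable
    (isCovariant_indFun f)] at h
  by_contra hlt
  rw [not_lt_top_iff.1 hlt, ENNReal.top_rpow_of_pos (by norm_num)] at h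
  exact lt_irrefl _ h

theorem exists_indFun_ae_eq {b : L → ℝ≥0∞} (hb : Measurable b)
    (hb1 : ∀ x, ∫⁻ k, b (x * ι k) ∂(haar : Measure K) = 1) {f : L → σ.space}
    (hm : AEStronglyMeasurable f (haar : Measure L)) (hf : IsCovariant ι σ f)
    (hlt : ∫⁻ x, b x * ‖f x‖ₑ ^ 2 ∂(haar : Measure L) < ∞) :
    ∃ φ : (ind ι hι σ).space, indFun φ =ᵐ[haar] f := by
  have hL : MemLp f 2 (indMeasure ι hι) := by
    refine ⟨aestronglyMeasurable_indMeasure_iff.2 hm, ?_⟩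
    rw [eLpNorm_two_indMeasure hb hb1 hm hf]
    exact ENNReal.rpow_lt_top_of_nonneg (by norm_num) hlt.ne
  have h := hL.coeFn_toLp
  rw [EventuallyEq, ae_indMeasure] at h
  exact ⟨(⟨hL.toLp, hf.congr (EventuallyEq.symm h)⟩ : indSpace ι hι σ), h⟩

/-- Induction respects unitary equivalence. -/
theorem UnitarilyEquivalent.ind {τ : UnitaryRep K} (h : σ.UnitarilyEquivalent τ)
    (hι : IsClosedEmbedding ι) : (UnitaryRep.ind ι hι σ).UnitarilyEquivalent (UnitaryRep.ind ι hι τ) := by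
  obtain ⟨U, hU⟩ := h
  have hU' : ∀ (k : K) (x : σ.space), U ((σ.hom k)⁻¹ x) = (τ.hom k)⁻¹ (U x) := fun k x => by
    rw [← map_inv, hU, map_inv]
  have hUm : ∀ (k : K) (x : τ.space), U.symm ((τ.hom k)⁻¹ x) = (σ.hom k)⁻¹ (U.symm x) :=
    fun k x => by
      rw [LinearIsometryEquiv.symm_apply_eq, hU', LinearIsometryEquiv.apply_symm_apply]
  have hb := (exists_isBruhat ι hι).choose_spec
  refine .of_relation (fun f F => indFun F =ᵐ[haar] fun x => U (indFun f x)) ?_ ?_ ?_ ?_ ?_ ?_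
  · intro f F f' F' h h'
    filter_upwards [indFun_add f f', indFun_add F F', h, h'] with x h1 h2 h3 h4
    rw [h1, h2, map_add, ← h3, ← h4]
  · intro c f F h
    filter_upwards [indFun_smul c f, indFun_smul c F, h] with x h1 h2 h3
    rw [h1, h2, map_smul, ← h3]
  · intro f F h
    rw [ind_norm_eq hb.measurable hb.lintegral_eq_one f,
      ind_norm_eq hb.measurable hb.lintegral_eq_one F]
    congr 2
    refine lintegral_congr_ae ?_
    filter_upwards [h] with x hx
    rw [hx, LinearIsometryEquiv.enorm_map]
  · intro f
    refine exists_indFun_ae_eq hb.measurable hb.lintegral_eq_one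
      (U.continuous.comp_aestronglyMeasurable
        (stronglyMeasurable_indFun f).aestronglyMeasurable) ?_ ?_
    · intro k
      filter_upwards [isCovariant_indFun f k] with x hx
      rw [hx, map_smul, hU']
    · simpa only [LinearIsometryEquiv.enorm_map] using
        lintegral_indFun_lt_top hb.measurable hb.lintegral_eq_one f
  · intro F
    obtain ⟨f, hf⟩ := exists_indFun_ae_eq (hι := hι) (σ := σ) hb.measurable
      hb.lintegral_eq_one (f := fun x => U.symm (indFun F x))
      (U.symm.continuous.comp_aestronglyMeasurable
        (stronglyMeasurable_indFun F).aestronglyMeasurable)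
      (fun k => by
        filter_upwards [isCovariant_indFun F k] with x hx
        rw [hx, map_smul, hUm])
      (by simpa only [LinearIsometryEquiv.enorm_map] using
        lintegral_indFun_lt_top hb.measurable hb.lintegral_eq_one F)
    refine ⟨f, ?_⟩
    filter_upwards [hf] with x hx
    rw [hx, LinearIsometryEquiv.apply_symm_apply]
  · intro g f F h
    filter_upwards [indFun_hom g f, indFun_hom g F, ae_haar_of_mul_left h g⁻¹] with x h1 h2 h3
    rw [h1, h2, h3]

end UnitaryRep

end Induction

/-! ### The normalizing factor, and measurable families of induced vectors -/

section Induction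

variable {K L : Type*}
  [Group K] [TopologicalSpace K] [IsTopologicalGroup K] [LocallyCompactSpace K]
  [SecondCountableTopology K] [MeasurableSpace K] [BorelSpace K]
  [Group L] [TopologicalSpace L] [IsTopologicalGroup L] [LocallyCompactSpace L] [T2Space L]
  [SecondCountableTopology L] [MeasurableSpace L] [BorelSpace L]

/-- The normalizing factor `(Δ_K / Δ_L)^{1/2}` of unitary induction. -/
noncomputable def indFactor (ι : K →* L) : K →* ℂ where
  toFun k := ((NNReal.sqrt (modularFn k / modularFn (ι k)) : ℝ) : ℂ)
  map_one' := by
    have h : modularFn (1 : K) / modularFn (ι 1) = 1 := by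
      rw [map_one, modularFn, modularFn, modularCharacterFun_map_one, modularCharacterFun_map_one,
        div_self (by simp)]
    rw [h, NNReal.sqrt_one]
    simp
  map_mul' k k' := by
    rw [map_mul, modularFn_mul, modularFn_mul, mul_div_mul_comm, NNReal.sqrt_mul]
    push_cast
    rfl

theorem indFactor_ne_zero (ι : K →* L) (k : K) : indFactor ι k ≠ 0 := by
  change ((NNReal.sqrt (modularFn k / modularFn (ι k)) : ℝ) : ℂ) ≠ 0
  have h := div_pos (modularFn_pos k) (modularFn_pos (ι k))
  simpa using h.ne'

theorem enorm_indFactor_sq (ι : K →* L) (k : K) :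
    ‖indFactor ι k‖ₑ ^ 2 = ((modularFn k / modularFn (ι k) : ℝ≥0) : ℝ≥0∞) :=
  enorm_coe_sqrt_sq _

theorem enorm_inv_indFactor_sq (ι : K →* L) (k : K) :
    ‖(indFactor ι k)⁻¹‖ₑ ^ 2 = ((modularFn (ι k) / modularFn k : ℝ≥0) : ℝ≥0∞) := by
  rw [enorm_inv (indFactor_ne_zero ι k), ← ENNReal.inv_pow, enorm_indFactor_sq,
    ← ENNReal.coe_inv (div_pos (modularFn_pos _) (modularFn_pos _)).ne', inv_div]

theorem measurable_indFactor {ι : K →* L} (hι : Continuous ι) : Measurable (indFactor ι) := by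
  have h1 : Measurable fun k : K => modularFn k / modularFn (ι k) :=
    measurable_modularFn.div (measurable_modularFn.comp hι.measurable)
  exact Complex.measurable_ofReal.comp
    (measurable_coe_nnreal_real.comp (NNReal.continuous_sqrt.measurable.comp h1))

/-- The modular function of the intermediate group cancels. This chain rule is why normalized
induction is compatible with stages. -/
theorem indFactor_comp {M : Type*} [Group M] [TopologicalSpace M] [IsTopologicalGroup M]
    [LocallyCompactSpace M] [T2Space M] [SecondCountableTopology M] [MeasurableSpace M]
    [BorelSpace M] {ι₁ : K →* M} {ι₂ : M →* L} {ι : K →* L} (hc : ∀ k, ι k = ι₂ (ι₁ k)) (k : K) :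
    indFactor ι k = indFactor ι₁ k * indFactor ι₂ (ι₁ k) := by
  change ((NNReal.sqrt (modularFn k / modularFn (ι k)) : ℝ) : ℂ) =
    ((NNReal.sqrt (modularFn k / modularFn (ι₁ k)) : ℝ) : ℂ) *
      ((NNReal.sqrt (modularFn (ι₁ k) / modularFn (ι₂ (ι₁ k))) : ℝ) : ℂ)
  rw [← Complex.ofReal_mul, ← NNReal.coe_mul, ← NNReal.sqrt_mul,
    div_mul_div_cancel₀ (modularFn_pos _).ne', hc]

theorem quasiMeasurePreserving_prodMk_mul_map {ι : K →* L} (hι : Continuous ι) :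
    QuasiMeasurePreserving (fun p : L × K => (p.1 * ι p.2, p.2))
      ((haar : Measure L).prod (haar : Measure K)) ((haar : Measure L).prod (haar : Measure K)) :=
  quasiMeasurePreserving_prodMk_left (T := fun k x => x * ι k)
    (continuous_fst.mul (hι.comp continuous_snd)).measurable
    fun _ => quasiMeasurePreserving_mul_right _ _

theorem quasiMeasurePreserving_prodMk_mul_map_inv {ι : K →* L} (hι : Continuous ι) :
    QuasiMeasurePreserving (fun p : L × K => (p.1 * (ι p.2)⁻¹, p.2))
      ((haar : Measure L).prod (haar : Measure K)) ((haar : Measure L).prod (haar : Measure K)) :=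
  quasiMeasurePreserving_prodMk_left (T := fun k x => x * (ι k)⁻¹)
    (continuous_fst.mul (hι.comp continuous_snd).inv).measurable
    fun _ => quasiMeasurePreserving_mul_right _ _

theorem ae_prod_mul_map {ι : K →* L} (hι : Continuous ι) {p : L → Prop}
    (h : ∀ᵐ x ∂(haar : Measure L), p x) :
    ∀ᵐ q ∂(haar : Measure L).prod (haar : Measure K), p (q.1 * ι q.2) :=
  (quasiMeasurePreserving_fst.comp (quasiMeasurePreserving_prodMk_mul_map hι)).ae h

/-- The nonsingular substitution `(x, k) ↦ (x * (ι k)⁻¹, k)` turns the hypothesis into a condition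
on `x` alone, and then a single good slice in `k` suffices. -/
theorem ae_of_ae_prod_mul_map {ι : K →* L} (hι : Continuous ι) {p : L → Prop}
    (h : ∀ᵐ q ∂(haar : Measure L).prod (haar : Measure K), p (q.1 * ι q.2)) :
    ∀ᵐ x ∂(haar : Measure L), p x := by
  have h1 := (quasiMeasurePreserving_prodMk_mul_map_inv hι).ae h
  simp only [inv_mul_cancel_right] at h1
  exact (ae_ae_of_ae_prod (measurePreserving_swap.quasiMeasurePreserving.ae h1)).exists.choose_spec

namespace UnitaryRep

variable {ι : K →* L} {hι : IsClosedEmbedding ι} {σ : UnitaryRep K}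

theorem ind_ext {f f' : (ind ι hι σ).space} (h : indFun f =ᵐ[haar] indFun f') : f = f' :=
  indSpace_ext h

theorem ind_enorm_sq {b : L → ℝ≥0∞} (hb : Measurable b)
    (hb1 : ∀ x, ∫⁻ k, b (x * ι k) ∂(haar : Measure K) = 1) (f : (ind ι hι σ).space) :
    ‖f‖ₑ ^ 2 = ∫⁻ x, b x * ‖indFun f x‖ₑ ^ 2 ∂(haar : Measure L) := by
  rw [← ofReal_norm, ind_norm_eq hb hb1, ENNReal.ofReal_toReal, ← ENNReal.rpow_ofNat,
    ← ENNReal.rpow_mul]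
  · norm_num
  · exact (ENNReal.rpow_lt_top_of_nonneg (by norm_num) (lintegral_indFun_lt_top hb hb1 f).ne).ne

theorem indFun_hom_inv (g : L) (f : (ind ι hι σ).space) :
    indFun (((ind ι hι σ).hom g)⁻¹ f) =ᵐ[haar] fun x => indFun f (g * x) := by
  rw [← map_inv]
  simpa using indFun_hom g⁻¹ f

/-- A jointly measurable family of vectors of the induced representation. -/
theorem exists_stronglyMeasurable_indFun [SecondCountableTopology σ.space] {X : Type*}
    [MeasurableSpace X] {b : L → ℝ≥0∞} (hb : Measurable b)
    (hb1 : ∀ x, ∫⁻ k, b (x * ι k) ∂(haar : Measure K) = 1) {h : X × L → σ.space}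
    (hh : StronglyMeasurable h) :
    ∃ F : X → (ind ι hι σ).space, StronglyMeasurable F ∧
      ∀ x, IsCovariant ι σ (fun y => h (x, y)) →
        ∫⁻ y, b y * ‖h (x, y)‖ₑ ^ 2 ∂(haar : Measure L) < ∞ →
        indFun (F x) =ᵐ[haar] fun y => h (x, y) := by
  have : SFinite (indMeasure ι hι) := inferInstanceAs (SFinite (Measure.withDensity _ _))
  obtain ⟨F, hF, hFh⟩ := exists_measurable_Lp_of_uncurry (ν := indMeasure ι hι) hh
  have : CompleteSpace (indSpace ι hι σ) := (isClosed_indSpace ι hι σ).completeSpace_coe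
  -- Projecting onto the closed subspace of covariant classes keeps the family measurable and leaves
  -- unchanged the members that are already covariant.
  refine ⟨fun x => (indSpace ι hι σ).orthogonalProjectionOnto (F x),
    ((indSpace ι hι σ).orthogonalProjectionOnto).continuous.comp_stronglyMeasurable hF,
    fun x hx hlt => ?_⟩
  have hhx : AEStronglyMeasurable (fun y => h (x, y)) (haar : Measure L) :=
    (hh.comp_measurable measurable_prodMk_left).aestronglyMeasurable
  have hL : MemLp (fun y => h (x, y)) 2 (indMeasure ι hι) := by
    refine ⟨aestronglyMeasurable_indMeasure_iff.2 hhx, ?_⟩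
    rw [eLpNorm_two_indMeasure hb hb1 hhx hx]
    exact ENNReal.rpow_lt_top_of_nonneg (by norm_num) hlt.ne
  have h1 := hFh x hL
  rw [EventuallyEq, ae_indMeasure] at h1
  have hmem : F x ∈ indSpace ι hι σ := hx.congr (EventuallyEq.symm h1)
  have h2 : ((indSpace ι hι σ).orthogonalProjectionOnto (F x) : Lp σ.space 2 (indMeasure ι hι)) = F x :=
    Submodule.starProjection_eq_self_iff.2 hmem
  have h3 : indFun (hι := hι) (σ := σ) ((indSpace ι hι σ).orthogonalProjectionOnto (F x)) =
      (F x : L → σ.space) :=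
    congrArg (fun f : Lp σ.space 2 (indMeasure ι hι) => (f : L → σ.space)) h2
  rw [h3]
  exact h1

theorem exists_uncurry_indFun [SecondCountableTopology σ.space] {X : Type*}
    [MeasurableSpace X] {F : X → (ind ι hι σ).space} (hF : StronglyMeasurable F) :
    ∃ h : X × L → σ.space, StronglyMeasurable h ∧
      ∀ x, indFun (F x) =ᵐ[haar] fun y => h (x, y) := by
  have : SFinite (indMeasure ι hι) := inferInstanceAs (SFinite (Measure.withDensity _ _))
  have hF' : StronglyMeasurable fun x => (indSpace ι hι σ).subtypeL (F x) :=
    (indSpace ι hι σ).subtypeL.continuous.comp_stronglyMeasurable hF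
  obtain ⟨h, hh, hFh⟩ := exists_uncurry_of_measurable_Lp hF'
  refine ⟨h, hh, fun x => ?_⟩
  have h1 := hFh x
  rw [EventuallyEq, ae_indMeasure] at h1
  exact h1

/-- If a family of functions is covariant almost everywhere for each element of `K`, then almost
all of its members are covariant. -/
theorem ae_isCovariant [SecondCountableTopology σ.space]
    (hσ : Continuous fun p : K × σ.space => σ.hom p.1 p.2) (hι : Continuous ι) {X : Type*}
    [MeasurableSpace X] {μ : Measure X} [SFinite μ] {h : X × L → σ.space}
    (hh : StronglyMeasurable h)
    (hcov : ∀ k, ∀ᵐ p ∂μ.prod (haar : Measure L),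
      h (p.1, p.2 * ι k) = indFactor ι k • (σ.hom k)⁻¹ (h p)) :
    ∀ᵐ x ∂μ, IsCovariant ι σ fun y => h (x, y) := by
  borelize σ.space
  have hact : Measurable fun p : K × σ.space => σ.hom p.1 p.2 := hσ.measurable
  -- Applying `σ.hom k` to both sides removes the inverse, so that the joint continuity `hσ` gives
  -- measurability directly.
  have hm : MeasurableSet {q : K × (X × L) |
      σ.hom q.1 (h (q.2.1, q.2.2 * ι q.1)) = indFactor ι q.1 • h q.2} := by
    have h1 : Measurable fun q : K × (X × L) => h (q.2.1, q.2.2 * ι q.1) := by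
      refine hh.measurable.comp ((measurable_fst.comp measurable_snd).prodMk ?_)
      exact ((measurable_snd.comp measurable_snd).mul (hι.measurable.comp measurable_fst))
    refine measurableSet_eq_fun (hact.comp (measurable_fst.prodMk h1)) ?_
    exact ((measurable_indFactor hι).comp measurable_fst).smul (hh.measurable.comp measurable_snd)
  have hiff : ∀ k x y, h (x, y * ι k) = indFactor ι k • (σ.hom k)⁻¹ (h (x, y)) ↔
      σ.hom k (h (x, y * ι k)) = indFactor ι k • h (x, y) := fun k x y => by
    rw [← map_smul]
    exact (LinearIsometryEquiv.eq_symm_apply (σ.hom k))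
  have h1 : ∀ᵐ q ∂(haar : Measure K).prod (μ.prod (haar : Measure L)),
      σ.hom q.1 (h (q.2.1, q.2.2 * ι q.1)) = indFactor ι q.1 • h q.2 := by
    refine (ae_prod_iff_ae_ae hm).2 (ae_of_all _ fun k => ?_)
    filter_upwards [hcov k] with p hp using (hiff k p.1 p.2).1 hp
  have h2 := (measurePreserving_prodAssoc μ (haar : Measure L)
    (haar : Measure K)).symm.quasiMeasurePreserving.ae
      ((measurePreserving_swap (μ := μ.prod (haar : Measure L))
        (ν := (haar : Measure K))).quasiMeasurePreserving.ae h1)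
  -- With `x` outermost, Fubini gives covariance of almost every section at almost every `k`, which
  -- `isCovariant_of_ae` extends to all `k`.
  filter_upwards [ae_ae_of_ae_prod h2] with x hx
  refine isCovariant_of_ae ?_
  have h3 := (measurePreserving_swap (μ := (haar : Measure K))
    (ν := (haar : Measure L))).quasiMeasurePreserving.ae hx
  filter_upwards [ae_ae_of_ae_prod h3] with k hk
  filter_upwards [hk] with y hy using (hiff k x y).2 hy

end UnitaryRep

end Induction

/-! ### Induction in stages -/

section Stages

variable {K M L : Type*}
  [Group K] [TopologicalSpace K] [IsTopologicalGroup K] [LocallyCompactSpace K]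
  [SecondCountableTopology K] [MeasurableSpace K] [BorelSpace K]
  [Group M] [TopologicalSpace M] [IsTopologicalGroup M] [LocallyCompactSpace M] [T2Space M]
  [SecondCountableTopology M] [MeasurableSpace M] [BorelSpace M]
  [Group L] [TopologicalSpace L] [IsTopologicalGroup L] [LocallyCompactSpace L] [T2Space L]
  [SecondCountableTopology L] [MeasurableSpace L] [BorelSpace L]
  {ι₁ : K →* M} {ι₂ : M →* L} {ι : K →* L}

/-- Integration over `L ⧸ K` is integration over `M ⧸ K` followed by integration over `L ⧸ M`. -/
theorem lintegral_lintegral_coset (h₁ : Continuous ι₁) (h₂ : Continuous ι₂) (hι : Continuous ι)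
    (hc : ∀ k, ι k = ι₂ (ι₁ k)) {b₁ : M → ℝ≥0∞} {b₂ b : L → ℝ≥0∞}
    (hb₁ : Measurable b₁) (hb₁' : ∀ x, ∫⁻ k, b₁ (x * ι₁ k) ∂(haar : Measure K) = 1)
    (hb₂ : Measurable b₂) (hb₂' : ∀ x, ∫⁻ k, b₂ (x * ι₂ k) ∂(haar : Measure M) = 1)
    (hb : Measurable b) (hb' : ∀ x, ∫⁻ k, b (x * ι k) ∂(haar : Measure K) = 1)
    {F : L → ℝ≥0∞} (hF : Measurable F)
    (hcov : ∀ k : K, ∀ᵐ x ∂(haar : Measure L),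
      F (x * ι k) = ((modularFn k / modularFn (ι k) : ℝ≥0) : ℝ≥0∞) * F x) :
    ∫⁻ x, b₂ x * ∫⁻ y, b₁ y * (((modularFn (ι₂ y) / modularFn y : ℝ≥0) : ℝ≥0∞) * F (x * ι₂ y))
      ∂(haar : Measure M) ∂(haar : Measure L) = ∫⁻ x, b x * F x ∂(haar : Measure L) := by
  have hmul : Measurable fun p : L × M => p.1 * ι₂ p.2 :=
    (continuous_fst.mul (h₂.comp continuous_snd)).measurable
  have hmulx : ∀ x, Measurable fun y : M => x * ι₂ y := fun x =>
    (continuous_const.mul h₂).measurable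
  have hmulinv : Measurable fun p : L × M => p.1 * ι₂ p.2⁻¹ :=
    (continuous_fst.mul (h₂.comp continuous_snd.inv)).measurable
  have hΔ : Measurable fun y : M => ((modularFn (ι₂ y) / modularFn y : ℝ≥0) : ℝ≥0∞) :=
    ((measurable_modularFn.comp h₂.measurable).div measurable_modularFn).coe_nnreal_ennreal
  have hΔ' : Measurable fun y : M => (((modularFn y)⁻¹ : ℝ≥0) : ℝ≥0∞) := measurable_modularFn_inv
  -- This convolution of the two weights is what multiplies `F` once the double integral is
  -- rearranged. It has mass one on the cosets of `K`, so it may replace `b`.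
  set b' : L → ℝ≥0∞ := fun x => ∫⁻ y, b₁ y⁻¹ * b₂ (x * ι₂ y) ∂(haar : Measure M) with hb'def
  have hbm' : Measurable b' := Measurable.lintegral_prod_right'
    (f := fun p : L × M => b₁ p.2⁻¹ * b₂ (p.1 * ι₂ p.2))
    ((hb₁.comp measurable_snd.inv).mul (hb₂.comp hmul))
  have hb1' : ∀ x, ∫⁻ k, b' (x * ι k) ∂(haar : Measure K) = 1 := fun x => by
    calc ∫⁻ k, b' (x * ι k) ∂(haar : Measure K)
        = ∫⁻ k, ∫⁻ y, b₁ (y⁻¹ * ι₁ k) * b₂ (x * ι₂ y) ∂(haar : Measure M) ∂(haar : Measure K) := by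
          refine lintegral_congr fun k => ?_
          simp only [hb'def]
          rw [← lintegral_mul_left_eq_self _ (ι₁ k)⁻¹]
          refine lintegral_congr fun y => ?_
          rw [mul_inv_rev, inv_inv, map_mul, map_inv, hc, mul_assoc x, mul_inv_cancel_left]
      _ = ∫⁻ y, ∫⁻ k, b₁ (y⁻¹ * ι₁ k) * b₂ (x * ι₂ y) ∂(haar : Measure K) ∂(haar : Measure M) := by
          refine lintegral_lintegral_swap (Measurable.aemeasurable ?_)
          refine (hb₁.comp (measurable_snd.inv.mul (h₁.measurable.comp measurable_fst))).mul ?_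
          exact hb₂.comp ((hmulx x).comp measurable_snd)
      _ = ∫⁻ y, b₂ (x * ι₂ y) ∂(haar : Measure M) := by
          refine lintegral_congr fun y => ?_
          have hm : Measurable fun k : K => b₁ (y⁻¹ * ι₁ k) :=
            hb₁.comp (continuous_const.mul h₁).measurable
          rw [lintegral_mul_const _ hm, hb₁', one_mul]
      _ = 1 := hb₂' x
  rw [← lintegral_mul_eq_of_lintegral_coset_eq_one hι hb hb' hbm' hb1' hF hcov]
  calc ∫⁻ x, b₂ x * ∫⁻ y, b₁ y * (((modularFn (ι₂ y) / modularFn y : ℝ≥0) : ℝ≥0∞) *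
          F (x * ι₂ y)) ∂(haar : Measure M) ∂(haar : Measure L)
      = ∫⁻ x, ∫⁻ y, b₂ x * (b₁ y * (((modularFn (ι₂ y) / modularFn y : ℝ≥0) : ℝ≥0∞) *
          F (x * ι₂ y))) ∂(haar : Measure M) ∂(haar : Measure L) := by
        refine lintegral_congr fun x => (lintegral_const_mul _ ?_).symm
        exact hb₁.mul (hΔ.mul (hF.comp (hmulx x)))
    _ = ∫⁻ y, ∫⁻ x, b₂ x * (b₁ y * (((modularFn (ι₂ y) / modularFn y : ℝ≥0) : ℝ≥0∞) *
          F (x * ι₂ y))) ∂(haar : Measure L) ∂(haar : Measure M) := by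
        refine lintegral_lintegral_swap (Measurable.aemeasurable ?_)
        exact (hb₂.comp measurable_fst).mul ((hb₁.comp measurable_snd).mul
          ((hΔ.comp measurable_snd).mul (hF.comp hmul)))
    _ = ∫⁻ y, ∫⁻ x, F x * (((modularFn y)⁻¹ : ℝ≥0) * (b₁ y * b₂ (x * ι₂ y⁻¹)))
          ∂(haar : Measure L) ∂(haar : Measure M) := by
        refine lintegral_congr fun y => ?_
        -- Translating `x` by `ι₂ y` yields `Δ_L⁻¹`, which reduces the factor `Δ_L / Δ_M` to
        -- `Δ_M⁻¹`; the latter is absorbed by inversion in `M`.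
        have h := lintegral_mul_right_eq_modularFn (fun x => b₂ (x * ι₂ y⁻¹) *
          (b₁ y * (((modularFn (ι₂ y) / modularFn y : ℝ≥0) : ℝ≥0∞) * F x))) (ι₂ y)
        simp only [mul_assoc _ (ι₂ y), ← map_mul, mul_inv_cancel, map_one, mul_one] at h
        rw [h, ← lintegral_const_mul' _ _ ENNReal.coe_ne_top]
        refine lintegral_congr fun x => ?_
        have h2 : (modularFn (ι₂ y))⁻¹ * (modularFn (ι₂ y) / modularFn y) = (modularFn y)⁻¹ := by
          have := (modularFn_pos (ι₂ y)).ne'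
          field_simp
        rw [← h2, ENNReal.coe_mul]
        ring
    _ = ∫⁻ x, ∫⁻ y, F x * (((modularFn y)⁻¹ : ℝ≥0) * (b₁ y * b₂ (x * ι₂ y⁻¹)))
          ∂(haar : Measure M) ∂(haar : Measure L) := by
        refine lintegral_lintegral_swap (μ := (haar : Measure M)) (ν := (haar : Measure L))
          (f := fun y x => F x * (((modularFn y)⁻¹ : ℝ≥0) * (b₁ y * b₂ (x * ι₂ y⁻¹))))
          (Measurable.aemeasurable ?_)
        exact (hF.comp measurable_snd).mul ((hΔ'.comp measurable_fst).mul
          ((hb₁.comp measurable_fst).mul (hb₂.comp (hmulinv.comp measurable_swap))))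
    _ = ∫⁻ x, b' x * F x ∂(haar : Measure L) := by
        refine lintegral_congr fun x => ?_
        have h1 : Measurable fun y : M => b₁ y⁻¹ * b₂ (x * ι₂ y) :=
          (hb₁.comp measurable_inv).mul (hb₂.comp (hmulx x))
        have h2 := lintegral_modularFn_inv_mul h1
        simp only [inv_inv] at h2
        have h3 : Measurable fun y : M =>
            (((modularFn y)⁻¹ : ℝ≥0) : ℝ≥0∞) * (b₁ y * b₂ (x * ι₂ y⁻¹)) :=
          hΔ'.mul (hb₁.mul (hb₂.comp ((hmulx x).comp measurable_inv)))
        rw [lintegral_const_mul _ h3, h2, mul_comm]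

namespace UnitaryRep

variable {σ : UnitaryRep K} {hι₁ : IsClosedEmbedding ι₁} {hι₂ : IsClosedEmbedding ι₂}
  {hι : IsClosedEmbedding ι}

/-- The relation between a vector of `Ind_K^L σ` and a vector of `Ind_M^L Ind_K^M σ`. -/
def IsStage (f : (ind ι hι σ).space) (F : (ind ι₂ hι₂ (ind ι₁ hι₁ σ)).space) : Prop :=
  ∀ᵐ x ∂(haar : Measure L), ∀ᵐ y ∂(haar : Measure M),
    indFun (indFun F x) y = (indFactor ι₂ y)⁻¹ • indFun f (x * ι₂ y)

/-- The squared modulus of `(indFactor ι₂ y)⁻¹` is `Δ_L / Δ_M`, exactly the density in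
`lintegral_lintegral_coset`. -/
theorem IsStage.norm_eq (hc : ∀ k, ι k = ι₂ (ι₁ k)) {f : (ind ι hι σ).space}
    {F : (ind ι₂ hι₂ (ind ι₁ hι₁ σ)).space} (h : IsStage f F) : ‖f‖ = ‖F‖ := by
  have hb := (exists_isBruhat ι hι).choose_spec
  have hb₁ := (exists_isBruhat ι₁ hι₁).choose_spec
  have hb₂ := (exists_isBruhat ι₂ hι₂).choose_spec
  rw [ind_norm_eq hb.measurable hb.lintegral_eq_one f,
    ind_norm_eq hb₂.measurable hb₂.lintegral_eq_one F,
    ← lintegral_lintegral_coset hι₁.continuous hι₂.continuous hι.continuous hc hb₁.measurable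
      hb₁.lintegral_eq_one hb₂.measurable hb₂.lintegral_eq_one hb.measurable hb.lintegral_eq_one
      ((stronglyMeasurable_indFun f).enorm.pow_const 2) (isCovariant_indFun f).enorm_sq]
  congr 2
  refine lintegral_congr_ae ?_
  filter_upwards [h] with x hx
  rw [ind_enorm_sq hb₁.measurable hb₁.lintegral_eq_one]
  congr 1
  refine lintegral_congr_ae ?_
  filter_upwards [hx] with y hy
  rw [hy, enorm_smul, mul_pow, enorm_inv_indFactor_sq]

/-- The vector at `x` is the restriction of `f` to the coset `x M`, rescaled by the normalizing
factor. For almost every `x` it lies in `Ind_K^M σ`: covariance comes from `ae_isCovariant`, and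
square integrability from the finiteness of the double integral. Covariance over `M` holds because
moving `x` by `ι₂ m` translates `y` by `m`. -/
theorem exists_isStage_right [SecondCountableTopology σ.space]
    (hσ : Continuous fun p : K × σ.space => σ.hom p.1 p.2) (hc : ∀ k, ι k = ι₂ (ι₁ k))
    (f : (ind ι hι σ).space) : ∃ F : (ind ι₂ hι₂ (ind ι₁ hι₁ σ)).space, IsStage f F := by
  have hb := (exists_isBruhat ι hι).choose_spec
  have hb₁ := (exists_isBruhat ι₁ hι₁).choose_spec
  have hb₂ := (exists_isBruhat ι₂ hι₂).choose_spec
  set h : L × M → σ.space := fun p => (indFactor ι₂ p.2)⁻¹ • indFun f (p.1 * ι₂ p.2) with hdef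
  have hmul : Measurable fun p : L × M => p.1 * ι₂ p.2 :=
    (continuous_fst.mul (hι₂.continuous.comp continuous_snd)).measurable
  have hh : StronglyMeasurable h :=
    ((measurable_indFactor hι₂.continuous).comp measurable_snd).inv.stronglyMeasurable.smul
      ((stronglyMeasurable_indFun f).comp_measurable hmul)
  have hcov : ∀ᵐ x ∂(haar : Measure L), IsCovariant ι₁ σ fun y => h (x, y) := by
    refine ae_isCovariant hσ hι₁.continuous hh fun k => ?_
    filter_upwards [ae_prod_mul_map hι₂.continuous (isCovariant_indFun f k)] with p hp
    replace hp : indFun f (p.1 * ι₂ p.2 * ι k) =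
      indFactor ι k • (σ.hom k)⁻¹ (indFun f (p.1 * ι₂ p.2)) := hp
    simp only [hdef]
    rw [map_mul ι₂, ← hc, ← mul_assoc, hp, indFactor_comp hc, map_smul, smul_smul, smul_smul,
      map_mul (indFactor ι₂)]
    congr 1
    have := indFactor_ne_zero ι₂ (ι₁ k)
    have := indFactor_ne_zero ι₂ p.2
    field_simp
  have hint : ∫⁻ x, (exists_isBruhat ι₂ hι₂).choose x * ∫⁻ y, (exists_isBruhat ι₁ hι₁).choose y *
      ‖h (x, y)‖ₑ ^ 2 ∂(haar : Measure M) ∂(haar : Measure L) < ∞ := by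
    refine lt_of_eq_of_lt ?_ (lintegral_indFun_lt_top hb.measurable hb.lintegral_eq_one f)
    rw [← lintegral_lintegral_coset hι₁.continuous hι₂.continuous hι.continuous hc hb₁.measurable
      hb₁.lintegral_eq_one hb₂.measurable hb₂.lintegral_eq_one hb.measurable hb.lintegral_eq_one
      ((stronglyMeasurable_indFun f).enorm.pow_const 2) (isCovariant_indFun f).enorm_sq]
    simp only [hdef, enorm_smul, mul_pow, enorm_inv_indFactor_sq]
  have hfin : ∀ᵐ x ∂(haar : Measure L), ∫⁻ y, (exists_isBruhat ι₁ hι₁).choose y *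
      ‖h (x, y)‖ₑ ^ 2 ∂(haar : Measure M) < ∞ := by
    have hm : Measurable fun x => ∫⁻ y, (exists_isBruhat ι₁ hι₁).choose y *
        ‖h (x, y)‖ₑ ^ 2 ∂(haar : Measure M) := Measurable.lintegral_prod_right'
      (f := fun p : L × M => (exists_isBruhat ι₁ hι₁).choose p.2 * ‖h p‖ₑ ^ 2)
      ((hb₁.measurable.comp measurable_snd).mul (hh.enorm.pow_const 2))
    -- A Bruhat function vanishes nowhere, so a finite product forces a finite inner integral.
    filter_upwards [ae_lt_top (hb₂.measurable.mul hm) hint.ne] with x hx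
    by_contra hlt
    rw [Pi.mul_apply, not_lt_top_iff.1 hlt, ENNReal.mul_top (hb₂.ne_zero x)] at hx
    exact lt_irrefl _ hx
  obtain ⟨F, hF, hFh⟩ := exists_stronglyMeasurable_indFun (hι := hι₁) (σ := σ) hb₁.measurable
    hb₁.lintegral_eq_one hh
  have hFae : ∀ᵐ x ∂(haar : Measure L), indFun (F x) =ᵐ[haar] fun y => h (x, y) := by
    filter_upwards [hcov, hfin] with x h1 h2 using hFh x h1 h2
  obtain ⟨φ, hφ⟩ := exists_indFun_ae_eq (hι := hι₂) (σ := ind ι₁ hι₁ σ) hb₂.measurable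
    hb₂.lintegral_eq_one hF.aestronglyMeasurable (fun m => by
      change ∀ᵐ x ∂(haar : Measure L), F (x * ι₂ m) =
        indFactor ι₂ m • ((ind ι₁ hι₁ σ).hom m)⁻¹ (F x)
      filter_upwards [hFae, ae_haar_of_mul_right hFae (ι₂ m)] with x h1 h2
      refine ind_ext ?_
      filter_upwards [h2, indFun_smul (indFactor ι₂ m) (((ind ι₁ hι₁ σ).hom m)⁻¹ (F x)),
        indFun_hom_inv m (F x), ae_haar_of_mul_left h1 m] with y e1 e2 e3 e4
      rw [e1, e2, e3, e4]
      simp only [hdef]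
      rw [smul_smul, map_mul, map_mul, mul_assoc]
      congr 1
      have := indFactor_ne_zero ι₂ m
      have := indFactor_ne_zero ι₂ y
      field_simp)
    (by
      refine lt_of_eq_of_lt (lintegral_congr_ae ?_) hint
      filter_upwards [hFae] with x hx
      rw [ind_enorm_sq hb₁.measurable hb₁.lintegral_eq_one]
      congr 1
      refine lintegral_congr_ae ?_
      filter_upwards [hx] with y hy
      rw [hy])
  refine ⟨φ, ?_⟩
  filter_upwards [hφ, hFae] with x h1 h2
  rw [h1]
  exact h2

/-- The value of `f` at `x` has to be `indFactor ι₂ y • F (x * (ι₂ y)⁻¹) y` for almost every `y`.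
Covariance of `F` over `M` says that this expression is invariant under each left translation of `y`
up to null sets, so it is almost everywhere a function of `x` alone. To make sense of it as a
function of two variables, `F` is first replaced by a jointly measurable representative. -/
theorem exists_isStage_left [SecondCountableTopology σ.space]
    (hc : ∀ k, ι k = ι₂ (ι₁ k))
    (F : (ind ι₂ hι₂ (ind ι₁ hι₁ σ)).space) : ∃ f : (ind ι hι σ).space, IsStage f F := by
  have hb := (exists_isBruhat ι hι).choose_spec
  have hb₁ := (exists_isBruhat ι₁ hι₁).choose_spec
  have hb₂ := (exists_isBruhat ι₂ hι₂).choose_spec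
  obtain ⟨h, hh, hFh⟩ := exists_uncurry_indFun (stronglyMeasurable_indFun F)
  have hq := quasiMeasurePreserving_prodMk_mul_map hι₂.continuous
  have hq' := quasiMeasurePreserving_prodMk_mul_map_inv hι₂.continuous
  have hcovM : ∀ m : M, ∀ᵐ p ∂(haar : Measure L).prod (haar : Measure M),
      h (p.1 * ι₂ m, p.2) = indFactor ι₂ m • h (p.1, m * p.2) := fun m => by
    have hm : MeasurableSet {p : L × M | h (p.1 * ι₂ m, p.2) = indFactor ι₂ m • h (p.1, m * p.2)} :=
      (hh.comp_measurable (by fun_prop)).measurableSet_eq_fun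
        ((hh.comp_measurable (g := fun p : L × M => (p.1, m * p.2)) (by fun_prop)).const_smul _)
    refine (ae_prod_iff_ae_ae hm).2 ?_
    filter_upwards [isCovariant_indFun F m] with x hx
    replace hx : indFun F (x * ι₂ m) =
      indFactor ι₂ m • ((ind ι₁ hι₁ σ).hom m)⁻¹ (indFun F x) := hx
    filter_upwards [hFh (x * ι₂ m), ae_haar_of_mul_left (hFh x) m,
      indFun_smul (indFactor ι₂ m) (((ind ι₁ hι₁ σ).hom m)⁻¹ (indFun F x)),
      indFun_hom_inv m (indFun F x)] with y e1 e2 e3 e4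
    rw [← e1, hx, e3, e4, e2]
  have hcm := measurable_indFactor hι₂.continuous
  set k : L × M → σ.space := fun p => indFactor ι₂ p.2 • h (p.1 * (ι₂ p.2)⁻¹, p.2) with hkdef
  have hk : StronglyMeasurable k :=
    (hcm.comp measurable_snd).stronglyMeasurable.smul (hh.comp_measurable hq'.measurable)
  obtain ⟨φ, hφ, hkφ⟩ := exists_ae_eq_comp_fst_of_forall_ae_mul_left (μ := (haar : Measure L)) hk
    fun m => by
      have hqm := quasiMeasurePreserving_prodMk_left (μ := (haar : Measure L))
        (ν := (haar : Measure M)) (T := fun _ x => x * (ι₂ m)⁻¹) (by fun_prop)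
        fun _ => quasiMeasurePreserving_mul_right _ _
      filter_upwards [(hqm.comp hq').ae (hcovM m)] with p hp
      simp only [Function.comp_apply, inv_mul_cancel_right] at hp
      simp only [hkdef]
      rw [hp, smul_smul, map_mul, map_mul, mul_inv_rev, mul_assoc p.1, mul_comm (indFactor ι₂ m)]
  have hhφ : ∀ᵐ p ∂(haar : Measure L).prod (haar : Measure M),
      h p = (indFactor ι₂ p.2)⁻¹ • φ (p.1 * ι₂ p.2) := by
    filter_upwards [hq.ae hkφ] with p hp
    simp only [hkdef, mul_inv_cancel_right] at hp
    rw [← hp, inv_smul_smul₀ (indFactor_ne_zero _ _)]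
  -- Covariance is tested at the points `x * ι₂ y`, where `φ` is `h` up to the normalizing factor;
  -- there it is the covariance of the inner vectors combined with `indFactor_comp`.
  have hcov : IsCovariant ι σ φ := fun k => by
    have h1 : ∀ᵐ p ∂(haar : Measure L).prod (haar : Measure M),
        h (p.1, p.2 * ι₁ k) = indFactor ι₁ k • (σ.hom k)⁻¹ (h p) := by
      have hm : MeasurableSet {p : L × M |
          h (p.1, p.2 * ι₁ k) = indFactor ι₁ k • (σ.hom k)⁻¹ (h p)} :=
        (hh.comp_measurable (by fun_prop)).measurableSet_eq_fun
          (((σ.hom k)⁻¹.continuous.comp_stronglyMeasurable hh).const_smul _)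
      refine (ae_prod_iff_ae_ae hm).2 (ae_of_all _ fun x => ?_)
      filter_upwards [hFh x, ae_haar_of_mul_right (hFh x) (ι₁ k),
        isCovariant_indFun (indFun F x) k] with y e1 e2 e3
      rw [← e2, e3, e1]
      rfl
    have hqr := quasiMeasurePreserving_prodMk_right (μ := (haar : Measure L))
      (ν := (haar : Measure M)) (T := fun _ y => y * ι₁ k) (by fun_prop)
      fun _ => quasiMeasurePreserving_mul_right _ _
    refine ae_of_ae_prod_mul_map hι₂.continuous ?_
    filter_upwards [h1, hhφ, hqr.ae hhφ] with p e1 e2 e3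
    rw [e3, e2] at e1
    simp only [map_smul, map_mul, ← hc, ← mul_assoc] at e1
    change φ (p.1 * ι₂ p.2 * ι k) = indFactor ι k • (σ.hom k)⁻¹ (φ (p.1 * ι₂ p.2))
    rw [indFactor_comp hc]
    have n1 := indFactor_ne_zero ι₂ (ι₁ k)
    have n2 := indFactor_ne_zero ι₂ p.2
    rw [inv_smul_eq_iff₀ (mul_ne_zero n2 n1), smul_smul, smul_smul] at e1
    rw [e1]
    congr 1
    field_simp
  have hint : ∫⁻ x, (exists_isBruhat ι hι).choose x * ‖φ x‖ₑ ^ 2 ∂(haar : Measure L) < ∞ := by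
    refine lt_of_eq_of_lt ?_ (lintegral_indFun_lt_top hb₂.measurable hb₂.lintegral_eq_one F)
    rw [← lintegral_lintegral_coset hι₁.continuous hι₂.continuous hι.continuous hc hb₁.measurable
      hb₁.lintegral_eq_one hb₂.measurable hb₂.lintegral_eq_one hb.measurable hb.lintegral_eq_one
      (hφ.enorm.pow_const 2) hcov.enorm_sq]
    refine lintegral_congr_ae ?_
    filter_upwards [ae_ae_of_ae_prod hhφ] with x hx
    rw [ind_enorm_sq hb₁.measurable hb₁.lintegral_eq_one]
    congr 1
    refine lintegral_congr_ae ?_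
    filter_upwards [hx, hFh x] with y hy hy'
    rw [hy', hy, enorm_smul, mul_pow, enorm_inv_indFactor_sq]
  obtain ⟨f, hf⟩ := exists_indFun_ae_eq (hι := hι) (σ := σ) hb.measurable hb.lintegral_eq_one
    hφ.aestronglyMeasurable hcov hint
  refine ⟨f, ?_⟩
  filter_upwards [ae_ae_of_ae_prod hhφ,
    ae_ae_of_ae_prod (ae_prod_mul_map hι₂.continuous hf)] with x h1 h2
  filter_upwards [h1, h2, hFh x] with y e1 e2 e3
  rw [e3, e1, e2]

/-- **Induction in stages.** -/
theorem ind_unitarilyEquivalent_ind_ind [SecondCountableTopology σ.space]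
    (hσ : Continuous fun p : K × σ.space => σ.hom p.1 p.2) (hι₁ : IsClosedEmbedding ι₁)
    (hι₂ : IsClosedEmbedding ι₂) (hι : IsClosedEmbedding ι) (hc : ∀ k, ι k = ι₂ (ι₁ k)) :
    (ind ι hι σ).UnitarilyEquivalent (ind ι₂ hι₂ (ind ι₁ hι₁ σ)) := by
  refine .of_relation IsStage ?_ ?_ (fun f F h => h.norm_eq hc)
    (fun f => exists_isStage_right hσ hc f) (fun F => exists_isStage_left hc F) ?_
  · intro f F f' F' h h'
    filter_upwards [h, h', indFun_add F F',
      ae_ae_of_ae_prod (ae_prod_mul_map hι₂.continuous (indFun_add f f'))] with x h1 h2 h3 h4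
    rw [h3]
    filter_upwards [h1, h2, indFun_add (indFun F x) (indFun F' x), h4] with y e1 e2 e3 e4
    rw [e3, e4, e1, e2, smul_add]
  · intro c f F h
    filter_upwards [h, indFun_smul c F,
      ae_ae_of_ae_prod (ae_prod_mul_map hι₂.continuous (indFun_smul c f))] with x h1 h3 h4
    rw [h3]
    filter_upwards [h1, indFun_smul c (indFun F x), h4] with y e1 e3 e4
    rw [e3, e4, e1, smul_comm]
  · intro g f F h
    filter_upwards [ae_haar_of_mul_left h g⁻¹, indFun_hom g F,
      ae_ae_of_ae_prod (ae_prod_mul_map hι₂.continuous (indFun_hom g f))] with x h1 h2 h3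
    rw [h2]
    filter_upwards [h1, h3] with y e1 e3
    rw [e1, e3, mul_assoc]

end UnitaryRep

end Stages

/-! ### Haar measure and modular functions of a semidirect product with abelian kernel -/

section SplitExtension

variable {G V M : Type*}
  [Group G] [TopologicalSpace G] [IsTopologicalGroup G] [LocallyCompactSpace G]
  [SecondCountableTopology G] [MeasurableSpace G] [BorelSpace G]
  [Group V] [TopologicalSpace V] [IsTopologicalGroup V] [LocallyCompactSpace V]
  [SecondCountableTopology V] [MeasurableSpace V] [BorelSpace V]
  [Group M] [TopologicalSpace M] [IsTopologicalGroup M] [LocallyCompactSpace M]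
  [SecondCountableTopology M] [MeasurableSpace M] [BorelSpace M]

/-- `M` is the topological semidirect product of its subgroup `G` and its abelian normal subgroup
`V`, with `g⁻¹ v g = α g v`. -/
structure IsSplitExtension (jG : G →* M) (jV : V →* M) (α : G → V → V) : Prop where
  isHomeomorph : IsHomeomorph fun p : G × V => jG p.1 * jV p.2
  mul_eq : ∀ g v, jV v * jG g = jG g * jV (α g v)
  comm : ∀ v w : V, v * w = w * v

namespace IsSplitExtension

variable {jG : G →* M} {jV : V →* M} {α : G → V → V} (hM : IsSplitExtension jG jV α)

/-- The coordinates `(g, v) ↦ g v`. -/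
noncomputable def coord : G × V ≃ₜ M := hM.isHomeomorph.homeomorph _

theorem coord_apply (p : G × V) : hM.coord p = jG p.1 * jV p.2 := rfl

theorem mul_coord_symm (x : M) : jG (hM.coord.symm x).1 * jV (hM.coord.symm x).2 = x :=
  hM.coord.apply_symm_apply x

theorem coord_symm_mul_right (x : M) (g : G) :
    hM.coord.symm (x * jG g) = ((hM.coord.symm x).1 * g, α g (hM.coord.symm x).2) := by
  rw [Homeomorph.symm_apply_eq, coord_apply, map_mul, mul_assoc, ← hM.mul_eq, ← mul_assoc,
    mul_coord_symm]

theorem coord_symm_mul_right' (x : M) (v : V) :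
    hM.coord.symm (x * jV v) = ((hM.coord.symm x).1, (hM.coord.symm x).2 * v) := by
  rw [Homeomorph.symm_apply_eq, coord_apply, map_mul, ← mul_assoc, mul_coord_symm]

theorem coord_symm_mul_left (x : M) (g : G) :
    hM.coord.symm (jG g * x) = (g * (hM.coord.symm x).1, (hM.coord.symm x).2) := by
  rw [Homeomorph.symm_apply_eq, coord_apply, map_mul, mul_assoc, mul_coord_symm]

theorem coord_symm_mul_left' (x : M) (v : V) : hM.coord.symm (jV v * x) =
    ((hM.coord.symm x).1, α (hM.coord.symm x).1 v * (hM.coord.symm x).2) := by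
  rw [Homeomorph.symm_apply_eq, coord_apply, map_mul, ← mul_assoc, ← hM.mul_eq, mul_assoc,
    mul_coord_symm]

theorem continuous_right (hM : IsSplitExtension jG jV α) : Continuous jV := by
  have h : Continuous fun v : V => hM.coord (1, v) := hM.coord.continuous.comp (by fun_prop)
  simpa [coord_apply] using h

/-- The action is read off as the `V`-coordinate of `v g`. -/
theorem continuous_act (hM : IsSplitExtension jG jV α) (g : G) : Continuous (α g) := by
  have h : Continuous fun v : V => (hM.coord.symm (jV v * jG g)).2 :=
    continuous_snd.comp (hM.coord.symm.continuous.comp (hM.continuous_right.mul continuous_const))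
  convert h using 2 with v
  rw [hM.mul_eq, ← hM.coord_apply (g, α g v), Homeomorph.symm_apply_apply]

/-- In the coordinates `g v`, left multiplication by `g₀ v₀` is `(g, v) ↦ (g₀ g, α g v₀ * v)`, a
skew product of left translations. With the factors in this order no modular correction appears. -/
theorem isMulLeftInvariant_map :
    IsMulLeftInvariant (map hM.coord ((haar : Measure G).prod (haar : Measure V))) := by
  refine ⟨fun m => ?_⟩
  have hem : Measurable hM.coord := hM.coord.continuous.measurable
  have hS : Continuous fun p : G × V => hM.coord.symm (m * hM.coord p) :=
    hM.coord.symm.continuous.comp (continuous_const.mul hM.coord.continuous)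
  have hSp : ∀ p : G × V, hM.coord.symm (m * hM.coord p) = ((hM.coord.symm m).1 * p.1,
      α p.1 (hM.coord.symm m).2 * p.2) := fun p => by
    rw [← hM.mul_coord_symm m, mul_assoc, coord_symm_mul_left, coord_symm_mul_left',
      mul_coord_symm, Homeomorph.symm_apply_apply]
  have hmp : MeasurePreserving (fun p : G × V => hM.coord.symm (m * hM.coord p))
      ((haar : Measure G).prod (haar : Measure V)) ((haar : Measure G).prod (haar : Measure V)) := by
    have h1 : (fun p : G × V => hM.coord.symm (m * hM.coord p)) =
        fun p => ((hM.coord.symm m).1 * p.1, α p.1 (hM.coord.symm m).2 * p.2) := funext hSp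
    have h2 : Measurable fun p : G × V => α p.1 (hM.coord.symm m).2 * p.2 := by
      have h3 := (continuous_snd.comp hS).measurable
      convert h3 using 2 with p
      exact (congrArg Prod.snd (hSp p)).symm
    rw [h1]
    exact (measurePreserving_mul_left (haar : Measure G) _).skew_product
      (g := fun g v => α g (hM.coord.symm m).2 * v) h2
      (ae_of_all _ fun g => map_mul_left_eq_self _ _)
  rw [map_map (measurable_const_mul m) hem]
  conv_rhs => rw [← hmp.map_eq, map_map hem hS.measurable]
  congr 1
  ext p
  exact (hM.coord.apply_symm_apply _).symm

/-- Haar measure in the coordinates `(g, v) ↦ g v`. -/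
theorem exists_haar_eq : ∃ c : ℝ≥0, c ≠ 0 ∧ (haar : Measure M) =
    c • map hM.coord ((haar : Measure G).prod (haar : Measure V)) := by
  have := hM.isMulLeftInvariant_map
  have : IsFiniteMeasureOnCompacts
      (map hM.coord ((haar : Measure G).prod (haar : Measure V))) :=
    IsFiniteMeasureOnCompacts.map _ hM.coord
  have h := isMulLeftInvariant_eq_smul
    (map hM.coord ((haar : Measure G).prod (haar : Measure V))) (haar : Measure M)
  set c := haarScalarFactor (map hM.coord ((haar : Measure G).prod (haar : Measure V)))
    (haar : Measure M) with hcdef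
  have hc : c ≠ 0 := by
    intro h0
    rw [h0, zero_smul, Measure.map_eq_zero_iff hM.coord.continuous.aemeasurable] at h
    exact NeZero.ne ((haar : Measure G).prod (haar : Measure V)) h
  refine ⟨c⁻¹, inv_ne_zero hc, ?_⟩
  rw [h, smul_smul, inv_mul_cancel₀ hc, one_smul]

theorem lintegral_haar_eq {c : ℝ≥0} (hc : (haar : Measure M) =
      c • map hM.coord ((haar : Measure G).prod (haar : Measure V))) {F : M → ℝ≥0∞}
    (hF : Measurable F) : ∫⁻ x, F x ∂(haar : Measure M) =
      c * ∫⁻ g, ∫⁻ v, F (jG g * jV v) ∂(haar : Measure V) ∂(haar : Measure G) := by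
  have hFe : Measurable fun p => F (hM.coord p) := hF.comp hM.coord.continuous.measurable
  rw [hc, lintegral_smul_measure, lintegral_map hF hM.coord.continuous.measurable,
    lintegral_prod _ hFe.aemeasurable]
  rfl

theorem quasiMeasurePreserving_coord : QuasiMeasurePreserving hM.coord
    ((haar : Measure G).prod (haar : Measure V)) (haar : Measure M) := by
  obtain ⟨c, hc0, hc⟩ := hM.exists_haar_eq
  refine ⟨hM.coord.continuous.measurable, AbsolutelyContinuous.mk fun s _ h0 => ?_⟩
  rw [hc, Measure.smul_apply] at h0
  simpa [hc0] using h0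

theorem quasiMeasurePreserving_coord_symm : QuasiMeasurePreserving hM.coord.symm
    (haar : Measure M) ((haar : Measure G).prod (haar : Measure V)) := by
  obtain ⟨c, hc0, hc⟩ := hM.exists_haar_eq
  refine ⟨hM.coord.symm.continuous.measurable, AbsolutelyContinuous.mk fun s hs h0 => ?_⟩
  rw [hc, Measure.map_smul, map_map hM.coord.symm.continuous.measurable
    hM.coord.continuous.measurable, hM.coord.symm_comp_self, Measure.map_id, Measure.smul_apply, h0,
    smul_zero]

theorem ae_comp_fst {p : G → Prop} (h : ∀ᵐ g ∂(haar : Measure G), p g) :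
    ∀ᵐ x ∂(haar : Measure M), p (hM.coord.symm x).1 :=
  (quasiMeasurePreserving_fst.comp hM.quasiMeasurePreserving_coord_symm).ae h

theorem ae_of_ae_comp_fst {p : G → Prop}
    (h : ∀ᵐ x ∂(haar : Measure M), p (hM.coord.symm x).1) : ∀ᵐ g ∂(haar : Measure G), p g := by
  have h1 := hM.quasiMeasurePreserving_coord.ae h
  simp only [Homeomorph.symm_apply_apply] at h1
  filter_upwards [ae_ae_of_ae_prod h1] with g hg using hg.exists.choose_spec

/-- Right translation by `v` only translates the `V`-coordinate, and an abelian group is unimodular.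
-/
theorem modularFn_right (hM : IsSplitExtension jG jV α) (v : V) : modularFn (jV v) = 1 := by
  obtain ⟨c, hc0, hc⟩ := hM.exists_haar_eq
  obtain ⟨ψ, hψ, h0, ht⟩ := exists_lintegral_ne M
  have h1 := lintegral_mul_right_eq_modularFn ψ (jV v)
  have h2 : ∫⁻ x, ψ (x * jV v) ∂(haar : Measure M) = ∫⁻ x, ψ x ∂haar := by
    have hψr : Measurable fun x => ψ (x * jV v) := hψ.comp (measurable_mul_const _)
    rw [hM.lintegral_haar_eq hc hψ, hM.lintegral_haar_eq hc hψr]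
    congr 1
    refine lintegral_congr fun g => ?_
    rw [← lintegral_mul_left_eq_self (fun w => ψ (jG g * jV w)) v]
    refine lintegral_congr fun w => ?_
    rw [hM.comm v w, map_mul, mul_assoc]
  rw [h2] at h1
  have h3 : (((modularFn (jV v))⁻¹ : ℝ≥0) : ℝ≥0∞) = 1 :=
    (ENNReal.mul_left_inj h0 ht).1 (by rw [← h1, one_mul])
  exact inv_eq_one.1 (ENNReal.coe_eq_one.1 h3)

/-- A product function on `M` is translated on the right by `g` and integrated in two ways: globally
this costs `Δ_M(g)⁻¹`, while in coordinates it costs `Δ_G(g)⁻¹` on `G` and the dilation of `α g` on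
`V`. -/
theorem lintegral_act (hM : IsSplitExtension jG jV α) {ψ : V → ℝ≥0∞}
    (hψ : Measurable ψ) (g : G) :
    ∫⁻ v, ψ (α g v) ∂(haar : Measure V) =
      ((modularFn g / modularFn (jG g) : ℝ≥0) : ℝ≥0∞) * ∫⁻ v, ψ v ∂(haar : Measure V) := by
  obtain ⟨c, hc0, hc⟩ := hM.exists_haar_eq
  obtain ⟨φ, hφ, h0, ht⟩ := exists_lintegral_ne G
  set F : M → ℝ≥0∞ := fun x => φ (hM.coord.symm x).1 * ψ (hM.coord.symm x).2 with hFdef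
  have hsymm := hM.coord.symm.continuous.measurable
  have hF : Measurable F :=
    (hφ.comp (measurable_fst.comp hsymm)).mul (hψ.comp (measurable_snd.comp hsymm))
  have hFe : ∀ (g' : G) (v : V), F (jG g' * jV v) = φ g' * ψ v := fun g' v => by
    rw [hFdef]
    simp only
    rw [← hM.coord_apply (g', v), Homeomorph.symm_apply_apply]
  have hFr : ∀ (g' : G) (v : V), F (jG g' * jV v * jG g) = φ (g' * g) * ψ (α g v) := fun g' v => by
    rw [hFdef]
    simp only [coord_symm_mul_right]
    rw [← hM.coord_apply (g', v), Homeomorph.symm_apply_apply]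
  have h1 := lintegral_mul_right_eq_modularFn F (jG g)
  have hFrm : Measurable fun x => F (x * jG g) := hF.comp (measurable_mul_const _)
  rw [hM.lintegral_haar_eq hc hF, hM.lintegral_haar_eq hc hFrm] at h1
  have hψα : Measurable fun v => ψ (α g v) := hψ.comp (hM.continuous_act g).measurable
  have hφg : Measurable fun g' => φ (g' * g) := hφ.comp (measurable_mul_const _)
  simp only [hFe, hFr] at h1
  simp only [lintegral_const_mul _ hψ, lintegral_const_mul _ hψα] at h1
  rw [lintegral_mul_const _ hφ, lintegral_mul_const _ hφg, lintegral_mul_right_eq_modularFn,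
    mul_left_comm _ (c : ℝ≥0∞),
    ENNReal.mul_right_inj (ENNReal.coe_ne_zero.2 hc0) ENNReal.coe_ne_top] at h1
  have hG := (modularFn_pos g).ne'
  have h2 : (modularFn g / modularFn (jG g) : ℝ≥0) = modularFn g * (modularFn (jG g))⁻¹ :=
    div_eq_mul_inv _ _
  have h3 : ((modularFn g : ℝ≥0) : ℝ≥0∞) * (((modularFn g)⁻¹ : ℝ≥0) : ℝ≥0∞) = 1 := by
    rw [← ENNReal.coe_mul, mul_inv_cancel₀ hG, ENNReal.coe_one]
  refine (ENNReal.mul_right_inj h0 ht).1 ?_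
  calc (∫⁻ x, φ x ∂(haar : Measure G)) * ∫⁻ v, ψ (α g v) ∂(haar : Measure V)
      = modularFn g * (((modularFn g)⁻¹ : ℝ≥0) * (∫⁻ x, φ x ∂(haar : Measure G)) *
          ∫⁻ v, ψ (α g v) ∂(haar : Measure V)) := by
        rw [← mul_assoc, ← mul_assoc, h3, one_mul]
    _ = _ := by
        rw [h1, h2, ENNReal.coe_mul]
        ring

/-- Restricting the first factor does not change the ratio of the modular functions. -/
theorem modularFn_div_modularFn {N K : Type*}
    [Group N] [TopologicalSpace N] [IsTopologicalGroup N] [LocallyCompactSpace N]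
    [SecondCountableTopology N] [MeasurableSpace N] [BorelSpace N]
    [Group K] [TopologicalSpace K] [IsTopologicalGroup K] [LocallyCompactSpace K]
    [SecondCountableTopology K] [MeasurableSpace K] [BorelSpace K]
    (hM : IsSplitExtension jG jV α) {kN : N →* K} {kV : V →* K} {i : N →* G}
    (hK : IsSplitExtension kN kV fun n => α (i n)) (n : N) :
    modularFn (kN n) / modularFn (jG (i n)) = modularFn n / modularFn (i n) := by
  obtain ⟨ψ, hψ, h0, ht⟩ := exists_lintegral_ne V
  -- Both semidirect products compute the same dilation of Haar measure on `V` by `α (i n)`.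
  have h1 := (hM.lintegral_act hψ (i n)).symm.trans (hK.lintegral_act hψ n)
  have h2 := ENNReal.coe_inj.1 ((ENNReal.mul_left_inj h0 ht).1 h1)
  have := (modularFn_pos n).ne'
  have := (modularFn_pos (i n)).ne'
  have := (modularFn_pos (kN n)).ne'
  have := (modularFn_pos (jG (i n))).ne'
  field_simp at h2 ⊢
  linear_combination (norm := ring_nf) h2

end IsSplitExtension

end SplitExtension

/-! ### Inducing `σ ⊗ ξ` through a semidirect product -/

section TensorInduction

variable {G V M N K : Type*}
  [Group G] [TopologicalSpace G] [IsTopologicalGroup G] [LocallyCompactSpace G] [T2Space G]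
  [SecondCountableTopology G] [MeasurableSpace G] [BorelSpace G]
  [Group V] [TopologicalSpace V] [IsTopologicalGroup V] [LocallyCompactSpace V]
  [SecondCountableTopology V] [MeasurableSpace V] [BorelSpace V]
  [Group M] [TopologicalSpace M] [IsTopologicalGroup M] [LocallyCompactSpace M] [T2Space M]
  [SecondCountableTopology M] [MeasurableSpace M] [BorelSpace M]
  [Group N] [TopologicalSpace N] [IsTopologicalGroup N] [LocallyCompactSpace N]
  [SecondCountableTopology N] [MeasurableSpace N] [BorelSpace N]
  [Group K] [TopologicalSpace K] [IsTopologicalGroup K] [LocallyCompactSpace K]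
  [SecondCountableTopology K] [MeasurableSpace K] [BorelSpace K]
  {jG : G →* M} {jV : V →* M} {kN : N →* K} {kV : V →* K} {iN : N →* G} {ι : K →* M}
  {α : G → V → V}

namespace IsSplitExtension

/-- The coset spaces `M ⧸ K` and `G ⧸ N` coincide. Integrating the weight of `M` over `V` gives a
weight on `G`, up to the constants relating the chosen Haar measures. -/
theorem exists_forall_lintegral_coset (hM : IsSplitExtension jG jV α)
    (hK : IsSplitExtension kN kV fun n => α (iN n)) (hcN : ∀ n, ι (kN n) = jG (iN n))
    (hcV : ∀ v, ι (kV v) = jV v) (hN : IsClosedEmbedding iN) (hι : IsClosedEmbedding ι) :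
    ∃ c : ℝ≥0, c ≠ 0 ∧ ∀ Φ : G → ℝ≥0∞, Measurable Φ →
      (∀ n, ∀ᵐ g ∂(haar : Measure G),
        Φ (g * iN n) = ((modularFn n / modularFn (iN n) : ℝ≥0) : ℝ≥0∞) * Φ g) →
      ∫⁻ x, (exists_isBruhat ι hι).choose x * (c * Φ (hM.coord.symm x).1) ∂(haar : Measure M) =
        ∫⁻ g, (exists_isBruhat iN hN).choose g * Φ g ∂(haar : Measure G) := by
  obtain ⟨cM, hcM0, hcM⟩ := hM.exists_haar_eq
  obtain ⟨cK, hcK0, hcK⟩ := hK.exists_haar_eq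
  have hb := (exists_isBruhat ι hι).choose_spec
  have hbN := (exists_isBruhat iN hN).choose_spec
  set b := (exists_isBruhat ι hι).choose
  -- `cK` normalizes the averaged weight on the cosets of `N`, while `cM` enters through the
  -- integral over `M`.
  refine ⟨cK / cM, div_ne_zero hcK0 hcM0, fun Φ hΦ hcov => ?_⟩
  have hcoord : Measurable fun p : G × V => jG p.1 * jV p.2 := hM.coord.continuous.measurable
  have hbv : ∀ g, Measurable fun v => b (jG g * jV v) := fun g =>
    hb.measurable.comp (hcoord.comp measurable_prodMk_left)
  set b' : G → ℝ≥0∞ := fun g => cK * ∫⁻ v, b (jG g * jV v) ∂(haar : Measure V) with hb'def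
  have hb' : Measurable b' := (Measurable.lintegral_prod_right'
    (f := fun p : G × V => b (jG p.1 * jV p.2)) (hb.measurable.comp hcoord)).const_mul _
  have hb'1 : ∀ g, ∫⁻ n, b' (g * iN n) ∂(haar : Measure N) = 1 := fun g => by
    have hbk : Measurable fun k : K => b (jG g * ι k) :=
      hb.measurable.comp (continuous_const.mul hι.continuous).measurable
    have hm : Measurable fun n => ∫⁻ v, b (jG (g * iN n) * jV v) ∂(haar : Measure V) :=
      (Measurable.lintegral_prod_right' (f := fun p : G × V => b (jG p.1 * jV p.2))
        (hb.measurable.comp hcoord)).comp (continuous_const.mul hN.continuous).measurable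
    rw [← hb.lintegral_eq_one (jG g), hK.lintegral_haar_eq hcK hbk, lintegral_const_mul _ hm]
    simp only [map_mul, hcN, hcV, mul_assoc]
  rw [← lintegral_mul_eq_of_lintegral_coset_eq_one hN.continuous hbN.measurable
    hbN.lintegral_eq_one hb' hb'1 hΦ hcov]
  have hF : Measurable fun x => b x * (((cK / cM : ℝ≥0) : ℝ≥0∞) * Φ (hM.coord.symm x).1) :=
    hb.measurable.mul ((hΦ.comp (measurable_fst.comp
      hM.coord.symm.continuous.measurable)).const_mul _)
  have hsymm : ∀ g v, hM.coord.symm (jG g * jV v) = (g, v) := fun g v =>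
    hM.coord.symm_apply_apply (g, v)
  rw [hM.lintegral_haar_eq hcM hF, ← lintegral_const_mul' _ _ ENNReal.coe_ne_top]
  refine lintegral_congr fun g => ?_
  simp only [hsymm]
  rw [lintegral_mul_const _ (hbv g), hb'def]
  have h1 : (cM : ℝ≥0∞) * ((cK / cM : ℝ≥0) : ℝ≥0∞) = cK := by
    rw [← ENNReal.coe_mul, mul_div_cancel₀ _ hcM0]
  simp only
  rw [← h1]
  ring

theorem indFactor_left (hM : IsSplitExtension jG jV α)
    (hK : IsSplitExtension kN kV fun n => α (iN n)) (hcN : ∀ n, ι (kN n) = jG (iN n)) (n : N) :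
    indFactor ι (kN n) = indFactor iN n := by
  change ((NNReal.sqrt (modularFn (kN n) / modularFn (ι (kN n))) : ℝ) : ℂ) =
    ((NNReal.sqrt (modularFn n / modularFn (iN n)) : ℝ) : ℂ)
  rw [hcN, hM.modularFn_div_modularFn hK]

theorem indFactor_right (hM : IsSplitExtension jG jV α)
    (hK : IsSplitExtension kN kV fun n => α (iN n)) (hcV : ∀ v, ι (kV v) = jV v) (v : V) :
    indFactor ι (kV v) = 1 := by
  change ((NNReal.sqrt (modularFn (kV v) / modularFn (ι (kV v))) : ℝ) : ℂ) = 1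
  rw [hcV, hM.modularFn_right, hK.modularFn_right, div_one, NNReal.sqrt_one]
  simp

end IsSplitExtension

namespace UnitaryRep

/-- A function on `G ⋉ V` covariant under `N ⋉ V` is determined by a covariant function on `G`. -/
theorem exists_isCovariant_of_tensor (hM : IsSplitExtension jG jV α)
    (hK : IsSplitExtension kN kV fun n => α (iN n)) (hcN : ∀ n, ι (kN n) = jG (iN n))
    (hcV : ∀ v, ι (kV v) = jV v) {ξ : V →* Circle} (hξc : Continuous ξ)
    (hξ : ∀ g v, ξ (α g v) = ξ v) (σ : UnitaryRep N)
    {homK : K →* (σ.space ≃ₗᵢ[ℂ] σ.space)} (hKN : ∀ n, homK (kN n) = σ.hom n)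
    (hKV : ∀ v x, homK (kV v) x = (ξ v : ℂ) • x) {f : M → σ.space} (hfm : StronglyMeasurable f)
    (hf : ∀ k, ∀ᵐ x ∂(haar : Measure M), f (x * ι k) = indFactor ι k • (homK k)⁻¹ (f x)) :
    ∃ φ : G → σ.space, StronglyMeasurable φ ∧ IsCovariant iN σ φ ∧ ∀ᵐ x ∂(haar : Measure M),
      f x = (ξ (hM.coord.symm x).2 : ℂ)⁻¹ • φ (hM.coord.symm x).1 := by
  have hξne : ∀ v, (ξ v : ℂ) ≠ 0 := fun v => Circle.coe_ne_zero _
  -- Multiplication by `ξ` undoes covariance under `V`: the result is invariant under translations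
  -- of `v`, hence a function of `g`.
  set k : G × V → σ.space := fun p => (ξ p.2 : ℂ) • f (hM.coord p) with hkdef
  have hk : StronglyMeasurable k :=
    (((by fun_prop : Continuous fun z : Circle => (z : ℂ)).comp hξc).measurable.comp
      measurable_snd).stronglyMeasurable.smul
      (hfm.comp_measurable hM.coord.continuous.measurable)
  have hcovV : ∀ v, ∀ᵐ x ∂(haar : Measure M), f (x * jV v) = (ξ v : ℂ)⁻¹ • f x := by
    intro v
    filter_upwards [hf (kV v)] with x hx
    rw [← hcV, hx, hM.indFactor_right hK hcV, one_smul, ← map_inv, ← map_inv, hKV, map_inv,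
      Circle.coe_inv]
  obtain ⟨φ, hφm, hkφ⟩ := exists_ae_eq_comp_fst_of_forall_ae_mul_left (μ := (haar : Measure G))
    hk fun v => by
      filter_upwards [hM.quasiMeasurePreserving_coord.ae (hcovV v)] with p hp
      simp only [hkdef]
      -- Commutativity of `V` turns the left translation of the coordinate into right multiplication
      -- in `M`, to which covariance applies.
      have h1 : hM.coord (p.1, v * p.2) = hM.coord p * jV v := by
        rw [hM.coord_apply, hM.coord_apply, hM.comm, map_mul, mul_assoc]
      rw [h1, hp, smul_smul, map_mul, Circle.coe_mul]
      congr 1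
      have := hξne v
      field_simp
  have hφ : ∀ᵐ x ∂(haar : Measure M),
      f x = (ξ (hM.coord.symm x).2 : ℂ)⁻¹ • φ (hM.coord.symm x).1 := by
    filter_upwards [hM.quasiMeasurePreserving_coord_symm.ae hkφ] with x hx
    simp only [hkdef, Homeomorph.apply_symm_apply] at hx
    rw [← hx, inv_smul_smul₀ (hξne _)]
  refine ⟨φ, hφm, fun n => hM.ae_of_ae_comp_fst ?_, hφ⟩
  filter_upwards [hφ, ae_haar_of_mul_right hφ (jG (iN n)), hf (kN n)] with x h1 h2 h3
  change φ ((hM.coord.symm x).1 * iN n) = indFactor iN n • (σ.hom n)⁻¹ (φ (hM.coord.symm x).1)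
  rw [hcN, h2, h1, hM.indFactor_left hK hcN, hKN, hM.coord_symm_mul_right, hξ, map_smul,
    smul_comm (indFactor iN n)] at h3
  exact smul_right_injective σ.space (inv_ne_zero (hξne (hM.coord.symm x).2)) h3

/-- Covariance is multiplicative in `k`, so the factors in `N` and `V` are treated separately. An
element of `V` changes only the phase; an element of `N` leaves the phase alone because `ξ` is fixed
by the action. -/
theorem ae_covariant_tensor (hM : IsSplitExtension jG jV α)
    (hK : IsSplitExtension kN kV fun n => α (iN n)) (hcN : ∀ n, ι (kN n) = jG (iN n))
    (hcV : ∀ v, ι (kV v) = jV v) {ξ : V →* Circle} (hξ : ∀ g v, ξ (α g v) = ξ v)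
    (σ : UnitaryRep N) {homK : K →* (σ.space ≃ₗᵢ[ℂ] σ.space)} (hKN : ∀ n, homK (kN n) = σ.hom n)
    (hKV : ∀ v x, homK (kV v) x = (ξ v : ℂ) • x) {φ : G → σ.space} (hφ : IsCovariant iN σ φ)
    (k : K) : IsCovariantAt ι ⟨σ.space, homK⟩
      (fun x => (ξ (hM.coord.symm x).2 : ℂ)⁻¹ • φ (hM.coord.symm x).1) k := by
  rw [← hK.mul_coord_symm k]
  refine IsCovariantAt.mul ?_ ?_
  · filter_upwards [hM.ae_comp_fst (hφ (hK.coord.symm k).1)] with x hx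
    generalize (hK.coord.symm k).1 = n at hx
    replace hx : φ ((hM.coord.symm x).1 * iN n) =
      indFactor iN n • (σ.hom n)⁻¹ (φ (hM.coord.symm x).1) := hx
    change _ = indFactor ι (kN n) • (homK (kN n))⁻¹ _
    rw [hcN, hM.coord_symm_mul_right, hξ, hx, hM.indFactor_left hK hcN, hKN, map_smul,
      smul_comm (indFactor iN n)]
  · refine ae_of_all _ fun x => ?_
    generalize (hK.coord.symm k).2 = v
    change (ξ (hM.coord.symm (x * ι (kV v))).2 : ℂ)⁻¹ • φ (hM.coord.symm (x * ι (kV v))).1 =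
      indFactor ι (kV v) • (homK (kV v))⁻¹
        ((ξ (hM.coord.symm x).2 : ℂ)⁻¹ • φ (hM.coord.symm x).1)
    rw [hcV, hM.coord_symm_mul_right', hM.indFactor_right hK hcV, one_smul, ← map_inv, ← map_inv,
      hKV, map_inv, map_mul, Circle.coe_mul, Circle.coe_inv, mul_inv, mul_comm, mul_smul]

/-- Inducing `σ ⊗ ξ` from `N ⋉ V` to `G ⋉ V` amounts to inducing `σ` from `N` to `G`. -/
theorem ind_tensor_unitarilyEquivalent (hM : IsSplitExtension jG jV α)
    (hK : IsSplitExtension kN kV fun n => α (iN n)) (hcN : ∀ n, ι (kN n) = jG (iN n))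
    (hcV : ∀ v, ι (kV v) = jV v) (hN : IsClosedEmbedding iN) (hι : IsClosedEmbedding ι)
    {ξ : V →* Circle} (hξc : Continuous ξ) (hξ : ∀ g v, ξ (α g v) = ξ v) (σ : UnitaryRep N)
    {homK : K →* (σ.space ≃ₗᵢ[ℂ] σ.space)} (hKN : ∀ n, homK (kN n) = σ.hom n)
    (hKV : ∀ v x, homK (kV v) x = (ξ v : ℂ) • x)
    {homM : M →* ((ind iN hN σ).space ≃ₗᵢ[ℂ] (ind iN hN σ).space)}
    (hMG : ∀ g, homM (jG g) = (ind iN hN σ).hom g) (hMV : ∀ v f, homM (jV v) f = (ξ v : ℂ) • f) :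
    (ind ι hι ⟨σ.space, homK⟩).UnitarilyEquivalent ⟨(ind iN hN σ).space, homM⟩ := by
  obtain ⟨c, hc0, hc⟩ := hM.exists_forall_lintegral_coset hK hcN hcV hN hι
  have hb := (exists_isBruhat ι hι).choose_spec
  have hbN := (exists_isBruhat iN hN).choose_spec
  -- The square root of the Haar constant makes the correspondence isometric.
  set r : ℂ := ((NNReal.sqrt c : ℝ) : ℂ) with hr
  have hr0 : r ≠ 0 := by
    rw [hr]
    simpa using hc0
  have hsymm := hM.coord.symm.continuous.measurable
  have hξm : Measurable fun x : M => (ξ (hM.coord.symm x).2 : ℂ) :=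
    ((by fun_prop : Continuous fun z : Circle => (z : ℂ)).comp hξc).measurable.comp (measurable_snd.comp hsymm)
  let τ : UnitaryRep K := ⟨σ.space, homK⟩
  let π : UnitaryRep M := ⟨(ind iN hN σ).space, homM⟩
  let R : (ind ι hι τ).space → (ind iN hN σ).space → Prop := fun f φ =>
    ∀ᵐ x ∂(haar : Measure M),
      indFun f x = r • (ξ (hM.coord.symm x).2 : ℂ)⁻¹ • indFun φ (hM.coord.symm x).1
  have hlint : ∀ (f : M → σ.space) (φ : G → σ.space), StronglyMeasurable φ → IsCovariant iN σ φ →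
      (∀ᵐ x ∂(haar : Measure M),
        f x = r • (ξ (hM.coord.symm x).2 : ℂ)⁻¹ • φ (hM.coord.symm x).1) →
      ∫⁻ x, (exists_isBruhat ι hι).choose x * ‖f x‖ₑ ^ 2 ∂(haar : Measure M) =
        ∫⁻ g, (exists_isBruhat iN hN).choose g * ‖φ g‖ₑ ^ 2 ∂(haar : Measure G) := by
    intro f φ hφm hφ h
    rw [← hc _ (hφm.enorm.pow_const 2) hφ.enorm_sq]
    refine lintegral_congr_ae ?_
    filter_upwards [h] with x hx
    have h1 : ‖(ξ (hM.coord.symm x).2 : ℂ)⁻¹‖ₑ = 1 := by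
      rw [← Circle.coe_inv, ← ofReal_norm, Circle.norm_coe, ENNReal.ofReal_one]
    rw [hx, enorm_smul, enorm_smul, h1, one_mul, mul_pow, hr, enorm_coe_sqrt_sq]
  -- It suffices to check equivariance on the two factors, since every element of `M` is a product
  -- `g v`.
  have hmulR : ∀ m m', (∀ f φ, R f φ → R ((ind ι hι τ).hom m f) (homM m φ)) →
      (∀ f φ, R f φ → R ((ind ι hι τ).hom m' f) (homM m' φ)) →
      ∀ f φ, R f φ → R ((ind ι hι τ).hom (m * m') f) (homM (m * m') φ) := by
    intro m m' h h' f φ hR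
    rw [map_mul, map_mul]
    exact h _ _ (h' _ _ hR)
  refine .of_relation (π₁ := ind ι hι τ) (π₂ := π) R ?_ ?_ ?_ ?_ ?_ ?_
  · intro f φ f' φ' h h'
    filter_upwards [h, h', indFun_add f f', hM.ae_comp_fst (indFun_add φ φ')] with x h1 h2 h3 h4
    refine h3.trans ((congrArg₂ (· + ·) h1 h2).trans ?_)
    rw [← smul_add, ← smul_add, ← h4]
  · intro a f φ h
    filter_upwards [h, indFun_smul a f, hM.ae_comp_fst (indFun_smul a φ)] with x h1 h3 h4
    refine h3.trans ((congrArg (a • ·) h1).trans ?_)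
    rw [smul_comm a, smul_comm a, ← h4]
  · intro f φ h
    refine (ind_norm_eq hb.measurable hb.lintegral_eq_one f).trans
      (Eq.trans ?_ (ind_norm_eq hbN.measurable hbN.lintegral_eq_one φ).symm)
    congr 2
    exact hlint _ _ (stronglyMeasurable_indFun φ) (isCovariant_indFun φ) h
  · intro f
    obtain ⟨φ, hφm, hφ, hfφ⟩ := exists_isCovariant_of_tensor hM hK hcN hcV hξc hξ σ hKN hKV
      (stronglyMeasurable_indFun f) (isCovariant_indFun f)
    have hφm' : StronglyMeasurable fun g => r⁻¹ • φ g := hφm.const_smul _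
    have hφ' : IsCovariant iN σ fun g => r⁻¹ • φ g := fun n => by
      filter_upwards [hφ n] with g hg
      rw [hg, map_smul, smul_comm]
    have hR : ∀ᵐ x ∂(haar : Measure M), indFun f x =
        r • (ξ (hM.coord.symm x).2 : ℂ)⁻¹ • r⁻¹ • φ (hM.coord.symm x).1 := by
      filter_upwards [hfφ] with x hx
      rw [hx, smul_comm r, smul_inv_smul₀ hr0]
    obtain ⟨ψ, hψ⟩ := exists_indFun_ae_eq (hι := hN) (σ := σ) hbN.measurable hbN.lintegral_eq_one
      hφm'.aestronglyMeasurable hφ' (by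
        rw [← hlint _ _ hφm' hφ' hR]
        exact lintegral_indFun_lt_top hb.measurable hb.lintegral_eq_one f)
    refine ⟨ψ, ?_⟩
    filter_upwards [hR, hM.ae_comp_fst hψ] with x h1 h2
    rw [h2]
    exact h1
  · intro (φ : (ind iN hN σ).space)
    have hfm : StronglyMeasurable fun x =>
        r • (ξ (hM.coord.symm x).2 : ℂ)⁻¹ • indFun φ (hM.coord.symm x).1 :=
      (hξm.inv.stronglyMeasurable.smul ((stronglyMeasurable_indFun φ).comp_measurable
        (measurable_fst.comp hsymm))).const_smul _
    have hcov : IsCovariant ι τ fun x =>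
        r • (ξ (hM.coord.symm x).2 : ℂ)⁻¹ • indFun φ (hM.coord.symm x).1 := fun k => by
      filter_upwards [ae_covariant_tensor hM hK hcN hcV hξ σ hKN hKV (isCovariant_indFun φ) k]
        with x hx
      exact (congrArg (r • ·) hx).trans ((smul_comm r _ _).trans
        (congrArg _ (map_smul ((homK k)⁻¹) r _).symm))
    obtain ⟨F, hF⟩ := exists_indFun_ae_eq (hι := hι) (σ := τ) hb.measurable hb.lintegral_eq_one
      hfm.aestronglyMeasurable hcov (by
        refine lt_of_eq_of_lt (hlint _ _ (stronglyMeasurable_indFun φ) (isCovariant_indFun φ)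
          (ae_of_all _ fun x => rfl)) ?_
        exact lintegral_indFun_lt_top hbN.measurable hbN.lintegral_eq_one φ)
    exact ⟨F, hF⟩
  · intro m
    rw [← hM.mul_coord_symm m]
    refine hmulR _ _ (fun f φ h => ?_) (fun f φ h => ?_)
    · generalize (hM.coord.symm m).1 = g
      rw [hMG]
      filter_upwards [indFun_hom (jG g) f, hM.ae_comp_fst (indFun_hom g φ),
        ae_haar_of_mul_left h (jG g)⁻¹] with x h1 h2 h3
      refine h1.trans (h3.trans ?_)
      rw [h2, ← map_inv, hM.coord_symm_mul_left]
    · generalize (hM.coord.symm m).2 = v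
      rw [hMV]
      filter_upwards [indFun_hom (jV v) f, hM.ae_comp_fst (indFun_smul (ξ v : ℂ) φ),
        ae_haar_of_mul_left h (jV v)⁻¹] with x h1 h2 h3
      refine h1.trans (h3.trans ?_)
      -- Left translation by `v⁻¹` shifts the `V`-coordinate by `α g v⁻¹`, on which `ξ` takes the
      -- value `ξ v⁻¹` whatever `g` is; the translate is thus the scalar multiple by `ξ v`.
      rw [h2, ← map_inv, hM.coord_symm_mul_left', map_mul, hξ, map_inv, Circle.coe_mul,
        Circle.coe_inv, mul_inv, inv_inv, mul_smul, smul_comm (ξ v : ℂ)]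

end UnitaryRep

end TensorInduction

/-! ### Semidirect products of closed subgroups -/

namespace IsSemidirect

section

variable {Γ : Type*} [Group Γ] [TopologicalSpace Γ] [IsTopologicalGroup Γ] {G H V : Subgroup Γ}

theorem isHomeomorph_equiv (hS : IsSemidirect G H V) : IsHomeomorph hS.equiv := by
  have h : IsEmbedding hS.equiv :=
    IsEmbedding.of_comp (hS.isClosedEmbedding.continuous.subtype_mk _) continuous_subtype_val
      hS.isClosedEmbedding.isEmbedding
  exact isHomeomorph_iff_isEmbedding_surjective.2 ⟨h, hS.equiv.surjective⟩

theorem continuous_equiv_symm (hS : IsSemidirect G H V) : Continuous hS.equiv.symm :=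
  (hS.isHomeomorph_equiv.homeomorph _).symm.continuous.congr fun x => by
    rw [Equiv.eq_symm_apply]
    exact (hS.isHomeomorph_equiv.homeomorph _).apply_symm_apply x

theorem equiv_symm_left (hS : IsSemidirect G H V) (h : H) :
    hS.equiv.symm (Subgroup.inclusion hS.left_le h) = (1, h) := by
  rw [Equiv.symm_apply_eq]
  exact Subtype.ext (one_mul (h : Γ)).symm

theorem equiv_symm_right (hS : IsSemidirect G H V) (v : V) :
    hS.equiv.symm (Subgroup.inclusion hS.right_le v) = (v, 1) := by
  rw [Equiv.symm_apply_eq]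
  exact Subtype.ext (mul_one (v : Γ)).symm

theorem lift_left (hS : IsSemidirect G H V) {A : Type*} [Monoid A] {c : V →* A} {f : H →* A}
    (hcf : ∀ (h : H) (v : V), f h * c v = c (conjHom (hS.le_normalizer h.2) v) * f h) (h : H) :
    hS.lift c f hcf (Subgroup.inclusion hS.left_le h) = f h := by
  change c (hS.equiv.symm _).1 * f (hS.equiv.symm _).2 = _
  rw [equiv_symm_left, map_one, one_mul]

theorem lift_right (hS : IsSemidirect G H V) {A : Type*} [Monoid A] {c : V →* A} {f : H →* A}
    (hcf : ∀ (h : H) (v : V), f h * c v = c (conjHom (hS.le_normalizer h.2) v) * f h) (v : V) :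
    hS.lift c f hcf (Subgroup.inclusion hS.right_le v) = c v := by
  change c (hS.equiv.symm _).1 * f (hS.equiv.symm _).2 = _
  rw [equiv_symm_right, map_one, mul_one]

/-- `IsSemidirect` writes elements as `v h`, a split extension as `h v`. Inverting the group and
both factors exchanges the two orders, and the action becomes `v ↦ h⁻¹ v h`. -/
theorem isSplitExtension (hS : IsSemidirect G H V) (hc : ∀ v ∈ V, ∀ w ∈ V, v * w = w * v) :
    IsSplitExtension (Subgroup.inclusion hS.left_le) (Subgroup.inclusion hS.right_le)
      fun (h : H) v => conjHom (inv_mem (hS.le_normalizer h.2)) v where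
  isHomeomorph := by
    have h := ((Homeomorph.inv G).isHomeomorph.comp hS.isHomeomorph_equiv).comp
      (((Homeomorph.inv V).prodCongr (Homeomorph.inv H)).isHomeomorph.comp
        (Homeomorph.prodComm H V).isHomeomorph)
    convert h using 1
    ext p
    change (p.1 : Γ) * p.2 = ((p.2 : Γ)⁻¹ * (p.1 : Γ)⁻¹)⁻¹
    group
  mul_eq g v := Subtype.ext <| by
    change (v : Γ) * g = g * ((g : Γ)⁻¹ * v * (g : Γ)⁻¹⁻¹)
    group
  comm v w := Subtype.ext (hc v v.2 w w.2)

theorem continuous_tensorCharacter (hS : IsSemidirect G H V) {χ : H →* Circle}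
    (hχ : Continuous χ) (ξ : PontryaginDual V)
    (hξ : ∀ h : H, dualOrbitMap hS.le_normalizer ξ h = ξ) :
    Continuous (hS.tensorCharacter χ ξ hξ) :=
  ((map_continuous ξ).comp (continuous_fst.comp hS.continuous_equiv_symm)).mul
    (hχ.comp (continuous_snd.comp hS.continuous_equiv_symm))

theorem tensor_congr (hS : IsSemidirect G H V) {σ τ : UnitaryRep H} (h : σ.UnitarilyEquivalent τ)
    (ξ : PontryaginDual V) (hξ : ∀ h : H, dualOrbitMap hS.le_normalizer ξ h = ξ) :
    (hS.tensor σ ξ hξ).UnitarilyEquivalent (hS.tensor τ ξ hξ) := by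
  obtain ⟨U, hU⟩ := h
  refine ⟨U, fun g x => ?_⟩
  change U ((ξ (hS.equiv.symm g).1 : ℂ) • σ.hom (hS.equiv.symm g).2 x) =
    (ξ (hS.equiv.symm g).1 : ℂ) • τ.hom (hS.equiv.symm g).2 (U x)
  exact (map_smul U _ _).trans (congrArg _ (hU _ _))

theorem ofCharacter_tensorCharacter (hS : IsSemidirect G H V) (χ : H →* Circle)
    (ξ : PontryaginDual V) (hξ : ∀ h : H, dualOrbitMap hS.le_normalizer ξ h = ξ) :
    (UnitaryRep.ofCharacter (hS.tensorCharacter χ ξ hξ)).UnitarilyEquivalent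
      (hS.tensor (UnitaryRep.ofCharacter χ) ξ hξ) := by
  refine ⟨LinearIsometryEquiv.refl ℂ ℂ, fun g x => ?_⟩
  change ((ξ (hS.equiv.symm g).1 * χ (hS.equiv.symm g).2 : Circle) : ℂ) • x =
    (ξ (hS.equiv.symm g).1 : ℂ) • (χ (hS.equiv.symm g).2 : ℂ) • x
  rw [Circle.coe_mul, mul_smul]

end

variable {Γ : Type*} [Group Γ] [TopologicalSpace Γ] [IsTopologicalGroup Γ]
  [LocallyCompactSpace Γ] [T2Space Γ] [SecondCountableTopology Γ] [MeasurableSpace Γ] [BorelSpace Γ]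
  {G V N M K : Subgroup Γ}

/-- `Ind (σ ⊗ ξ) ≅ Ind σ ⊗ ξ` for the subgroup `K = N ⋉ V` of `M = G ⋉ V`. -/
theorem indSubgroup_tensor (hM : IsSemidirect M G V) (hK : IsSemidirect K N V) (hNG : N ≤ G)
    (hKM : K ≤ M) (hc : ∀ v ∈ V, ∀ w ∈ V, v * w = w * v) (σ : UnitaryRep N) (ξ : PontryaginDual V)
    (hξ : ∀ h : G, dualOrbitMap hM.le_normalizer ξ h = ξ)
    (hξ' : ∀ h : N, dualOrbitMap hK.le_normalizer ξ h = ξ) :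
    ((hK.tensor σ ξ hξ').indSubgroup hKM hK.isClosed hM.isClosed).UnitarilyEquivalent
      (hM.tensor (σ.indSubgroup hNG hK.isClosed_left hM.isClosed_left) ξ hξ) := by
  have : SecondCountableTopology G := IsEmbedding.subtypeVal.secondCountableTopology
  have : SecondCountableTopology V := IsEmbedding.subtypeVal.secondCountableTopology
  have : SecondCountableTopology N := IsEmbedding.subtypeVal.secondCountableTopology
  have : SecondCountableTopology M := IsEmbedding.subtypeVal.secondCountableTopology
  have : SecondCountableTopology K := IsEmbedding.subtypeVal.secondCountableTopology
  have : LocallyCompactSpace G := hM.isClosed_left.isClosedEmbedding_subtypeVal.locallyCompactSpace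
  have : LocallyCompactSpace V := hM.isClosed_right.isClosedEmbedding_subtypeVal.locallyCompactSpace
  have : LocallyCompactSpace N := hK.isClosed_left.isClosedEmbedding_subtypeVal.locallyCompactSpace
  have : LocallyCompactSpace M := hM.isClosed.isClosedEmbedding_subtypeVal.locallyCompactSpace
  have : LocallyCompactSpace K := hK.isClosed.isClosedEmbedding_subtypeVal.locallyCompactSpace
  exact UnitaryRep.ind_tensor_unitarilyEquivalent (iN := Subgroup.inclusion hNG)
    (hM.isSplitExtension hc) (hK.isSplitExtension hc) (fun _ => rfl) (fun _ => rfl) _ _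
    (ξ := (ξ : V →* Circle)) (map_continuous ξ) (fun g v => DFunLike.congr_fun (hξ g) v) σ
    (fun n => hK.lift_left _ n) (fun v x => by
      refine (DFunLike.congr_fun (hK.lift_right _ v) x).trans ?_
      rfl)
    (fun g => hM.lift_left _ g) (fun v f => by
      refine (DFunLike.congr_fun (hM.lift_right _ v) f).trans ?_
      rfl)

end IsSemidirect

/-! ### Induction between closed subgroups, and between trivial groups -/

namespace UnitaryRep

section

variable {Γ : Type*} [Group Γ] [TopologicalSpace Γ] [IsTopologicalGroup Γ]
  [LocallyCompactSpace Γ] [T2Space Γ] [SecondCountableTopology Γ] [MeasurableSpace Γ] [BorelSpace Γ]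
  {K M L : Subgroup Γ}

theorem UnitarilyEquivalent.indSubgroup {σ τ : UnitaryRep K} (h : σ.UnitarilyEquivalent τ)
    (hKL : K ≤ L) (hK : IsClosed (K : Set Γ)) (hL : IsClosed (L : Set Γ)) :
    (σ.indSubgroup hKL hK hL).UnitarilyEquivalent (τ.indSubgroup hKL hK hL) := by
  have : SecondCountableTopology K := IsEmbedding.subtypeVal.secondCountableTopology
  have : SecondCountableTopology L := IsEmbedding.subtypeVal.secondCountableTopology
  have : LocallyCompactSpace K := hK.isClosedEmbedding_subtypeVal.locallyCompactSpace
  have : LocallyCompactSpace L := hL.isClosedEmbedding_subtypeVal.locallyCompactSpace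
  exact h.ind _

theorem continuous_ofCharacter {G : Type*} [Group G] [TopologicalSpace G] {χ : G →* Circle}
    (hχ : Continuous χ) : Continuous fun p : G × ℂ => (ofCharacter χ).hom p.1 p.2 := by
  change Continuous fun p : G × ℂ => (χ p.1 : ℂ) • p.2
  fun_prop

theorem indSubgroup_ofCharacter_stages {χ : K →* Circle} (hχ : Continuous χ) (hKM : K ≤ M)
    (hML : M ≤ L) (hK : IsClosed (K : Set Γ)) (hM : IsClosed (M : Set Γ))
    (hL : IsClosed (L : Set Γ)) :
    ((ofCharacter χ).indSubgroup (hKM.trans hML) hK hL).UnitarilyEquivalent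
      (((ofCharacter χ).indSubgroup hKM hK hM).indSubgroup hML hM hL) := by
  have : SecondCountableTopology K := IsEmbedding.subtypeVal.secondCountableTopology
  have : SecondCountableTopology M := IsEmbedding.subtypeVal.secondCountableTopology
  have : SecondCountableTopology L := IsEmbedding.subtypeVal.secondCountableTopology
  have : LocallyCompactSpace K := hK.isClosedEmbedding_subtypeVal.locallyCompactSpace
  have : LocallyCompactSpace M := hM.isClosedEmbedding_subtypeVal.locallyCompactSpace
  have : LocallyCompactSpace L := hL.isClosedEmbedding_subtypeVal.locallyCompactSpace
  have : SecondCountableTopology (ofCharacter χ).space :=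
    inferInstanceAs (SecondCountableTopology ℂ)
  exact ind_unitarilyEquivalent_ind_ind (σ := ofCharacter χ) (continuous_ofCharacter hχ) _ _ _
    fun _ => rfl

end

/-- Induction between trivial groups only remembers the Hilbert space. -/
theorem ind_of_subsingleton {K L : Type*}
    [Group K] [TopologicalSpace K] [IsTopologicalGroup K] [LocallyCompactSpace K]
    [SecondCountableTopology K] [MeasurableSpace K] [BorelSpace K]
    [Group L] [TopologicalSpace L] [IsTopologicalGroup L] [LocallyCompactSpace L] [T2Space L]
    [SecondCountableTopology L] [MeasurableSpace L] [BorelSpace L] [Subsingleton K]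
    [Subsingleton L] {ι : K →* L} (hι : IsClosedEmbedding ι) {σ : UnitaryRep K}
    {π : UnitaryRep L} (U : σ.space ≃ₗᵢ[ℂ] π.space) : (ind ι hι σ).UnitarilyEquivalent π := by
  have hb := (exists_isBruhat ι hι).choose_spec
  set b := (exists_isBruhat ι hι).choose
  have hae : ∀ {p : L → Prop}, (∀ᵐ x ∂(haar : Measure L), p x) → ∀ x, p x := fun h x => by
    obtain ⟨y, hy⟩ := h.exists
    rwa [Subsingleton.elim x y]
  have hfin : (haar : Measure L) Set.univ ≠ ∞ :=
    (Set.subsingleton_univ.finite.isCompact).measure_lt_top.ne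
  have hpos : (haar : Measure L) Set.univ ≠ 0 := by simpa using NeZero.ne (haar : Measure L)
  -- The squared norm of `f` is `B * ‖f 1‖²`, so evaluation at 1 becomes isometric after rescaling
  -- by the square root of `B`.
  set B : ℝ≥0 := (b 1 * (haar : Measure L) Set.univ).toNNReal with hB
  have hBe : (B : ℝ≥0∞) = b 1 * (haar : Measure L) Set.univ :=
    ENNReal.coe_toNNReal (ENNReal.mul_ne_top (hb.ne_top 1) hfin)
  have hB0 : B ≠ 0 := fun h => mul_ne_zero (hb.ne_zero 1) hpos (by rw [← hBe, h, ENNReal.coe_zero])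
  have hint : ∀ f : L → σ.space,
      ∫⁻ x, b x * ‖f x‖ₑ ^ 2 ∂(haar : Measure L) = B * ‖f 1‖ₑ ^ 2 := by
    intro f
    have h1 : (fun x => b x * ‖f x‖ₑ ^ 2) = fun _ => b 1 * ‖f 1‖ₑ ^ 2 :=
      funext fun x => by rw [Subsingleton.elim x 1]
    rw [h1, lintegral_const, hBe]
    ring
  have hcov : ∀ f : L → σ.space, IsCovariant ι σ f := fun f k => by
    refine ae_of_all _ fun x => ?_
    change f (x * ι k) = indFactor ι k • (σ.hom k)⁻¹ (f x)
    rw [Subsingleton.elim k 1, map_one, map_one, map_one, mul_one, one_smul, inv_one]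
    rfl
  set r : ℂ := ((NNReal.sqrt B : ℝ) : ℂ) with hr
  have hr0 : r ≠ 0 := by
    rw [hr]
    simpa using hB0
  refine .of_relation (fun f z => U (r • indFun f 1) = z) ?_ ?_ ?_ ?_ ?_ ?_
  · rintro f _ f' _ rfl rfl
    rw [hae (indFun_add f f') 1, smul_add, map_add]
  · rintro c f _ rfl
    rw [hae (indFun_smul c f) 1, smul_comm, map_smul]
  · rintro f _ rfl
    have h := ind_enorm_sq hb.measurable hb.lintegral_eq_one f
    rw [hint, ← enorm_coe_sqrt_sq, ← hr, ← mul_pow, ← enorm_smul, ← ENNReal.rpow_ofNat,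
      ← ENNReal.rpow_ofNat] at h
    have h1 := ENNReal.rpow_left_injective (by norm_num) h
    rw [LinearIsometryEquiv.norm_map, ← toReal_enorm, h1, toReal_enorm]
  · intro f
    exact ⟨_, rfl⟩
  · intro z
    obtain ⟨f, hf⟩ := exists_indFun_ae_eq (hι := hι) (σ := σ) hb.measurable
      hb.lintegral_eq_one (f := fun _ => r⁻¹ • U.symm z)
      aestronglyMeasurable_const (hcov _) (by
        rw [hint]
        exact ENNReal.mul_lt_top ENNReal.coe_lt_top (by simp))
    refine ⟨f, ?_⟩
    rw [hae hf 1, smul_inv_smul₀ hr0, LinearIsometryEquiv.apply_symm_apply]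
  · rintro g f _ rfl
    rw [hae (indFun_hom g f) 1, Subsingleton.elim g 1, map_one, inv_one]
    simp only [one_mul]
    rfl

end UnitaryRep

/-! ### Induction along the tower -/

namespace DualOrbitTower

variable {Γ : Type u} [Group Γ] [TopologicalSpace Γ] [IsTopologicalGroup Γ]
  [LocallyCompactSpace Γ] [T2Space Γ] [SecondCountableTopology Γ] [MeasurableSpace Γ] [BorelSpace Γ]
  {ℓ : ℕ} (T : DualOrbitTower Γ ℓ)

/-- Induction in stages needs a jointly continuous action of the smallest group. -/
theorem continuous_chi (j : ℕ) (hj : j ≤ ℓ) : Continuous (T.chi j hj) := by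
  induction j with
  | zero => exact continuous_const
  | succ j ih => exact (T.semidirect_N hj).continuous_tensorCharacter (ih _) _ _

theorem ind_chi_unitarilyEquivalent_mackeyRep (j : ℕ) (hj : j ≤ ℓ) :
    ((UnitaryRep.ofCharacter (T.chi j hj)).indSubgroup (T.N_le_G hj) (T.isClosed_N hj)
      (T.isClosed_G hj)).UnitarilyEquivalent (T.mackeyRep j hj) := by
  induction j with
  | zero =>
    have : Subsingleton (T.N 0) := inferInstanceAs (Subsingleton (⊥ : Subgroup Γ))
    have : Subsingleton (T.G 0) := by
      rw [T.G_zero]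
      infer_instance
    have : SecondCountableTopology (T.N 0) := IsEmbedding.subtypeVal.secondCountableTopology
    have : SecondCountableTopology (T.G 0) := IsEmbedding.subtypeVal.secondCountableTopology
    have : LocallyCompactSpace (T.N 0) :=
      (T.isClosed_N hj).isClosedEmbedding_subtypeVal.locallyCompactSpace
    have : LocallyCompactSpace (T.G 0) :=
      (T.isClosed_G hj).isClosedEmbedding_subtypeVal.locallyCompactSpace
    -- The character of the trivial group acts on `ℂ` and the trivial representation on
    -- `EuclideanSpace ℂ PUnit`; the coordinates of a one-vector orthonormal basis identify the two
    -- spaces.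
    exact UnitaryRep.ind_of_subsingleton _ (σ := UnitaryRep.ofCharacter _)
      (π := UnitaryRep.trivial (T.G 0)) (OrthonormalBasis.singleton PUnit ℂ).repr
  | succ j ih =>
    have hN : T.N (j + 1) ≤ T.G j ⊔ T.V (j + 1) :=
      sup_le_sup_right (T.N_le_G (Nat.le_of_succ_le hj)) _
    -- `h1` inserts `G j ⋉ V (j+1)` as an intermediate group; `h2` and `h3` pull `ξ (j+1)` out of
    -- the inner induction; `h4` applies the induction hypothesis under the tensor product.
    have h1 := UnitaryRep.indSubgroup_ofCharacter_stages (T.continuous_chi (j + 1) hj) hN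
      (T.sup_le_G hj) (T.isClosed_N hj) (T.semidirect_G hj).isClosed (T.isClosed_G hj)
    have h2 := ((T.semidirect_N hj).ofCharacter_tensorCharacter
      (T.chi j (Nat.le_of_succ_le hj)) (T.ξ (j + 1))
      (T.G_fixes hj _ (T.N_le_G (Nat.le_of_succ_le hj)))).indSubgroup hN (T.isClosed_N hj)
        (T.semidirect_G hj).isClosed
    have h3 := (T.semidirect_G hj).indSubgroup_tensor (T.semidirect_N hj)
      (T.N_le_G (Nat.le_of_succ_le hj)) hN (T.comm j hj)
      (UnitaryRep.ofCharacter (T.chi j (Nat.le_of_succ_le hj))) (T.ξ (j + 1))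
      (T.G_fixes hj _ le_rfl) (T.G_fixes hj _ (T.N_le_G (Nat.le_of_succ_le hj)))
    have h4 := (T.semidirect_G hj).tensor_congr (ih (Nat.le_of_succ_le hj)) (T.ξ (j + 1))
      (T.G_fixes hj _ le_rfl)
    exact h1.trans (((h2.trans h3).trans h4).indSubgroup (T.sup_le_G hj) _ _)

end DualOrbitTower

theorem mainTheorem3 {Γ : Type u} [Group Γ] [TopologicalSpace Γ] [IsTopologicalGroup Γ]
    [LocallyCompactSpace Γ] [T2Space Γ] [SecondCountableTopology Γ] [MeasurableSpace Γ]
    [BorelSpace Γ] (ℓ : ℕ) (hℓ : 1 ≤ ℓ) (T : DualOrbitTower Γ ℓ) :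
    T.characterRep.UnitarilyEquivalent (T.mackeyRep ℓ le_rfl) :=
  T.ind_chi_unitarilyEquivalent_mackeyRep ℓ le_rfl
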